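/- **Conventions.** A *spectral triple* $X=(\mathcal A,\mathcal H,D)$ consists of a (not necessarily unital) C*-algebra $\mathcal A$ represented on a Hilbert space $\mathcal H$ and a self-adjoint operator $D$ on $\mathcal H$ with compact resolvent such that $C^1(X)=\{a\in\mathcal A:\ \|[D,a]\|<\infty\}$ is dense in $\mathcal A$. Its Lipschitz ball is $B_{Lip}(X)=\{a\in\mathcal A:\|[D,a]\|\le 1\}$ and its metric commutant is $\mathcal A_D'=\{a\in\mathcal A:[D,a]=0\}$. It is a *spectral metric space* if the representation is non-degenerate, if $\mathcal A_D'$ is trivial (it contains only multiples of the unit of $\mathcal A$; only $0$ if $\mathcal A$ has no unit), and if there is a strictly positive $h\in\mathcal A$ (that is, $h\ge 0$ and $h\mathcal A h$ is dense in $\mathcal A$) such that $hB_{Lip}(X)h$ has precompact image in $\mathcal A/\mathcal A_D'$. A $*$-automorphism $\alpha$ of $\mathcal A$ is *quasi-isometric* if $a\in C^1(X)\Leftrightarrow\alpha(a)\in C^1(X)$. It is *equicontinuous* if, for the group $G$ generated by $\alpha$, endowed with the topology of pointwise norm convergence, $C^1(X)$ equals the set $C^1_b(G,X)$ of those $a\in\mathcal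 A$ for which $[D,g(a)]$ is bounded for all $g\in G$, the map $g\mapsto[D,g(a)]$ is norm continuous on $G$, and $\sup_{g\in G}\|[D,g(a)]\|<\infty$. The crossed product $\mathcal A\rtimes_\alpha\mathbb Z$ is the universal C*-algebra generated by elements $au^n$ ($a\in\mathcal A$, $n\in\mathbb Z$), where $u$ is a unitary with $uau^{-1}=\alpha(a)$. $\mathcal A\otimes c_0(\mathbb Z)$ is the C*-algebra of sequences $b=(b_n)_{n\in\mathbb Z}$ in $\mathcal A$ with $\|b_n\|\to 0$ as $|n|\to\infty$. **Theorem.** Let $X=(\mathcal A,\mathcal H,D)$ be a spectral metric space and let $\alpha$ be a quasi-isometric $*$-automorphism of $\mathcal A$ that is not equicontinuous. Then there is a spectral metric space $Y=(\mathcal A\otimes c_0(\mathbb Z),\mathcal K,D_Y)$ (the *metric bundle*) of the following form: $\mathcal K=\mathcal H\otimes\ell^2(\mathbb Z\times\mathbb N_{\ge1})\otimes\mathbb C^4$, whose vectors are written $f=(f_{n,r})$ with $f_{n,r}\in\mathcal H\otimes\mathbb C^4$; the algebra acts by $$(bf)_{n,r}=\alpha^{-n}(b_n)f_{n,r};$$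 and $$D_Y=\tfrac{\gamma_1+i\gamma_2}{2}\nabla+\tfrac{\gamma_1-i\gamma_2}{2}\nabla^*+\lambda R+\gamma_5D,\qquad (\nabla f)_{n,r}=\frac{f_{n,r}-f_{n-r,r}}{d_r},\qquad (Rf)_{n,r}=(n\gamma_3+r\gamma_4)f_{n,r},$$ on the domain of all $f\in\mathcal K$ whose components lie in $\mathrm{dom}(D)\otimes\mathbb C^4$ and for which the resulting family is square summable. Here $\gamma_1,\dots,\gamma_5$ are self-adjoint $4\times4$ matrices with $\gamma_i\gamma_j+\gamma_j\gamma_i=2\delta_{ij}$, $\lambda$ is a nonzero real number, and $(d_j)_{j\ge 0}$ is a real sequence with $d_0=0$, $d_j>0$ for $j>0$, $d_i\le d_j+d_k$ whenever $i\le j+k$, and $\sup_jd_j=1$. Moreover: (i) $\mathcal A$ acts on $Y$ as a multiplier algebra: there is an injective $*$-homomorphism $m$ from $\mathcal A$ to the multiplier algebra of $\mathcal A\otimes c_0(\mathbb Z)$ given by $(ab)_n=ab_n$ and $(ba)_n=b_na$. (ii) The automorphism $\alpha_*$ of $\mathcal A\otimes c_0(\mathbb Z)$ given by $(\alpha_*(b))_n=\alpha(b_{n-1})$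 is equicontinuous on $Y$. (iii) There is a spectral metric space $Z=\big((\mathcal A\otimes c_0(\mathbb Z))\rtimes_{\alpha_*}\mathbb Z,\ \mathcal K,\ D_Y\big)$, with the same Hilbert space and Dirac operator as $Y$, in which $bu^l$ acts by $(bu^lf)_{n,r}=\alpha^{-n}(b_n)f_{n-l,r}$, and $\mathcal A\rtimes_\alpha\mathbb Z$ acts on it as a multiplier algebra: there is an injective $*$-homomorphism from $\mathcal A\rtimes_\alpha\mathbb Z$ to the multiplier algebra of $(\mathcal A\otimes c_0(\mathbb Z))\rtimes_{\alpha_*}\mathbb Z$ such that, for $a\in\mathcal A$, $b\in\mathcal A\otimes c_0(\mathbb Z)$ and $k,l\in\mathbb Z$, $$(au^k)(bu^l)=\big(a\,\alpha_*^k(b)\big)u^{k+l},\qquad (bu^l)(au^k)=\big(b\,\alpha^l(a)\big)u^{l+k},$$ where the products $a\,\alpha_*^k(b)$ and $b\,\alpha^l(a)$ are those of (i). -/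

import Mathlib

open scoped ZeroAtInfty InnerProductSpace ENNReal Topology MultiplierAlgebra

universe u v

noncomputable section

/-! ### Spectral triples and spectral metric spaces -/

section Operators

variable {H : Type v} [NormedAddCommGroup H] [InnerProductSpace ℂ H]

/-- `IsCommutator D T S`: the bounded operator `T` maps the domain of the (unbounded) operator `D`
into itself and `[D, T] = D T - T D`, defined on the domain of `D`, is the restriction of the
bounded operator `S`. -/
def IsCommutator (D : H →ₗ.[ℂ] H) (T S : H →L[ℂ] H) : Prop :=
  ∀ x : D.domain, ∃ h : T (x : H) ∈ D.domain, D ⟨T (x : H), h⟩ - T (D x) = S (x : H)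

/-- `D` has compact resolvent: for some `z`, the operator `D - z` is a bijection from the domain of
`D` onto `H` whose inverse `R` is a compact operator. -/
def HasCompactResolvent (D : H →ₗ.[ℂ] H) : Prop :=
  ∃ (z : ℂ) (R : H →L[ℂ] H), IsCompactOperator R ∧
    (∀ y : H, ∃ h : R y ∈ D.domain, D ⟨R y, h⟩ - z • R y = y) ∧
    (∀ x : D.domain, R (D x - z • (x : H)) = (x : H))

end Operators

/-- A spectral triple `(A, H, D)`: the C⋆-algebra `A` acts on the Hilbert space `H`, and `D` is a
self-adjoint operator with compact resolvent such that the set of elements of `A` having a bounded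
commutator with `D` is dense. -/
structure SpectralTriple (A : Type u) (H : Type v) [NonUnitalCStarAlgebra A]
    [NormedAddCommGroup H] [InnerProductSpace ℂ H] [CompleteSpace H] where
  /-- the action of the algebra -/
  rep : A →⋆ₙₐ[ℂ] (H →L[ℂ] H)
  /-- the Dirac operator -/
  D : H →ₗ.[ℂ] H
  isSelfAdjoint : IsSelfAdjoint D
  hasCompactResolvent : HasCompactResolvent D
  dense_C1 : Dense {a : A | ∃ S : H →L[ℂ] H, IsCommutator D (rep a) S}

section Algebra

variable {A : Type u} [NonUnitalCStarAlgebra A]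

/-- `a` is a multiple of the unit of `A`; if `A` has no unit this means that `a = 0`. -/
def IsMultipleOfUnit (a : A) : Prop :=
  a = 0 ∨ ∃ (e : A) (c : ℂ), (∀ x : A, e * x = x ∧ x * e = x) ∧ a = c • e

/-- A strictly positive element of a C⋆-algebra: `h ≥ 0` (that is, `h = k⋆ k` for some `k`) and
`h A h` is norm dense in `A`. -/
def IsStrictlyPositiveElement (h : A) : Prop :=
  (∃ k : A, h = star k * k) ∧ Dense (Set.range fun a : A => h * a * h)

/-- The topology of pointwise norm convergence on a group of `⋆`-automorphisms. -/
abbrev pointNormTopology (G : Subgroup (A ≃⋆ₐ[ℂ] A)) : TopologicalSpace G :=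
  TopologicalSpace.induced (fun (g : G) (a : A) => (g : A ≃⋆ₐ[ℂ] A) a) inferInstance

end Algebra

namespace SpectralTriple

variable {A : Type u} {H : Type v} [NonUnitalCStarAlgebra A]
  [NormedAddCommGroup H] [InnerProductSpace ℂ H] [CompleteSpace H] (X : SpectralTriple A H)

/-- `C¹(X)`: the elements `a` with `‖[D, a]‖ < ∞`. -/
def C1 : Set A := {a | ∃ S : H →L[ℂ] H, IsCommutator X.D (X.rep a) S}

/-- The Lipschitz ball: the elements `a` with `‖[D, a]‖ ≤ 1`. -/
def lipschitzBall : Set A := {a | ∃ S : H →L[ℂ] H, IsCommutator X.D (X.rep a) S ∧ ‖S‖ ≤ 1}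

/-- The metric commutant `{a ∈ A ; [D, a] = 0}`. -/
def metricCommutant : Submodule ℂ A where
  carrier := {a | IsCommutator X.D (X.rep a) 0}
  zero_mem' := fun x => by
    refine ⟨by simp, ?_⟩
    have h0 : (⟨X.rep 0 (x : H), by simp⟩ : X.D.domain) = 0 := by ext; simp
    rw [h0]; simp
  add_mem' := fun {a b} ha hb x => by
    obtain ⟨h1, e1⟩ := ha x
    obtain ⟨h2, e2⟩ := hb x
    have h3 : X.rep (a + b) (x : H) ∈ X.D.domain := by
      rw [map_add]; exact X.D.domain.add_mem h1 h2
    refine ⟨h3, ?_⟩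
    have e : (⟨X.rep (a + b) (x : H), h3⟩ : X.D.domain) = ⟨_, h1⟩ + ⟨_, h2⟩ := by
      ext; simp
    rw [e, LinearPMap.map_add, map_add, add_apply, add_sub_add_comm, e1, e2]
    simp
  smul_mem' := fun c a ha x => by
    obtain ⟨h1, e1⟩ := ha x
    have h3 : X.rep (c • a) (x : H) ∈ X.D.domain := by
      rw [map_smul]; exact X.D.domain.smul_mem c h1
    refine ⟨h3, ?_⟩
    have e : (⟨X.rep (c • a) (x : H), h3⟩ : X.D.domain) = c • ⟨_, h1⟩ := by
      ext; simp
    rw [e, LinearPMap.map_smul, map_smul, smul_apply, ← smul_sub, e1]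
    simp

/-- A (bounded) spectral metric space: (i) the representation is non-degenerate, (ii) the metric
commutant is trivial, (iii) there is a strictly positive element `h` such that `h B h`, where `B` is
the Lipschitz ball, has precompact image in the quotient of `A` by the metric commutant. -/
structure IsSpectralMetricSpace : Prop where
  nondegenerate :
    Dense (Submodule.span ℂ {y : H | ∃ (a : A) (x : H), y = X.rep a x} : Set H)
  commutant_trivial : ∀ a ∈ X.metricCommutant, IsMultipleOfUnit a
  precompact : ∃ h : A, IsStrictlyPositiveElement h ∧
    TotallyBounded (X.metricCommutant.mkQ '' ((fun a : A => h * a * h) '' X.lipschitzBall))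

/-- `C_b¹(G, X)`: the elements `a` such that `[D, g(a)]` is bounded for all `g ∈ G`, the map
`g ↦ [D, g(a)]` is norm continuous, and `sup_g ‖[D, g(a)]‖ < ∞`. -/
def C1b (G : Subgroup (A ≃⋆ₐ[ℂ] A)) : Set A :=
  {a | ∃ S : G → H →L[ℂ] H, (∀ g : G, IsCommutator X.D (X.rep ((g : A ≃⋆ₐ[ℂ] A) a)) (S g)) ∧
    Continuous[pointNormTopology G, inferInstance] S ∧ ∃ C : ℝ, ∀ g : G, ‖S g‖ ≤ C}

/-- The automorphism `α` is a quasi-isometry: `a ∈ C¹(X) ↔ α(a) ∈ C¹(X)`. -/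
def IsQuasiIsometry (α : A ≃⋆ₐ[ℂ] A) : Prop := ∀ a : A, a ∈ X.C1 ↔ α a ∈ X.C1

/-- The automorphism `α` is equicontinuous: `C¹(X) = C_b¹(G, X)` for the group `G` generated
by `α`. -/
def IsEquicontinuous (α : A ≃⋆ₐ[ℂ] A) : Prop := X.C1 = X.C1b (Subgroup.zpowers α)

end SpectralTriple

/-! ### The crossed product by `ℤ` -/

section CrossedProduct

variable {A : Type u} [NonUnitalCStarAlgebra A]

/-- A covariant representation of `(A, α)`: a representation `π` of `A` and a unitary `U` on a
Hilbert space with `U π(a) U⁻¹ = π(α(a))`. -/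
structure CovariantRep (α : A ≃⋆ₐ[ℂ] A) where
  space : Type u
  [instNormed : NormedAddCommGroup space]
  [instInner : InnerProductSpace ℂ space]
  [instComplete : CompleteSpace space]
  π : A →⋆ₙₐ[ℂ] (space →L[ℂ] space)
  U : unitary (space →L[ℂ] space)
  covariant : ∀ a : A,
    (U : space →L[ℂ] space) * π a * ((U⁻¹ : unitary (space →L[ℂ] space)) : space →L[ℂ] space)
      = π (α a)

attribute [instance] CovariantRep.instNormed CovariantRep.instInner CovariantRep.instComplete

/-- The C⋆-algebra of all bounded families of operators, one for each covariant representation of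
`(A, α)`. -/
abbrev CovariantFamilies (α : A ≃⋆ₐ[ℂ] A) : Type (u + 1) :=
  lp (fun ρ : CovariantRep α => ρ.space →L[ℂ] ρ.space) ∞

/-- The image `(π(a) Uⁿ)_{(π, U)}` of `a uⁿ` under the direct sum of all covariant representations
`(π, U)` of `(A, α)`. -/
def covariantMonomial (α : A ≃⋆ₐ[ℂ] A) (a : A) (n : ℤ) : CovariantFamilies α :=
  ⟨fun ρ => ρ.π a * ((ρ.U ^ n : unitary (ρ.space →L[ℂ] ρ.space)) : ρ.space →L[ℂ] ρ.space), by
    refine memℓp_infty ⟨‖a‖, ?_⟩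
    rintro _ ⟨ρ, rfl⟩
    refine (CStarRing.norm_mul_coe_unitary (ρ.π a) (ρ.U ^ n)).trans_le ?_
    exact NonUnitalStarAlgHom.norm_apply_le ρ.π a⟩

/-- The norm-closed `⋆`-algebra generated by the `a uⁿ`, in the direct sum of all covariant
representations. -/
def crossedProductSubalgebra (α : A ≃⋆ₐ[ℂ] A) :
    NonUnitalStarSubalgebra ℂ (CovariantFamilies α) :=
  (NonUnitalStarAlgebra.adjoin ℂ
    (Set.range fun p : A × ℤ => covariantMonomial α p.1 p.2)).topologicalClosure

/-- The (full) crossed product C⋆-algebra `A ⋊_α ℤ`: the universal C⋆-algebra generated by the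
elements `a uⁿ`, where `u` is a unitary with `u a u⁻¹ = α(a)`. Its norm is the supremum of the
norms in all covariant representations. -/
def CrossedProduct (α : A ≃⋆ₐ[ℂ] A) : Type (u + 1) := crossedProductSubalgebra α

instance (α : A ≃⋆ₐ[ℂ] A) : NonUnitalCStarAlgebra (CrossedProduct α) :=
  NonUnitalStarSubalgebra.nonUnitalCStarAlgebra (crossedProductSubalgebra α)
    (h_closed := NonUnitalStarSubalgebra.isClosed_topologicalClosure _)

/-- The element `a uⁿ` of `A ⋊_α ℤ`. -/
def CrossedProduct.monomial (α : A ≃⋆ₐ[ℂ] A) (a : A) (n : ℤ) : CrossedProduct α :=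
  ⟨covariantMonomial α a n, NonUnitalStarSubalgebra.le_topologicalClosure _
    (NonUnitalStarAlgebra.subset_adjoin ℂ _ ⟨(a, n), rfl⟩)⟩

end CrossedProduct

/-! ### The metric bundle

The C⋆-algebra `A ⊗ c₀(ℤ)` is `C₀(ℤ, A)`: sequences `(b_n)` in `A` with `b_n → 0` as `|n| → ∞`,
with pointwise operations and the supremum norm. -/

section MetricBundle

variable {A : Type u} [NonUnitalCStarAlgebra A]

/-- The map `b ↦ (φ(b_{n - k}))_n` on `A ⊗ c₀(ℤ)`. -/
def bundleShift (φ : A ≃⋆ₐ[ℂ] A) (k : ℤ) (b : C₀(ℤ, A)) : C₀(ℤ, A) where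
  toFun n := φ (b (n - k))
  continuous_toFun := continuous_of_discreteTopology
  zero_at_infty' := by
    have h1 : Filter.Tendsto (fun n : ℤ => n - k) (Filter.cocompact ℤ) (Filter.cocompact ℤ) :=
      (Homeomorph.subRight k).isClosedEmbedding.tendsto_cocompact
    have h2 : Filter.Tendsto (fun x : A => φ x) (𝓝 0) (𝓝 0) := by
      have hc : Continuous (fun x : A => φ x) := (NonUnitalStarAlgHom.isometry φ φ.injective).continuous
      simpa using hc.tendsto 0
    exact h2.comp ((zero_at_infty b).comp h1)

/-- The automorphism `α_*` of `A ⊗ c₀(ℤ)` induced by `α`: `(α_*(b))_n = α(b_{n-1})`. -/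
def bundleAut (α : A ≃⋆ₐ[ℂ] A) : C₀(ℤ, A) ≃⋆ₐ[ℂ] C₀(ℤ, A) where
  toFun := bundleShift α 1
  invFun := bundleShift α.symm (-1)
  left_inv b := by ext n; simp [bundleShift]
  right_inv b := by ext n; simp [bundleShift]
  map_mul' b c := by ext n; simp [bundleShift]
  map_add' b c := by ext n; simp [bundleShift]
  map_star' b := by ext n; simp [bundleShift, map_star]
  map_smul' c b := by ext n; simp [bundleShift]

/-- The Hilbert space `H ⊗ ℓ²(ℤ × ℕ₊) ⊗ ℂ⁴`; a vector `f` has components `f (n, r, i)` in `H`. -/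
abbrev BundleSpace (H : Type v) [NormedAddCommGroup H] [InnerProductSpace ℂ H] : Type v :=
  lp (fun _ : ℤ × ℕ+ × Fin 4 => H) 2

/-- The auxiliary data of a metric bundle: a bounded translation invariant metric
`d(m, n) = d_{|m - n|}` on `ℤ` with supremum `1`, a nonzero real number `coupling`, and five Dirac
matrices `γ 0, …, γ 4` acting on `ℂ⁴`. -/
structure BundleData where
  d : ℕ → ℝ
  d_zero : d 0 = 0
  d_pos : ∀ j, 0 < j → 0 < d j
  d_triangle : ∀ i j k, i ≤ j + k → d i ≤ d j + d k
  d_sup : IsLUB (Set.range d) 1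
  coupling : ℝ
  coupling_ne_zero : coupling ≠ 0
  γ : Fin 5 → Matrix (Fin 4) (Fin 4) ℂ
  γ_hermitian : ∀ j, (γ j).IsHermitian
  γ_clifford : ∀ j k, γ j * γ k + γ k * γ j = if j = k then 2 else 0

variable {H : Type v} [NormedAddCommGroup H] [InnerProductSpace ℂ H]

/-- The component at `(n, r, i)` of
`((γ₁ + iγ₂)/2) ∇f + ((γ₁ - iγ₂)/2) ∇*f + coupling * (n γ₃ + r γ₄) f + γ₅ y`, where
`(∇f)_{n,r} = (f_{n,r} - f_{n-r,r}) / d_r` and `(∇*f)_{n,r} = (f_{n,r} - f_{n+r,r}) / d_r`. -/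
def BundleData.diracFormula (𝔡 : BundleData) (f y : ℤ × ℕ+ × Fin 4 → H)
    (n : ℤ) (r : ℕ+) (i : Fin 4) : H :=
  ∑ j : Fin 4,
    (((𝔡.γ 0 i j + Complex.I * 𝔡.γ 1 i j) / 2 * ((𝔡.d r)⁻¹ : ℝ)) •
        (f (n, r, j) - f (n - (r : ℤ), r, j)) +
      ((𝔡.γ 0 i j - Complex.I * 𝔡.γ 1 i j) / 2 * ((𝔡.d r)⁻¹ : ℝ)) •
        (f (n, r, j) - f (n + (r : ℤ), r, j)) +
      ((𝔡.coupling : ℂ) * ((n : ℂ) * 𝔡.γ 2 i j + (r : ℂ) * 𝔡.γ 3 i j)) • f (n, r, j) +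
      𝔡.γ 4 i j • y (n, r, j))

variable [CompleteSpace H]

/-- The spectral triple `Y` on `A ⊗ c₀(ℤ)` is the metric bundle over `(X, α)` with auxiliary data
`𝔡`: the algebra acts by `(b f)_{n,r} = α⁻ⁿ(b_n) f_{n,r}`, and the Dirac operator is
`((γ₁ + iγ₂)/2) ∇ + ((γ₁ - iγ₂)/2) ∇* + coupling * (n γ₃ + r γ₄) + γ₅ D`, on the domain of all `f`
whose components lie in the domain of `D` and for which the result is square summable. (The
operator is described through its graph.) -/
structure SpectralTriple.IsMetricBundle (Y : SpectralTriple C₀(ℤ, A) (BundleSpace H))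
    (X : SpectralTriple A H) (α : A ≃⋆ₐ[ℂ] A) (𝔡 : BundleData) : Prop where
  rep_apply : ∀ (b : C₀(ℤ, A)) (f : BundleSpace H) (n : ℤ) (r : ℕ+) (i : Fin 4),
    Y.rep b f (n, r, i) = X.rep ((α ^ (-n)) (b n)) (f (n, r, i))
  mem_graph_iff : ∀ f g : BundleSpace H, (f, g) ∈ Y.D.graph ↔
    ∃ y : ℤ × ℕ+ × Fin 4 → H, (∀ k, (f k, y k) ∈ X.D.graph) ∧
      ∀ (n : ℤ) (r : ℕ+) (i : Fin 4), g (n, r, i) = 𝔡.diracFormula f y n r i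

end MetricBundle

end

/-! The auxiliary metric may be chosen, and the proof takes the discrete one, $d_r=1$ for $r>0$,
with coupling $1$. Then $\nabla$ is bounded, and $D_Y=P+B$ with $B$ bounded symmetric and
$(Pf)_k=\varepsilon_k D f_k+c_k f_{\tau(k)}$, where $\tau$ is an involution,
$\varepsilon_{\tau(k)}=-\varepsilon_k$, $c_{\tau(k)}=\overline{c_k}$ and $|c_k|^2=n^2+r^2$. The
signs cancel the cross terms, so $P^2=D^2+n^2+r^2$ is block diagonal; its blocks give an explicit
resolvent of $P$ whose norms tend to $0$, hence a compact one, and $B$ is absorbed by a Neumann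
series (`DiracTypeData.exists_inverse_zero`, `DiracTypeData.exists_inverse`).

On $\mathcal K$ an element $x$ of $(\mathcal A\otimes c_0(\mathbb Z))\rtimes\mathbb Z$ acts in every
fibre over $(r,i)$ by the same $\mathbb Z\times\mathbb Z$ matrix $(x_{nm})$ over $\mathcal A$; the
elements $\delta_n\otimes\alpha^n(c)\,u^{n-m}$ are matrix units with dense span. Let $S=[D_Y,x]$ be
bounded. One matrix entry of $S$ is $[D,x_{nm}]$ (`isCommutator_matCoeff`); another is
$x_{n,m+r}-x_{n-r,m}$ (`map_matCoeff_sub_eq_lpCoeff`). Since $d_r=1$ and $x_{n-r,m-r}\to0$ as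
$r\to\infty$, it follows that $\|x_{nm}\|\le\|S\|$ (`norm_matCoeff_le_of_isCommutator`). Hence the
metric commutant is $0$, and the coefficients of a Lipschitz element lie in the Lipschitz ball of
$X$ and in the unit ball of $\mathcal A$, a set whose compression by some strictly positive $h_0$ is
precompact in $\mathcal A$ itself. Compressing $x$ by the diagonal matrix with entries $4^{-|n|}h_0$
gives an absolutely convergent series in the $h_0x_{nm}h_0$, a continuous image of part of a product
of compact sets (`totallyBounded_crossedPositive`). This settles $Z$; $Y$ inherits it through the
isometric inclusion of $\mathcal A\otimes c_0(\mathbb Z)$.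

For (ii), translation in $n$ implements $\alpha_*$ and commutes with $D_Y$ up to a term that
commutes with the algebra, so $[D_Y,\alpha_*^k(b)]$ is a translate of $[D_Y,b]$. For the multipliers
in (iii), the regular representation of $\mathcal A\rtimes_\alpha\mathbb Z$ on $\mathcal K$
idealizes the faithful image of $(\mathcal A\otimes c_0(\mathbb Z))\rtimes\mathbb Z$, and it is
itself faithful by a Fourier argument with the dual circle action
(`CrossedProduct.eq_zero_of_forall_coeff`).

Failure of equicontinuity enters only to exclude $\alpha=1$, which forces $\mathcal A\ne0$ and a
faithful representation of $\mathcal A$. -/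

noncomputable section

/-! ### Symmetric and self-adjoint unbounded operators and their resolvents. -/

section Unbounded

variable {H : Type v} [NormedAddCommGroup H] [InnerProductSpace ℂ H]

/-- Symmetry makes $\langle Tx,x\rangle$ real, so the cross term with the imaginary scalar vanishes.
-/
theorem LinearPMap.IsFormalAdjoint.norm_sub_smul_sq {T : H →ₗ.[ℂ] H} (hT : T.IsFormalAdjoint T)
    (s : ℝ) (x : T.domain) :
    ‖T x - ((s : ℂ) * Complex.I) • (x : H)‖ ^ 2 = ‖T x‖ ^ 2 + s ^ 2 * ‖(x : H)‖ ^ 2 := by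
  have h1 : (starRingEnd ℂ) ⟪T x, (x : H)⟫_ℂ = ⟪T x, (x : H)⟫_ℂ := by
    rw [inner_conj_symm]; exact (hT x x).symm
  have h2 : (⟪T x, (x : H)⟫_ℂ).im = 0 := Complex.conj_eq_iff_im.1 h1
  rw [@norm_sub_sq ℂ, inner_smul_right, norm_smul]
  simp [h2, mul_pow]

theorem LinearPMap.IsFormalAdjoint.norm_le {T : H →ₗ.[ℂ] H} (hT : T.IsFormalAdjoint T)
    (s : ℝ) (x : T.domain) :
    |s| * ‖(x : H)‖ ≤ ‖T x - ((s : ℂ) * Complex.I) • (x : H)‖ := by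
  refine abs_le_of_sq_le_sq' ?_ (norm_nonneg _) |>.2
  rw [hT.norm_sub_smul_sq, mul_pow, sq_abs]
  nlinarith [sq_nonneg ‖T x‖]

/-- The bounded inverse of `T - is` for a symmetric operator `T` such that `T - is` is onto. -/
theorem LinearPMap.IsFormalAdjoint.exists_resolvent {T : H →ₗ.[ℂ] H} (hf : T.IsFormalAdjoint T)
    {s : ℝ} (hs : s ≠ 0)
    (hsurj : ∀ y, ∃ x : T.domain, T x - ((s : ℂ) * Complex.I) • (x : H) = y) :
    ∃ R : H →L[ℂ] H, ‖R‖ ≤ |s|⁻¹ ∧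
      (∀ y : H, ∃ h : R y ∈ T.domain, T ⟨R y, h⟩ - ((s : ℂ) * Complex.I) • R y = y) ∧
      (∀ x : T.domain, R (T x - ((s : ℂ) * Complex.I) • (x : H)) = (x : H)) := by
  let L : T.domain →ₗ[ℂ] H := T.toFun - ((s : ℂ) * Complex.I) • T.domain.subtype
  have hL : ∀ x, L x = T x - ((s : ℂ) * Complex.I) • (x : H) := fun x => rfl
  have hinj : Function.Injective L := by
    rw [← LinearMap.ker_eq_bot, LinearMap.ker_eq_bot']
    intro x hx
    have h := hf.norm_le s x
    rw [← hL, hx, norm_zero] at h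
    have h' : ‖(x : H)‖ ≤ 0 := by
      by_contra hc; push Not at hc
      have := mul_pos (abs_pos.2 hs) hc
      linarith
    exact Subtype.ext (norm_le_zero_iff.1 h')
  let e := LinearEquiv.ofBijective L ⟨hinj, hsurj⟩
  let R0 : H →ₗ[ℂ] H := T.domain.subtype ∘ₗ e.symm.toLinearMap
  have hb : ∀ y, ‖R0 y‖ ≤ |s|⁻¹ * ‖y‖ := by
    intro y
    have h := hf.norm_le s (e.symm y)
    have h2 : L (e.symm y) = y := e.apply_symm_apply y
    rw [← hL, h2] at h
    rw [← div_eq_inv_mul, le_div_iff₀ (abs_pos.2 hs), mul_comm]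
    exact h
  refine ⟨R0.mkContinuous _ hb, R0.mkContinuous_norm_le (by positivity) hb, fun y => ?_, fun x => ?_⟩
  · refine ⟨(e.symm y).2, ?_⟩
    exact e.apply_symm_apply y
  · have : e.symm (L x) = x := e.symm_apply_apply x
    change ((e.symm (L x) : T.domain) : H) = x
    rw [this]

/-- The resolvent identity $R=R_0(1+(z-z_0)R)$ carries compactness from the one point where it is
known to any other. -/
theorem HasCompactResolvent.isCompactOperator {T : H →ₗ.[ℂ] H} (hT : HasCompactResolvent T)
    {z : ℂ} {R : H →L[ℂ] H} (hR : ∀ y : H, ∃ h : R y ∈ T.domain, T ⟨R y, h⟩ - z • R y = y) :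
    IsCompactOperator R := by
  obtain ⟨z0, R0, hc, h1, h2⟩ := hT
  have e : R = R0 ∘L (1 + (z - z0) • R) := by
    ext y
    obtain ⟨h, hy⟩ := hR y
    have h3 := h2 ⟨R y, h⟩
    have h4 : T ⟨R y, h⟩ - z0 • R y = y + (z - z0) • R y := by
      rw [sub_smul, ← add_sub_assoc, sub_left_inj, ← sub_eq_iff_eq_add, hy]
    simp only at h3
    rw [h4] at h3
    exact h3.symm
  rw [e]
  exact hc.comp_clm _

variable [CompleteSpace H]

/-- The basic criterion: a vector orthogonal to the domain is killed by surjectivity at $z$ and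
$\bar z$, and a vector of $\mathrm{dom}(T^*)$ differs from one of $\mathrm{dom}(T)$ by something
orthogonal to the range of $T-\bar z$. -/
theorem LinearPMap.IsFormalAdjoint.isSelfAdjoint {T : H →ₗ.[ℂ] H} (hT : T.IsFormalAdjoint T)
    (z : ℂ) (h1 : ∀ y, ∃ x : T.domain, T x - z • (x : H) = y)
    (h2 : ∀ y, ∃ x : T.domain, T x - (starRingEnd ℂ z) • (x : H) = y) : IsSelfAdjoint T := by
  have hd : Dense (T.domain : Set H) := by
    rw [Submodule.dense_iff_topologicalClosure_eq_top, Submodule.topologicalClosure_eq_top_iff,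
      Submodule.eq_bot_iff]
    intro v hv
    rw [Submodule.mem_orthogonal] at hv
    obtain ⟨w, rfl⟩ := h1 v
    have h3 : ∀ x : T.domain, ⟪T x - (starRingEnd ℂ z) • (x : H), (w : H)⟫_ℂ = 0 := by
      intro x
      rw [← hv x x.2, inner_sub_left, inner_sub_right, hT x w, inner_smul_left, inner_smul_right]
      simp
    obtain ⟨x, hx⟩ := h2 (w : H)
    have h4 := h3 x
    rw [hx, inner_self_eq_zero] at h4
    have h5 : w = 0 := Subtype.ext h4
    rw [h5]; simp
  rw [LinearPMap.isSelfAdjoint_def]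
  have hle : T ≤ T.adjoint := hT.le_adjoint hd
  refine (LinearPMap.eq_of_le_of_domain_eq hle (le_antisymm hle.1 ?_)).symm
  intro y hy
  obtain ⟨x, hx⟩ := h1 (T.adjoint ⟨y, hy⟩ - z • y)
  have key : ∀ u : T.domain, ⟪T u - (starRingEnd ℂ z) • (u : H), y - x⟫_ℂ = 0 := by
    intro u
    have e1 : ⟪T.adjoint ⟨y, hy⟩, (u : H)⟫_ℂ = ⟪y, T u⟫_ℂ := T.adjoint_isFormalAdjoint hd ⟨y, hy⟩ u
    have e2 : ⟪T x, (u : H)⟫_ℂ = ⟪(x : H), T u⟫_ℂ := hT x u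
    have e3 : T.adjoint ⟨y, hy⟩ - T x = z • (y - x) := by
      rw [smul_sub, sub_eq_sub_iff_add_eq_add]
      rw [sub_eq_sub_iff_add_eq_add] at hx
      rw [← hx, add_comm]
    have e4 : ⟪y - x, T u⟫_ℂ = ⟪z • (y - x), (u : H)⟫_ℂ := by
      rw [← e3, inner_sub_left, inner_sub_left, e1, e2]
    rw [← inner_conj_symm, inner_sub_right, e4, inner_smul_left, inner_smul_right]; simp
  obtain ⟨u, hu⟩ := h2 (y - x)
  have h6 := key u
  rw [hu, inner_self_eq_zero, sub_eq_zero] at h6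
  rw [h6]; exact x.2

theorem IsSelfAdjoint.isFormalAdjoint {T : H →ₗ.[ℂ] H} (hT : IsSelfAdjoint T) :
    T.IsFormalAdjoint T := by
  have h := T.adjoint_isFormalAdjoint hT.dense_domain
  rwa [(LinearPMap.isSelfAdjoint_def).1 hT] at h

/-- For self-adjoint `T` and real `s ≠ 0`, the operator `T - is` is onto. -/
theorem IsSelfAdjoint.surjective_sub_smul {T : H →ₗ.[ℂ] H} (hT : IsSelfAdjoint T) {s : ℝ}
    (hs : s ≠ 0) (y : H) : ∃ x : T.domain, T x - ((s : ℂ) * Complex.I) • (x : H) = y := by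
  have hf := hT.isFormalAdjoint
  let L : T.domain →ₗ[ℂ] H := T.toFun - ((s : ℂ) * Complex.I) • T.domain.subtype
  have hL : ∀ x, L x = T x - ((s : ℂ) * Complex.I) • (x : H) := fun x => rfl
  suffices h : LinearMap.range L = ⊤ by
    obtain ⟨x, hx⟩ := LinearMap.range_eq_top.1 h y
    exact ⟨x, hx⟩
  -- The lower bound `norm_le` makes preimages of a convergent sequence Cauchy, and the graph is
  -- closed.
  have hcl : IsClosed (LinearMap.range L : Set H) := by
    refine isClosed_of_closure_subset fun v hv => ?_
    obtain ⟨g, hg, hgv⟩ := mem_closure_iff_seq_limit.1 hv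
    choose x hx using hg
    have hc : CauchySeq fun n => (x n : H) := by
      have hcg := hgv.cauchySeq
      rw [Metric.cauchySeq_iff] at hcg ⊢
      intro ε hε
      obtain ⟨N, hN⟩ := hcg (|s| * ε) (by positivity)
      refine ⟨N, fun m hm n hn => ?_⟩
      have h1 := hN m hm n hn
      rw [dist_eq_norm, ← hx, ← hx, ← map_sub, hL] at h1
      have h2 := (hf.norm_le s (x m - x n)).trans_lt h1
      rw [dist_eq_norm]
      exact lt_of_mul_lt_mul_left h2 (abs_nonneg s)
    obtain ⟨x0, hx0⟩ := cauchySeq_tendsto_of_complete hc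
    have hTx : Filter.Tendsto (fun n => T (x n)) Filter.atTop
        (𝓝 (v + ((s : ℂ) * Complex.I) • x0)) := by
      have : (fun n => T (x n)) = fun n => g n + ((s : ℂ) * Complex.I) • (x n : H) := by
        ext n; rw [← hx, hL]; abel
      rw [this]
      exact hgv.add (hx0.const_smul _)
    have hmem : (x0, v + ((s : ℂ) * Complex.I) • x0) ∈ T.graph := by
      refine hT.isClosed.mem_of_tendsto (hx0.prodMk_nhds hTx) (Filter.Eventually.of_forall fun n => ?_)
      exact T.mem_graph (x n)
    rw [LinearPMap.mem_graph_iff] at hmem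
    obtain ⟨y0, hy1, hy2⟩ := hmem
    refine ⟨y0, ?_⟩
    simp only at hy1 hy2
    rw [hL, hy1, hy2]; simp
  rw [← hcl.submodule_topologicalClosure_eq, Submodule.topologicalClosure_eq_top_iff,
    Submodule.eq_bot_iff]
  intro w hw
  rw [Submodule.mem_orthogonal] at hw
  -- Orthogonality to the range says $T^*w=-is\,w$. As $T^*=T$, this is an imaginary eigenvalue of
  -- $T$, which the lower bound at $-s$ forbids unless $w=0$.
  have h1 : ∀ x : T.domain, ⟪(-((s : ℂ) * Complex.I)) • w, (x : H)⟫_ℂ = ⟪w, T x⟫_ℂ := by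
    intro x
    have h2 := hw (L x) ⟨x, rfl⟩
    rw [hL, ← inner_conj_symm, map_eq_zero, inner_sub_right, sub_eq_zero, inner_smul_right] at h2
    rw [h2, inner_smul_left]; simp
  have h2 : w ∈ T.adjoint.domain := T.mem_adjoint_domain_of_exists w ⟨_, h1⟩
  have h3 := T.adjoint_apply_eq hT.dense_domain ⟨w, h2⟩ h1
  have h4 : ∃ hw : w ∈ T.domain, T ⟨w, hw⟩ = (-((s : ℂ) * Complex.I)) • w := by
    have e := (LinearPMap.isSelfAdjoint_def).1 hT
    have : (w, (-((s : ℂ) * Complex.I)) • w) ∈ T.adjoint.graph := by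
      rw [← h3]; exact T.adjoint.mem_graph ⟨w, h2⟩
    rw [e, LinearPMap.mem_graph_iff] at this
    obtain ⟨a, ha, hb⟩ := this
    simp only at ha hb
    subst ha
    exact ⟨a.2, hb⟩
  obtain ⟨h5, h6⟩ := h4
  have h7 := hf.norm_le (-s) ⟨w, h5⟩
  rw [h6] at h7
  simp only [Complex.ofReal_neg, neg_mul, sub_self, norm_zero, abs_neg] at h7
  have : ‖w‖ = 0 := by
    by_contra hne
    have : 0 < |s| * ‖w‖ := mul_pos (abs_pos.2 hs) (lt_of_le_of_ne (norm_nonneg _) (Ne.symm hne))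
    linarith
  exact norm_eq_zero.1 this

end Unbounded

/-! ### Block diagonal and permutation operators on $\ell^2(I,H)$. -/

section LpOperators

variable {I : Type*} {H : Type v} [NormedAddCommGroup H] [InnerProductSpace ℂ H]

theorem lp_two_norm_le_of_apply_le {f g : lp (fun _ : I => H) 2} {C : ℝ} (hC : 0 ≤ C)
    (h : ∀ i, ‖f i‖ ≤ C * ‖g i‖) : ‖f‖ ≤ C * ‖g‖ := by
  have h1 : ‖f‖ ≤ ‖(C : ℂ) • g‖ := lp.norm_mono (by norm_num) fun i => by
    rw [lp.coeFn_smul, Pi.smul_apply, norm_smul]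
    simpa [abs_of_nonneg hC] using h i
  rw [norm_smul] at h1
  simpa [abs_of_nonneg hC] using h1

/-- The block diagonal operator on `ℓ²(I, H)` with entries `T i`. -/
def lpDiag (T : I → H →L[ℂ] H) (hT : ∃ C, ∀ i, ‖T i‖ ≤ C) :
    lp (fun _ : I => H) 2 →L[ℂ] lp (fun _ : I => H) 2 :=
  LinearMap.mkContinuousOfExistsBound
    { toFun := fun f => ⟨fun i => T i (f i), by
        obtain ⟨C, hC⟩ := hT
        refine (((lp.memℓp f).norm).const_mul C).mono (fun i => ?_)
        exact (T i).le_of_opNorm_le (hC i) (f i)⟩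
      map_add' := fun f g => by ext i; exact (T i).map_add _ _
      map_smul' := fun c f => by ext i; exact (T i).map_smul _ _ } (by
    obtain ⟨C, hC⟩ := hT
    refine ⟨max C 0, fun f => lp_two_norm_le_of_apply_le (le_max_right _ _) fun i => ?_⟩
    exact (T i).le_of_opNorm_le ((hC i).trans (le_max_left _ _)) (f i))

@[simp]
theorem lpDiag_apply (T : I → H →L[ℂ] H) (hT) (f : lp (fun _ : I => H) 2) (i : I) :
    lpDiag T hT f i = T i (f i) := rfl

/-- The finite truncations are compact, and the error of a truncation is at most the supremum of the
omitted block norms. -/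
theorem isCompactOperator_lpDiag [CompleteSpace H] (T : I → H →L[ℂ] H) (hT)
    (hc : ∀ i, IsCompactOperator (T i))
    (h0 : Filter.Tendsto (fun i => ‖T i‖) Filter.cofinite (𝓝 0)) :
    IsCompactOperator (lpDiag T hT) := by
  classical
  let F : Finset I → lp (fun _ : I => H) 2 →L[ℂ] lp (fun _ : I => H) 2 := fun s =>
    ∑ i ∈ s, (lp.singleContinuousLinearMap ℂ (fun _ : I => H) 2 i ∘L T i) ∘L
      lp.evalCLM ℂ (fun _ : I => H) 2 i
  have hF : ∀ s (f : lp (fun _ : I => H) 2) j, F s f j = if j ∈ s then T j (f j) else 0 := by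
    intro s f j
    simp only [F, sum_apply, lp.coeFn_sum, Finset.sum_apply]
    change ∑ i ∈ s, (Pi.single i (T i (f i)) : I → H) j = _
    simp [Pi.single_apply]
  refine isCompactOperator_of_tendsto (l := Filter.atTop) (F := F) (f := lpDiag T hT) ?_
    (Filter.Eventually.of_forall fun s => ?_)
  · rw [Metric.tendsto_atTop]
    intro ε hε
    have hfin : {i | ¬ ‖T i‖ < ε / 2}.Finite := by
      have := h0.eventually (gt_mem_nhds (half_pos hε))
      exact this
    refine ⟨hfin.toFinset, fun s hs => ?_⟩
    rw [dist_eq_norm]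
    refine lt_of_le_of_lt ?_ (half_lt_self hε)
    refine ContinuousLinearMap.opNorm_le_bound _ (half_pos hε).le fun f => ?_
    refine lp_two_norm_le_of_apply_le (half_pos hε).le fun j => ?_
    change ‖F s f j - T j (f j)‖ ≤ _
    rw [hF]
    split_ifs with hj
    · rw [sub_self, norm_zero]; positivity
    · rw [zero_sub, norm_neg]
      refine (T j).le_of_opNorm_le (le_of_lt ?_) (f j)
      by_contra hc
      exact hj (hs (hfin.mem_toFinset.2 hc))
  · change F s ∈ compactOperator (RingHom.id ℂ) _ _
    refine Submodule.sum_mem _ fun i _ => ?_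
    exact ((hc i).clm_comp (lp.singleContinuousLinearMap ℂ (fun _ : I => H) 2 i)).comp_clm
      (lp.evalCLM ℂ (fun _ : I => H) 2 i)

/-- The operator `f ↦ f ∘ e` on `ℓ²(I, H)`. -/
def lpReindex (e : I ≃ I) : lp (fun _ : I => H) 2 →ₗᵢ[ℂ] lp (fun _ : I => H) 2 where
  toFun f := ⟨fun i => f (e i), by
    have h := (lp.memℓp f).summable (by norm_num)
    exact memℓp_gen (h.comp_injective e.injective)⟩
  map_add' f g := by ext i; rfl
  map_smul' c f := by ext i; rfl
  norm_map' f := by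
    rw [lp.norm_eq_tsum_rpow (by norm_num), lp.norm_eq_tsum_rpow (by norm_num)]
    congr 1
    exact e.tsum_eq (fun i => ‖f i‖ ^ (2 : ℝ≥0∞).toReal)

@[simp]
theorem lpReindex_apply (e : I ≃ I) (f : lp (fun _ : I => H) 2) (i : I) :
    lpReindex e f i = f (e i) := rfl

/-- The unitary operator `f ↦ f ∘ e⁻¹` on `ℓ²(I, H)`, as a homomorphism in the permutation `e`. -/
def lpPerm [CompleteSpace H] :
    Equiv.Perm I →* unitary (lp (fun _ : I => H) 2 →L[ℂ] lp (fun _ : I => H) 2) where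
  toFun e := Unitary.linearIsometryEquiv.symm
    { toLinearEquiv := LinearEquiv.ofLinearMap (lpReindex e⁻¹).toLinearMap (lpReindex e).toLinearMap
        (by ext f i; simp) (by ext f i; simp)
      norm_map' := fun f => (lpReindex e⁻¹).norm_map f }
  map_one' := by ext f i; simp
  map_mul' e e' := by ext f i; simp; rfl

theorem lpPerm_apply [CompleteSpace H] (e : Equiv.Perm I) (f : lp (fun _ : I => H) 2) (i : I) :
    ((lpPerm e : unitary (lp (fun _ : I => H) 2 →L[ℂ] lp (fun _ : I => H) 2)) :
      lp (fun _ : I => H) 2 →L[ℂ] lp (fun _ : I => H) 2) f i = f (e⁻¹ i) := rfl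

/-- The representation of an algebra on `ℓ²(I, H)` by block diagonal operators, given by a family of
representations on `H`. -/
def lpDiagRep {B : Type*} [NonUnitalCStarAlgebra B] [CompleteSpace H]
    (π : I → B →⋆ₙₐ[ℂ] (H →L[ℂ] H)) :
    B →⋆ₙₐ[ℂ] (lp (fun _ : I => H) 2 →L[ℂ] lp (fun _ : I => H) 2) where
  toFun b := lpDiag (fun i => π i b) ⟨‖b‖, fun i => NonUnitalStarAlgHom.norm_apply_le (π i) b⟩
  map_smul' c b := by ext f i; simp
  map_zero' := by ext f i; simp
  map_add' b b' := by ext f i; simp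
  map_mul' b b' := by ext f i; simp
  map_star' b := by
    rw [ContinuousLinearMap.star_eq_adjoint, ContinuousLinearMap.eq_adjoint_iff]
    intro f g
    rw [lp.inner_eq_tsum, lp.inner_eq_tsum]
    refine tsum_congr fun i => ?_
    rw [lpDiag_apply, lpDiag_apply, map_star, ContinuousLinearMap.star_eq_adjoint,
      ContinuousLinearMap.adjoint_inner_left]

@[simp]
theorem lpDiagRep_apply {B : Type*} [NonUnitalCStarAlgebra B] [CompleteSpace H]
    (π : I → B →⋆ₙₐ[ℂ] (H →L[ℂ] H)) (b : B) (f : lp (fun _ : I => H) 2) (i : I) :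
    lpDiagRep π b f i = π i b (f i) := rfl

end LpOperators

/-! ### Dirac type operators: self-adjointness and compact resolvent. -/

section DiracType

variable {H : Type v} [NormedAddCommGroup H] [InnerProductSpace ℂ H]

theorem LinearPMap.exists_eq_of_mem_graph {T : H →ₗ.[ℂ] H} {x y : H} (h : (x, y) ∈ T.graph) :
    ∃ hx : x ∈ T.domain, T ⟨x, hx⟩ = y := by
  obtain ⟨a, rfl, rfl⟩ := (LinearPMap.mem_graph_iff _).1 h
  exact ⟨a.2, rfl⟩

/-- The operators `G = (D² + s²)⁻¹` and `K = D (D² + s²)⁻¹` for a self-adjoint operator `D` with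
compact resolvent. -/
theorem exists_compact_inverse_sq_add_sq [CompleteSpace H] {D : H →ₗ.[ℂ] H} (hD : IsSelfAdjoint D)
    (hc : HasCompactResolvent D) {s : ℝ} (hs : 0 < s) :
    ∃ G K : H →L[ℂ] H, IsCompactOperator G ∧ IsCompactOperator K ∧ ‖G‖ ≤ s⁻¹ * s⁻¹ ∧ ‖K‖ ≤ s⁻¹ ∧
      ∀ y, (G y, K y) ∈ D.graph ∧ (K y, y - ((s : ℂ) ^ 2) • G y) ∈ D.graph := by
  have hres : ∀ t : ℝ, t ≠ 0 → ∃ R : H →L[ℂ] H, IsCompactOperator R ∧ ‖R‖ ≤ |t|⁻¹ ∧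
      ∀ y, (R y, y + ((t : ℂ) * Complex.I) • R y) ∈ D.graph := by
    intro t ht
    obtain ⟨R, h1, h2, -⟩ := hD.isFormalAdjoint.exists_resolvent ht (hD.surjective_sub_smul ht)
    refine ⟨R, hc.isCompactOperator h2, h1, fun y => ?_⟩
    obtain ⟨h, hy⟩ := h2 y
    have := D.mem_graph ⟨R y, h⟩
    rwa [sub_eq_iff_eq_add.1 hy] at this
  obtain ⟨R, hR1, hR2, hR3⟩ := hres s hs.ne'
  obtain ⟨Q, hQ1, hQ2, hQ3⟩ := hres (-s) (neg_ne_zero.2 hs.ne')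
  rw [abs_neg] at hQ2
  rw [abs_of_pos hs] at hR2 hQ2
  have hs' : (s : ℂ) ≠ 0 := Complex.ofReal_ne_zero.2 hs.ne'
  -- Partial fractions in $R=(D-is)^{-1}$ and $Q=(D+is)^{-1}$.
  refine ⟨(2 * s * Complex.I : ℂ)⁻¹ • (R - Q), (2 : ℂ)⁻¹ • (R + Q), (hR1.sub hQ1).smul _,
    (hR1.add hQ1).smul _, ?_, ?_, fun y => ⟨?_, ?_⟩⟩
  · rw [norm_smul]
    have h1 : ‖R - Q‖ ≤ 2 * s⁻¹ := (norm_sub_le _ _).trans (by linarith)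
    have h2 : ‖(2 * s * Complex.I : ℂ)⁻¹‖ = 2⁻¹ * s⁻¹ := by
      simp [abs_of_pos hs, mul_comm]
    rw [h2]
    calc 2⁻¹ * s⁻¹ * ‖R - Q‖ ≤ 2⁻¹ * s⁻¹ * (2 * s⁻¹) := by gcongr
      _ = s⁻¹ * s⁻¹ := by ring
  · rw [norm_smul]
    have h1 : ‖R + Q‖ ≤ 2 * s⁻¹ := (norm_add_le _ _).trans (by linarith)
    have h2 : ‖(2 : ℂ)⁻¹‖ = 2⁻¹ := by simp
    rw [h2]
    linarith
  · have h := D.graph.smul_mem (2 * s * Complex.I : ℂ)⁻¹ (D.graph.sub_mem (hR3 y) (hQ3 y))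
    convert h using 1
    refine Prod.ext (by simp) ?_
    simp only [smul_apply, add_apply, Prod.smul_snd, Prod.snd_sub, Complex.ofReal_neg]
    match_scalars <;> field_simp
    ring
  · have h := D.graph.smul_mem (2 : ℂ)⁻¹ (D.graph.add_mem (hR3 y) (hQ3 y))
    convert h using 1
    refine Prod.ext (by simp) ?_
    simp only [smul_apply, sub_apply, Prod.smul_snd, Prod.snd_add, Complex.ofReal_neg]
    match_scalars <;> field_simp <;> ring_nf <;> simp [Complex.I_sq]

/-- The data of a Dirac type operator `f ↦ (ε i • D (f i) + c i • f (τ i))` on `ℓ²(I, H)`: an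
involution `τ`, signs `ε` and coefficients `c` tending to infinity with `ε (τ i) = - ε i` and
`c (τ i) = conj (c i)`. -/
structure DiracTypeData (I : Type*) where
  τ : I ≃ I
  ε : I → ℝ
  c : I → ℂ
  τ_τ : ∀ i, τ (τ i) = i
  ε_sq : ∀ i, ε i * ε i = 1
  ε_τ : ∀ i, ε (τ i) = - ε i
  c_τ : ∀ i, c (τ i) = starRingEnd ℂ (c i)
  tendsto_c : Filter.Tendsto (fun i => ‖c i‖) Filter.cofinite Filter.atTop

namespace DiracTypeData

variable {I : Type*} (P : DiracTypeData I) (D : H →ₗ.[ℂ] H)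
  (B : lp (fun _ : I => H) 2 →L[ℂ] lp (fun _ : I => H) 2)

/-- The graph of `f ↦ (ε i • D (f i) + c i • f (τ i) + B f i)`. -/
def graph : Submodule ℂ (lp (fun _ : I => H) 2 × lp (fun _ : I => H) 2) where
  carrier := {p | ∀ i, ∃ y, (p.1 i, y) ∈ D.graph ∧
    p.2 i = (P.ε i : ℂ) • y + P.c i • p.1 (P.τ i) + B p.1 i}
  zero_mem' := fun i => ⟨0, D.graph.zero_mem, by simp⟩
  add_mem' := by
    intro p q hp hq i
    obtain ⟨y, h1, h2⟩ := hp i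
    obtain ⟨z, h3, h4⟩ := hq i
    refine ⟨y + z, D.graph.add_mem h1 h3, ?_⟩
    simp only [Prod.snd_add, Prod.fst_add, lp.coeFn_add, Pi.add_apply, map_add, h2, h4, smul_add]
    abel
  smul_mem' := by
    intro a p hp i
    obtain ⟨y, h1, h2⟩ := hp i
    refine ⟨a • y, D.graph.smul_mem a h1, ?_⟩
    simp only [Prod.smul_snd, Prod.smul_fst, lp.coeFn_smul, Pi.smul_apply, map_smul, h2, smul_add,
      smul_comm a]

/-- The operator `f ↦ (ε i • D (f i) + c i • f (τ i) + B f i)`. -/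
def op : lp (fun _ : I => H) 2 →ₗ.[ℂ] lp (fun _ : I => H) 2 := (P.graph D B).toLinearPMap

theorem op_graph : (P.op D B).graph = P.graph D B := by
  refine Submodule.toLinearPMap_graph_eq _ ?_
  rintro ⟨f, g⟩ h (h0 : f = 0)
  subst h0
  ext i
  obtain ⟨y, h1, h2⟩ := h i
  have : y = 0 := D.graph_fst_eq_zero_snd h1 rfl
  simpa [this] using h2

variable {D}

theorem graph_symmetric (hD : D.IsFormalAdjoint D) (hB : ∀ f g, ⟪B f, g⟫_ℂ = ⟪f, B g⟫_ℂ)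
    {f g f' g' : lp (fun _ : I => H) 2} (h : (f, g) ∈ P.graph D B) (h' : (f', g') ∈ P.graph D B) :
    ⟪g, f'⟫_ℂ = ⟪f, g'⟫_ℂ := by
  have hD' : ∀ {x y x' y' : H}, (x, y) ∈ D.graph → (x', y') ∈ D.graph → ⟪y, x'⟫_ℂ = ⟪x, y'⟫_ℂ := by
    intro x y x' y' h1 h2
    obtain ⟨a, rfl⟩ := LinearPMap.exists_eq_of_mem_graph h1
    obtain ⟨b, rfl⟩ := LinearPMap.exists_eq_of_mem_graph h2
    exact hD ⟨x, a⟩ ⟨x', b⟩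
  suffices h0 : ⟪g - B f, f'⟫_ℂ = ⟪f, g' - B f'⟫_ℂ by
    rw [inner_sub_left, inner_sub_right, hB] at h0
    exact sub_left_injective h0
  choose y hy hy' using h
  choose z hz hz' using h'
  simp only at hy hy' hz hz'
  have s1 := lp.hasSum_inner (𝕜 := ℂ) (g - B f) f'
  have s2 := lp.hasSum_inner (𝕜 := ℂ) f (g' - B f')
  -- The coefficient term at $i$ on one side matches the one at $\tau(i)$ on the other, so the
  -- series agree termwise only after each is added to its own reindexing by $\tau$.
  have s1' := s1.add (P.τ.hasSum_iff.2 s1)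
  have s2' := s2.add (P.τ.hasSum_iff.2 s2)
  have e := s1'.unique (by
    convert s2' using 2 with i
    simp only [Function.comp, lp.coeFn_sub, Pi.sub_apply, hy', hz', add_sub_cancel_right, P.τ_τ,
      inner_add_left, inner_add_right, inner_smul_left, inner_smul_right, P.ε_τ, P.c_τ,
      Complex.conj_ofReal, Complex.conj_conj]
    rw [hD' (hy i) (hz i), hD' (hy (P.τ i)) (hz (P.τ i))]
    ring)
  linear_combination e / 2

theorem op_isFormalAdjoint (hD : D.IsFormalAdjoint D) (hB : ∀ f g, ⟪B f, g⟫_ℂ = ⟪f, B g⟫_ℂ) :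
    (P.op D B).IsFormalAdjoint (P.op D B) := fun f f' =>
  P.graph_symmetric B hD hB (by rw [← op_graph]; exact LinearPMap.mem_graph _ f)
    (by rw [← op_graph]; exact LinearPMap.mem_graph _ f')

variable [CompleteSpace H]

/-- For $B=0$ the square of the operator is $D^2+|c_i|^2$ in block $i$, so the inverse of $P-iw$ is
$(P+iw)(P^2+w^2)^{-1}$, expressed through $(D^2+s_i^2)^{-1}$ and $D(D^2+s_i^2)^{-1}$ with
$s_i^2=|c_i|^2+w^2$. -/
theorem exists_inverse_zero (hD : IsSelfAdjoint D) (hc : HasCompactResolvent D) {w : ℝ}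
    (hw : w ≠ 0) : ∃ S : lp (fun _ : I => H) 2 →L[ℂ] lp (fun _ : I => H) 2,
      IsCompactOperator S ∧ ‖S‖ ≤ |w|⁻¹ ∧
        ∀ f, (S f, f + ((w : ℂ) * Complex.I) • S f) ∈ P.graph D 0 := by
  let s : I → ℝ := fun i => √(‖P.c i‖ ^ 2 + w ^ 2)
  have hs : ∀ i, 0 < s i := fun i => Real.sqrt_pos.2 (by positivity)
  have hs2 : ∀ i, s i ^ 2 = ‖P.c i‖ ^ 2 + w ^ 2 := fun i => Real.sq_sqrt (by positivity)
  have hsτ : ∀ i, s (P.τ i) = s i := fun i => by simp only [s, P.c_τ, RCLike.norm_conj]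
  have hcs : ∀ i, ‖P.c i‖ ≤ s i := fun i => Real.le_sqrt_of_sq_le (by nlinarith [sq_nonneg w])
  have hws : ∀ i, |w| ≤ s i := fun i =>
    Real.le_sqrt_of_sq_le (by rw [sq_abs]; nlinarith [sq_nonneg ‖P.c i‖])
  have hfun : ∃ G K : ℝ → H →L[ℂ] H, ∀ t, 0 < t → IsCompactOperator (G t) ∧
      IsCompactOperator (K t) ∧ ‖G t‖ ≤ t⁻¹ * t⁻¹ ∧ ‖K t‖ ≤ t⁻¹ ∧
      ∀ y, (G t y, K t y) ∈ D.graph ∧ (K t y, y - ((t : ℂ) ^ 2) • G t y) ∈ D.graph := by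
    have : ∀ t : ℝ, ∃ G K : H →L[ℂ] H, 0 < t → IsCompactOperator G ∧
      IsCompactOperator K ∧ ‖G‖ ≤ t⁻¹ * t⁻¹ ∧ ‖K‖ ≤ t⁻¹ ∧
      ∀ y, (G y, K y) ∈ D.graph ∧ (K y, y - ((t : ℂ) ^ 2) • G y) ∈ D.graph := by
      intro t
      by_cases ht : 0 < t
      · obtain ⟨G, K, h⟩ := exists_compact_inverse_sq_add_sq hD hc ht
        exact ⟨G, K, fun _ => h⟩
      · exact ⟨0, 0, fun h => absurd h ht⟩
    choose G K h using this
    exact ⟨G, K, h⟩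
  obtain ⟨G, K, hGK⟩ := hfun
  -- The diagonal part of $(P+iw)(P^2+w^2)^{-1}$; `T2` is the part that moves $\tau(i)$ to $i$. Both
  -- have norm at most $2/s_i$, which tends to $0$.
  let T1 : I → H →L[ℂ] H := fun i =>
    (P.ε i : ℂ) • K (s i) + ((w : ℂ) * Complex.I) • G (s i)
  let T2 : I → H →L[ℂ] H := fun i => P.c i • G (s i)
  have hG : ∀ i, s i * ‖G (s i)‖ ≤ (s i)⁻¹ := fun i => by
    have h := mul_le_mul_of_nonneg_left (hGK _ (hs i)).2.2.1 (hs i).le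
    rwa [mul_inv_cancel_left₀ (hs i).ne'] at h
  have hε : ∀ i, ‖(P.ε i : ℂ)‖ = 1 := fun i => by
    have h := P.ε_sq i
    rw [Complex.norm_real, Real.norm_eq_abs, ← abs_one, ← sq_eq_sq_iff_abs_eq_abs]
    linarith
  have hT2 : ∀ i, ‖T2 i‖ ≤ 2 * (s i)⁻¹ := fun i => by
    have h1 : ‖T2 i‖ ≤ s i * ‖G (s i)‖ := by
      rw [norm_smul]; gcongr; exact hcs i
    have := inv_pos.2 (hs i)
    linarith [hG i]
  have hT1 : ∀ i, ‖T1 i‖ ≤ 2 * (s i)⁻¹ := fun i => by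
    have h1 : ‖((w : ℂ) * Complex.I) • G (s i)‖ ≤ s i * ‖G (s i)‖ := by
      rw [norm_smul]; gcongr; simpa using hws i
    have h2 : ‖(P.ε i : ℂ) • K (s i)‖ ≤ (s i)⁻¹ := by
      rw [norm_smul, hε, one_mul]; exact (hGK _ (hs i)).2.2.2.1
    linarith [hG i, norm_add_le ((P.ε i : ℂ) • K (s i)) (((w : ℂ) * Complex.I) • G (s i))]
  have hbd : ∀ T : I → H →L[ℂ] H, (∀ i, ‖T i‖ ≤ 2 * (s i)⁻¹) → ∃ C, ∀ i, ‖T i‖ ≤ C :=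
    fun T hT => ⟨2 * |w|⁻¹, fun i => (hT i).trans (by
      have := abs_pos.2 hw
      gcongr; exact hws i)⟩
  have hlim : ∀ T : I → H →L[ℂ] H, (∀ i, ‖T i‖ ≤ 2 * (s i)⁻¹) →
      Filter.Tendsto (fun i => ‖T i‖) Filter.cofinite (𝓝 0) := fun T hT => by
    have h1 : Filter.Tendsto (fun i => 2 * (s i)⁻¹) Filter.cofinite (𝓝 (2 * 0)) :=
      ((Filter.tendsto_atTop_mono hcs P.tendsto_c).inv_tendsto_atTop).const_mul 2
    rw [mul_zero] at h1
    exact squeeze_zero (fun i => norm_nonneg _) hT h1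
  let S : lp (fun _ : I => H) 2 →L[ℂ] lp (fun _ : I => H) 2 :=
    lpDiag T1 (hbd T1 hT1) + lpDiag T2 (hbd T2 hT2) ∘L (lpReindex P.τ).toContinuousLinearMap
  have hS : ∀ f i, S f i = (P.ε i : ℂ) • K (s i) (f i) + ((w : ℂ) * Complex.I) • G (s i) (f i) +
      P.c i • G (s i) (f (P.τ i)) := fun f i => rfl
  have hmem : ∀ f, (S f, f + ((w : ℂ) * Complex.I) • S f) ∈ P.graph D 0 := by
    intro f i
    have hg := fun y => (hGK _ (hs i)).2.2.2.2 y
    refine ⟨(P.ε i : ℂ) • (f i - ((s i : ℂ) ^ 2) • G (s i) (f i)) +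
      ((w : ℂ) * Complex.I) • K (s i) (f i) + P.c i • K (s i) (f (P.τ i)), ?_, ?_⟩
    · simp only [hS]
      exact D.graph.add_mem (D.graph.add_mem (D.graph.smul_mem _ (hg _).2)
        (D.graph.smul_mem _ (hg _).1)) (D.graph.smul_mem _ (hg _).1)
    · have e1 : (s i : ℂ) ^ 2 = P.c i * starRingEnd ℂ (P.c i) + (w : ℂ) ^ 2 := by
        rw [Complex.mul_conj, Complex.normSq_eq_norm_sq]; exact_mod_cast hs2 i
      have e2 : (P.ε i : ℂ) * P.ε i = 1 := by exact_mod_cast P.ε_sq i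
      simp only [lp.coeFn_add, Pi.add_apply, lp.coeFn_smul, Pi.smul_apply, hS, P.τ_τ, hsτ, P.ε_τ,
        P.c_τ, e1, zero_apply, lp.coeFn_zero, Pi.zero_apply, Complex.ofReal_neg]
      match_scalars
      · linear_combination -e2
      · ring
      · linear_combination (w : ℂ) ^ 2 * Complex.I_sq +
          ((w : ℂ) ^ 2 + P.c i * starRingEnd ℂ (P.c i)) * e2
      · ring
      · ring
  have hsym := P.op_isFormalAdjoint 0 hD.isFormalAdjoint (fun f g => by simp)
  refine ⟨S, ?_, ContinuousLinearMap.opNorm_le_bound _ (by positivity) fun f => ?_, hmem⟩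
  · refine IsCompactOperator.add (isCompactOperator_lpDiag _ (hbd T1 hT1) (fun i => ?_) (hlim _ hT1))
      ((isCompactOperator_lpDiag _ (hbd T2 hT2) (fun i => ?_) (hlim _ hT2)).comp_clm _)
    · exact ((hGK _ (hs i)).2.1.smul (P.ε i : ℂ)).add ((hGK _ (hs i)).1.smul ((w : ℂ) * Complex.I))
    · exact (hGK _ (hs i)).1.smul (P.c i)
  -- The block estimates would lose a factor; symmetry gives the sharp bound $|w|^{-1}$, which makes
  -- the Neumann series converge as soon as $\|B\|<|w|$.
  · have h := hmem f
    rw [← op_graph] at h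
    obtain ⟨h1, h2⟩ := LinearPMap.exists_eq_of_mem_graph h
    have h3 := hsym.norm_le w ⟨S f, h1⟩
    rw [h2, add_sub_cancel_right] at h3
    rw [← div_eq_inv_mul, le_div_iff₀ (abs_pos.2 hw), mul_comm]
    exact h3

/-- With $S$ the inverse for $B=0$, the operator $S(1+BS)^{-1}$ is the inverse for $B$, and it is
compact because $S$ is. -/
theorem exists_inverse (hD : IsSelfAdjoint D) (hc : HasCompactResolvent D) {w : ℝ}
    (hw : ‖B‖ < |w|) : ∃ S : lp (fun _ : I => H) 2 →L[ℂ] lp (fun _ : I => H) 2,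
      IsCompactOperator S ∧ ∀ f, (S f, f + ((w : ℂ) * Complex.I) • S f) ∈ P.graph D B := by
  have hw0 : 0 < |w| := (norm_nonneg B).trans_lt hw
  obtain ⟨S, h1, h2, h3⟩ := P.exists_inverse_zero hD hc (abs_pos.1 hw0)
  have hn : ‖-(B * S)‖ < 1 := by
    rw [norm_neg]
    calc ‖B * S‖ ≤ ‖B‖ * ‖S‖ := norm_mul_le _ _
      _ ≤ ‖B‖ * |w|⁻¹ := by gcongr
      _ < 1 := by rwa [← div_eq_mul_inv, div_lt_one hw0]
  let U := Units.oneSub _ hn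
  let V : lp (fun _ : I => H) 2 →L[ℂ] lp (fun _ : I => H) 2 := ↑U⁻¹
  have hV : ∀ f, V f + B (S (V f)) = f := by
    intro f
    have h : (U : lp (fun _ : I => H) 2 →L[ℂ] lp (fun _ : I => H) 2) * V = 1 := U.mul_inv
    have h' := congrArg (fun T => T f) h
    simpa [U] using h'
  refine ⟨S ∘L V, h1.comp_clm V, fun f i => ?_⟩
  obtain ⟨y, hy1, hy2⟩ := h3 (V f) i
  refine ⟨y, hy1, ?_⟩
  have h4 : f i = V f i + B (S (V f)) i := by
    nth_rewrite 1 [← hV f]; rfl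
  simp only [lp.coeFn_add, Pi.add_apply, lp.coeFn_smul, Pi.smul_apply, zero_apply, lp.coeFn_zero,
    Pi.zero_apply, add_zero, ContinuousLinearMap.comp_apply] at hy2 ⊢
  rw [h4, ← hy2]
  abel

theorem isSelfAdjoint_op (hD : IsSelfAdjoint D) (hc : HasCompactResolvent D)
    (hB : ∀ f g, ⟪B f, g⟫_ℂ = ⟪f, B g⟫_ℂ) : IsSelfAdjoint (P.op D B) := by
  have key : ∀ w : ℝ, ‖B‖ < |w| → ∀ g, ∃ f : (P.op D B).domain,
      P.op D B f - ((w : ℂ) * Complex.I) • (f : lp (fun _ : I => H) 2) = g := by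
    intro w hw g
    obtain ⟨S, -, h⟩ := P.exists_inverse B hD hc hw
    have h' := h g
    rw [← op_graph] at h'
    obtain ⟨h1, h2⟩ := LinearPMap.exists_eq_of_mem_graph h'
    exact ⟨⟨S g, h1⟩, by rw [h2]; simp⟩
  have hpos : ‖B‖ < |‖B‖ + 1| := by
    rw [abs_of_pos (by positivity)]; linarith
  refine (P.op_isFormalAdjoint B hD.isFormalAdjoint hB).isSelfAdjoint
    (((‖B‖ + 1 : ℝ) : ℂ) * Complex.I) (key _ hpos) ?_
  have h := key (-(‖B‖ + 1)) (by rwa [abs_neg])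
  convert h using 6
  simp
  ring

theorem hasCompactResolvent_op (hD : IsSelfAdjoint D) (hc : HasCompactResolvent D)
    (hB : ∀ f g, ⟪B f, g⟫_ℂ = ⟪f, B g⟫_ℂ) : HasCompactResolvent (P.op D B) := by
  have hpos : ‖B‖ < |‖B‖ + 1| := by
    rw [abs_of_pos (by positivity)]; linarith
  have hne : ‖B‖ + 1 ≠ 0 := by positivity
  have hsa := P.isSelfAdjoint_op B hD hc hB
  obtain ⟨S, hS, h⟩ := P.exists_inverse B hD hc hpos
  obtain ⟨R, -, h1, h2⟩ := hsa.isFormalAdjoint.exists_resolvent hne (hsa.surjective_sub_smul hne)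
  -- `exists_inverse` provides a compact right inverse; it coincides with the two-sided resolvent
  -- `R`.
  have e : R = S := by
    ext1 f
    have h' := h f
    rw [← op_graph] at h'
    obtain ⟨h3, h4⟩ := LinearPMap.exists_eq_of_mem_graph h'
    have h5 := h2 ⟨S f, h3⟩
    rw [h4] at h5
    simpa using h5
  exact ⟨_, R, e ▸ hS, h1, h2⟩

end DiracTypeData
end DiracType

/-! ### The Dirac operator of the bundle for the discrete metric. -/

section DiscreteBundle

/-- Five anticommuting hermitian unitary `4 × 4` matrices. -/
def diracMatrix : Fin 5 → Matrix (Fin 4) (Fin 4) ℂ :=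
  ![!![0, 0, 1, 0; 0, 0, 0, 1; 1, 0, 0, 0; 0, 1, 0, 0],
    !![0, 0, Complex.I, 0; 0, 0, 0, -Complex.I; -Complex.I, 0, 0, 0; 0, Complex.I, 0, 0],
    !![0, 0, 0, Complex.I; 0, 0, Complex.I, 0; 0, -Complex.I, 0, 0; -Complex.I, 0, 0, 0],
    !![0, 0, 0, 1; 0, 0, -1, 0; 0, -1, 0, 0; 1, 0, 0, 0],
    !![1, 0, 0, 0; 0, 1, 0, 0; 0, 0, -1, 0; 0, 0, 0, -1]]

theorem diracMatrix_isHermitian (j : Fin 5) : (diracMatrix j).IsHermitian := by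
  ext a b
  fin_cases j <;> fin_cases a <;> fin_cases b <;> simp [diracMatrix]

theorem diracMatrix_clifford (j k : Fin 5) :
    diracMatrix j * diracMatrix k + diracMatrix k * diracMatrix j = if j = k then 2 else 0 := by
  have h2 : (2 : Matrix (Fin 4) (Fin 4) ℂ) = !![2, 0, 0, 0; 0, 2, 0, 0; 0, 0, 2, 0; 0, 0, 0, 2] := by
    rw [show (2 : Matrix (Fin 4) (Fin 4) ℂ) = (2 : ℕ) by norm_num, ← Matrix.diagonal_natCast]
    ext a b
    fin_cases a <;> fin_cases b <;> simp
  have h0 : (0 : Matrix (Fin 4) (Fin 4) ℂ) = !![0, 0, 0, 0; 0, 0, 0, 0; 0, 0, 0, 0; 0, 0, 0, 0] := by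
    ext a b
    fin_cases a <;> fin_cases b <;> simp
  rw [h2, h0]
  fin_cases j <;> fin_cases k <;> simp [diracMatrix] <;> norm_num

/-- The auxiliary data of a metric bundle given by the discrete metric on `ℤ`. -/
def discreteBundleData : BundleData where
  -- All positive distances are $1$, so $\nabla$ is bounded, yet it still compares points
  -- arbitrarily far apart.
  d j := if j = 0 then 0 else 1
  d_zero := if_pos rfl
  d_pos j hj := by simp [hj.ne']
  d_triangle i j k h := by
    split_ifs <;> first | omega | norm_num
  d_sup := by
    refine ⟨?_, fun b hb => hb ⟨1, by simp⟩⟩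
    rintro _ ⟨j, rfl⟩
    dsimp only
    split_ifs <;> norm_num
  coupling := 1
  coupling_ne_zero := one_ne_zero
  γ := diracMatrix
  γ_hermitian := diracMatrix_isHermitian
  γ_clifford := diracMatrix_clifford

/-- The unbounded part of the Dirac operator of the metric bundle for the discrete metric. -/
def bundleDiracTypeData : DiracTypeData (ℤ × ℕ+ × Fin 4) where
  τ := (Equiv.refl ℤ).prodCongr ((Equiv.refl ℕ+).prodCongr Fin.revPerm)
  ε k := ![1, 1, -1, -1] k.2.2
  c k := ![Complex.I * k.1 + (k.2.1 : ℂ), Complex.I * k.1 - (k.2.1 : ℂ),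
    -(Complex.I * k.1) - (k.2.1 : ℂ), -(Complex.I * k.1) + (k.2.1 : ℂ)] k.2.2
  τ_τ := by rintro ⟨n, r, i⟩; simp
  ε_sq := by rintro ⟨n, r, i⟩; fin_cases i <;> simp
  ε_τ := by rintro ⟨n, r, i⟩; fin_cases i <;> simp [Fin.rev]
  c_τ := by rintro ⟨n, r, i⟩; fin_cases i <;> simp [Fin.rev]
  -- The real and imaginary parts of $c$ are $\pm r$ and $\pm n$, so a bound on $|c|$ leaves
  -- finitely many indices.
  tendsto_c := by
    rw [Filter.tendsto_atTop]
    intro b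
    obtain ⟨N, hN⟩ := exists_nat_ge b
    have hfin : ((Set.Icc (-(N : ℤ)) N) ×ˢ ((fun r : ℕ+ => (r : ℕ)) ⁻¹' Set.Iic N) ×ˢ
        (Set.univ : Set (Fin 4))).Finite :=
      (Set.finite_Icc _ _).prod (((Set.finite_Iic N).preimage PNat.coe_injective.injOn).prod
        Set.finite_univ)
    refine hfin.subset ?_
    rintro ⟨n, r, i⟩ h
    replace h : ¬ b ≤ _ := h
    rw [not_le] at h
    replace h := h.trans_le hN
    have h1 := (Complex.abs_im_le_norm _).trans h.le
    have h2 := (Complex.abs_re_le_norm _).trans h.le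
    have h3 : |(n : ℝ)| ≤ N := by
      fin_cases i <;> simpa using h1
    have h4 : |(r : ℝ)| ≤ N := by
      fin_cases i <;> simpa using h2
    rw [Nat.abs_cast] at h4
    rw [abs_le] at h3
    exact ⟨⟨by exact_mod_cast h3.1, by exact_mod_cast h3.2⟩, by exact_mod_cast h4, trivial⟩

/-- The involution `(n, r, i) ↦ (n, r, i + 2)`. -/
def fiberSwap : Equiv.Perm (ℤ × ℕ+ × Fin 4) where
  toFun k := (k.1, k.2.1, k.2.2 + 2)
  invFun k := (k.1, k.2.1, k.2.2 + 2)
  left_inv := by rintro ⟨n, r, i⟩; fin_cases i <;> rfl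
  right_inv := by rintro ⟨n, r, i⟩; fin_cases i <;> rfl

/-- The involution `(n, r, i) ↦ (n ± r, r, i + 2)`. -/
def fiberShiftSwap : Equiv.Perm (ℤ × ℕ+ × Fin 4) where
  toFun k := (k.1 + ![1, -1, -1, 1] k.2.2 * (k.2.1 : ℤ), k.2.1, k.2.2 + 2)
  invFun k := (k.1 + ![1, -1, -1, 1] k.2.2 * (k.2.1 : ℤ), k.2.1, k.2.2 + 2)
  left_inv := by rintro ⟨n, r, i⟩; fin_cases i <;> simp
  right_inv := by rintro ⟨n, r, i⟩; fin_cases i <;> simp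

theorem fiberSwap_apply (k : ℤ × ℕ+ × Fin 4) : fiberSwap k = (k.1, k.2.1, k.2.2 + 2) := rfl

theorem fiberShiftSwap_apply (k : ℤ × ℕ+ × Fin 4) :
    fiberShiftSwap k = (k.1 + ![1, -1, -1, 1] k.2.2 * (k.2.1 : ℤ), k.2.1, k.2.2 + 2) := rfl

variable {H : Type v} [NormedAddCommGroup H] [InnerProductSpace ℂ H]

theorem inner_lpReindex_left {I : Type*} {e : I ≃ I} (he : ∀ i, e (e i) = i)
    (f g : lp (fun _ : I => H) 2) : ⟪lpReindex e f, g⟫_ℂ = ⟪f, lpReindex e g⟫_ℂ := by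
  rw [← (lpReindex e).inner_map_map f]
  congr 1
  ext i
  simp [he]

variable (H) in
/-- The bounded part of the Dirac operator of the metric bundle for the discrete metric. -/
def bundleDiff : BundleSpace H →L[ℂ] BundleSpace H :=
  (lpReindex fiberSwap).toContinuousLinearMap - (lpReindex fiberShiftSwap).toContinuousLinearMap

theorem bundleDiff_symmetric (f g : BundleSpace H) :
    ⟪bundleDiff H f, g⟫_ℂ = ⟪f, bundleDiff H g⟫_ℂ := by
  change ⟪lpReindex fiberSwap f - lpReindex fiberShiftSwap f, g⟫_ℂ =
    ⟪f, lpReindex fiberSwap g - lpReindex fiberShiftSwap g⟫_ℂ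
  rw [inner_sub_left, inner_sub_right, inner_lpReindex_left (e := fiberSwap) fiberSwap.left_inv,
    inner_lpReindex_left (e := fiberShiftSwap) fiberShiftSwap.left_inv]

/-- The matrices are chosen so that $\gamma_5$ is diagonal, $\gamma_3,\gamma_4$ are antidiagonal,
and $(\gamma_1+i\gamma_2)/2$ and $(\gamma_1-i\gamma_2)/2$ have a single entry $1$ in rows $1,2$ and
in rows $0,3$ respectively. Each row therefore sees exactly one difference, which is $\nabla$ or
$\nabla^*$. -/
theorem diracFormula_discreteBundleData (f y : ℤ × ℕ+ × Fin 4 → H) (n : ℤ) (r : ℕ+) (i : Fin 4) :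
    discreteBundleData.diracFormula f y n r i =
      (bundleDiracTypeData.ε (n, r, i) : ℂ) • y (n, r, i) +
      bundleDiracTypeData.c (n, r, i) • f (bundleDiracTypeData.τ (n, r, i)) +
      (f (fiberSwap (n, r, i)) - f (fiberShiftSwap (n, r, i))) := by
  have hI : Complex.I * Complex.I = -1 := Complex.I_mul_I
  have hd : discreteBundleData.d r = 1 := if_neg r.ne_zero
  rw [BundleData.diracFormula, Fin.sum_univ_four, hd]
  fin_cases i <;>
    simp [discreteBundleData, diracMatrix, bundleDiracTypeData, fiberSwap_apply,
      fiberShiftSwap_apply, Fin.rev, ← sub_eq_add_neg] <;> module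

variable (D : H →ₗ.[ℂ] H)

/-- The Dirac operator of the metric bundle for the discrete metric. -/
def bundleDirac : BundleSpace H →ₗ.[ℂ] BundleSpace H := bundleDiracTypeData.op D (bundleDiff H)

variable {D}

theorem mem_bundleDirac_graph {f g : BundleSpace H} : (f, g) ∈ (bundleDirac D).graph ↔
    ∀ k, ∃ y, (f k, y) ∈ D.graph ∧ g k = (bundleDiracTypeData.ε k : ℂ) • y +
      bundleDiracTypeData.c k • f (bundleDiracTypeData.τ k) +
      (f (fiberSwap k) - f (fiberShiftSwap k)) := by
  rw [bundleDirac, DiracTypeData.op_graph]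
  exact Iff.rfl

theorem mem_bundleDirac_graph_iff {f g : BundleSpace H} : (f, g) ∈ (bundleDirac D).graph ↔
    ∃ y : ℤ × ℕ+ × Fin 4 → H, (∀ k, (f k, y k) ∈ D.graph) ∧
      ∀ (n : ℤ) (r : ℕ+) (i : Fin 4), g (n, r, i) = discreteBundleData.diracFormula f y n r i := by
  rw [mem_bundleDirac_graph]
  constructor
  · intro h
    choose y h1 h2 using h
    exact ⟨y, h1, fun n r i => by rw [h2, diracFormula_discreteBundleData]⟩
  · rintro ⟨y, h1, h2⟩ ⟨n, r, i⟩
    exact ⟨y (n, r, i), h1 _, by rw [h2, diracFormula_discreteBundleData]⟩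

end DiscreteBundle

/-! ### The universal crossed product: monomials and their density. -/

section CrossedProductBasics

variable {A : Type u} [NonUnitalCStarAlgebra A]

theorem StarAlgEquiv.zpow_add_apply (α : A ≃⋆ₐ[ℂ] A) (m n : ℤ) (a : A) :
    (α ^ (m + n)) a = (α ^ m) ((α ^ n) a) := by rw [zpow_add, StarAlgEquiv.mul_apply]

theorem StarAlgEquiv.zpow_neg_apply_zpow_apply (α : A ≃⋆ₐ[ℂ] A) (n : ℤ) (a : A) :
    (α ^ (-n)) ((α ^ n) a) = a := by rw [← StarAlgEquiv.zpow_add_apply]; simp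

theorem StarAlgEquiv.zpow_apply_zpow_neg_apply (α : A ≃⋆ₐ[ℂ] A) (n : ℤ) (a : A) :
    (α ^ n) ((α ^ (-n)) a) = a := by rw [← StarAlgEquiv.zpow_add_apply]; simp

theorem StarAlgEquiv.norm_apply (φ : A ≃⋆ₐ[ℂ] A) (a : A) : ‖φ a‖ = ‖a‖ :=
  NonUnitalStarAlgHom.norm_map φ φ.injective a

namespace CovariantRep

variable {α : A ≃⋆ₐ[ℂ] A} (ρ : CovariantRep α)

theorem U_mul_π (a : A) : (ρ.U : ρ.space →L[ℂ] ρ.space) * ρ.π a = ρ.π (α a) * ρ.U := by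
  rw [← ρ.covariant a, mul_assoc, ← Submonoid.coe_mul, inv_mul_cancel]
  simp

theorem U_zpow_mul_π (n : ℤ) (a : A) :
    ((ρ.U ^ n : unitary (ρ.space →L[ℂ] ρ.space)) : ρ.space →L[ℂ] ρ.space) * ρ.π a =
      ρ.π ((α ^ n) a) * ((ρ.U ^ n : unitary (ρ.space →L[ℂ] ρ.space)) : ρ.space →L[ℂ] ρ.space) := by
  induction n generalizing a with
  | zero => simp
  | succ n ih =>
    rw [zpow_add_one, Submonoid.coe_mul, mul_assoc, U_mul_π, ← mul_assoc, ih, mul_assoc, zpow_add_one,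
      StarAlgEquiv.mul_apply]
  | pred n ih =>
    have h := ρ.U_mul_π ((α⁻¹ : A ≃⋆ₐ[ℂ] A) a)
    rw [← StarAlgEquiv.mul_apply, mul_inv_cancel, StarAlgEquiv.one_apply] at h
    have h2 : ((ρ.U⁻¹ : unitary (ρ.space →L[ℂ] ρ.space)) : ρ.space →L[ℂ] ρ.space) * ρ.π a =
        ρ.π ((α⁻¹ : A ≃⋆ₐ[ℂ] A) a) *
          ((ρ.U⁻¹ : unitary (ρ.space →L[ℂ] ρ.space)) : ρ.space →L[ℂ] ρ.space) := by
      have h3 : ρ.π a = (ρ.U : ρ.space →L[ℂ] ρ.space) * ρ.π ((α⁻¹ : A ≃⋆ₐ[ℂ] A) a) *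
          ((ρ.U⁻¹ : unitary (ρ.space →L[ℂ] ρ.space)) : ρ.space →L[ℂ] ρ.space) := by
        rw [h, mul_assoc, ← Submonoid.coe_mul, mul_inv_cancel]; simp
      rw [h3, ← mul_assoc, ← mul_assoc, ← Submonoid.coe_mul, inv_mul_cancel]; simp
    rw [zpow_sub_one, Submonoid.coe_mul, mul_assoc, h2, ← mul_assoc, ih, mul_assoc, zpow_sub_one,
      StarAlgEquiv.mul_apply]

end CovariantRep

namespace CrossedProduct

variable {α : A ≃⋆ₐ[ℂ] A}

theorem ext_val {x y : CrossedProduct α} (h : ∀ ρ, x.1 ρ = y.1 ρ) : x = y :=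
  Subtype.ext (lp.ext (funext h))

/-- The representation of the crossed product given by a covariant representation. -/
def eval (ρ : CovariantRep α) : CrossedProduct α →⋆ₙₐ[ℂ] (ρ.space →L[ℂ] ρ.space) where
  toFun x := x.1 ρ
  map_smul' _ _ := rfl
  map_zero' := rfl
  map_add' _ _ := rfl
  map_mul' _ _ := rfl
  map_star' _ := rfl

theorem eval_monomial (ρ : CovariantRep α) (a : A) (n : ℤ) : eval ρ (monomial α a n) =
    ρ.π a * ((ρ.U ^ n : unitary (ρ.space →L[ℂ] ρ.space)) : ρ.space →L[ℂ] ρ.space) := rfl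

theorem ext_eval {x y : CrossedProduct α} (h : ∀ ρ, eval ρ x = eval ρ y) : x = y := ext_val h

theorem monomial_add (a b : A) (n : ℤ) :
    monomial α (a + b) n = monomial α a n + monomial α b n :=
  ext_eval fun ρ => by simp only [map_add, eval_monomial, add_mul]

theorem monomial_smul (c : ℂ) (a : A) (n : ℤ) : monomial α (c • a) n = c • monomial α a n :=
  ext_eval fun ρ => by simp only [map_smul, eval_monomial, smul_mul_assoc]

theorem norm_monomial_le (a : A) (n : ℤ) : ‖monomial α a n‖ ≤ ‖a‖ := by
  refine lp.norm_le_of_forall_le (norm_nonneg a) fun ρ => ?_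
  exact (CStarRing.norm_mul_coe_unitary (ρ.π a) (ρ.U ^ n)).trans_le
    (NonUnitalStarAlgHom.norm_apply_le ρ.π a)

variable (α) in
/-- The map `a ↦ a uⁿ` as a continuous linear map. -/
def monomialCLM (n : ℤ) : A →L[ℂ] CrossedProduct α :=
  LinearMap.mkContinuous
    { toFun := fun a => monomial α a n
      map_add' := fun a b => monomial_add a b n
      map_smul' := fun c a => monomial_smul c a n } 1
    (fun a => by rw [one_mul]; exact norm_monomial_le a n)

theorem monomialCLM_apply (n : ℤ) (a : A) : monomialCLM α n a = monomial α a n := rfl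

theorem monomial_mul_monomial (a b : A) (m n : ℤ) :
    monomial α a m * monomial α b n = monomial α (a * (α ^ m) b) (m + n) :=
  ext_eval fun ρ => by
    rw [map_mul, eval_monomial, eval_monomial, eval_monomial, mul_assoc, ← mul_assoc _ (ρ.π b),
      ρ.U_zpow_mul_π, map_mul, zpow_add, Submonoid.coe_mul]
    simp only [mul_assoc]

theorem star_monomial (a : A) (n : ℤ) :
    star (monomial α a n) = monomial α ((α ^ (-n)) (star a)) (-n) :=
  ext_eval fun ρ => by
    rw [map_star, eval_monomial, eval_monomial, star_mul, ← map_star, ← ρ.U_zpow_mul_π, zpow_neg]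
    rfl

/-- The product and star formulas show that the linear span of the monomials is already a
$*$-algebra, so it contains the algebraic `adjoin`. -/
theorem span_monomial_dense :
    (Submodule.span ℂ (Set.range fun p : A × ℤ => monomial α p.1 p.2)).topologicalClosure = ⊤ := by
  set S := Submodule.span ℂ (Set.range fun p : A × ℤ => monomial α p.1 p.2)
  have hmono : ∀ a n, monomial α a n ∈ S := fun a n => Submodule.subset_span ⟨(a, n), rfl⟩
  have hmul : ∀ x ∈ S, ∀ y ∈ S, x * y ∈ S := by
    intro x hx y hy
    induction hx using Submodule.span_induction with
    | mem x hx =>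
      obtain ⟨⟨a, m⟩, rfl⟩ := hx
      induction hy using Submodule.span_induction with
      | mem y hy =>
        obtain ⟨⟨b, n⟩, rfl⟩ := hy
        rw [monomial_mul_monomial]; exact hmono _ _
      | zero => rw [mul_zero]; exact S.zero_mem
      | add y z _ _ h1 h2 => rw [mul_add]; exact S.add_mem h1 h2
      | smul c y _ h => rw [mul_smul_comm]; exact S.smul_mem c h
    | zero => rw [zero_mul]; exact S.zero_mem
    | add y z _ _ h1 h2 => rw [add_mul]; exact S.add_mem h1 h2
    | smul c y _ h => rw [smul_mul_assoc]; exact S.smul_mem c h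
  have hstar : ∀ x ∈ S, star x ∈ S := by
    intro x hx
    induction hx using Submodule.span_induction with
    | mem x hx =>
      obtain ⟨⟨a, m⟩, rfl⟩ := hx
      rw [star_monomial]; exact hmono _ _
    | zero => rw [star_zero]; exact S.zero_mem
    | add y z _ _ h1 h2 => rw [star_add]; exact S.add_mem h1 h2
    | smul c y _ h => rw [star_smul]; exact S.smul_mem _ h
  have hadj : ∀ x ∈ NonUnitalStarAlgebra.adjoin ℂ
      (Set.range fun p : A × ℤ => covariantMonomial α p.1 p.2),
      ∃ y ∈ S, (y : crossedProductSubalgebra α).1 = x := by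
    intro x hx
    induction hx using NonUnitalStarAlgebra.adjoin_induction with
    | mem x hx =>
      obtain ⟨⟨a, n⟩, rfl⟩ := hx
      exact ⟨monomial α a n, hmono a n, rfl⟩
    | add x y _ _ hx hy =>
      obtain ⟨x', hx, rfl⟩ := hx
      obtain ⟨y', hy, rfl⟩ := hy
      exact ⟨x' + y', S.add_mem hx hy, rfl⟩
    | zero => exact ⟨0, S.zero_mem, rfl⟩
    | mul x y _ _ hx hy =>
      obtain ⟨x', hx, rfl⟩ := hx
      obtain ⟨y', hy, rfl⟩ := hy
      exact ⟨x' * y', hmul _ hx _ hy, rfl⟩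
    | smul c x _ hx =>
      obtain ⟨x', hx, rfl⟩ := hx
      exact ⟨c • x', S.smul_mem c hx, rfl⟩
    | star x _ hx =>
      obtain ⟨x', hx, rfl⟩ := hx
      exact ⟨star x', hstar _ hx, rfl⟩
  rw [← Submodule.dense_iff_topologicalClosure_eq_top]
  intro x
  have hx1 : x.1 ∈ closure (NonUnitalStarAlgebra.adjoin ℂ
      (Set.range fun p : A × ℤ => covariantMonomial α p.1 p.2) : Set (CovariantFamilies α)) := x.2
  refine Metric.mem_closure_iff.2 fun ε hε => ?_
  obtain ⟨y, hy, hd⟩ := Metric.mem_closure_iff.1 hx1 ε hε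
  obtain ⟨y', hy', rfl⟩ := hadj y hy
  exact ⟨y', hy', hd⟩

/-- A closed subspace of the crossed product that contains all monomials is everything. -/
theorem mem_of_isClosed {S : Submodule ℂ (CrossedProduct α)} (hS : IsClosed (S : Set (CrossedProduct α)))
    (h : ∀ a n, monomial α a n ∈ S) (x : CrossedProduct α) : x ∈ S := by
  have h1 : Submodule.span ℂ (Set.range fun p : A × ℤ => monomial α p.1 p.2) ≤ S := by
    rw [Submodule.span_le]; rintro _ ⟨⟨a, n⟩, rfl⟩; exact h a n
  have h2 := Submodule.topologicalClosure_minimal _ h1 hS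
  rw [span_monomial_dense] at h2
  exact h2 trivial

end CrossedProduct
end CrossedProductBasics

/-! ### Lifting bounded maps through faithful representations. -/

section Lifting

variable {A C : Type*} [NonUnitalCStarAlgebra A] [NonUnitalCStarAlgebra C]

/-- A `⋆`-homomorphism of C⋆-algebras as a continuous linear map. -/
def NonUnitalStarAlgHom.toCLM (π : A →⋆ₙₐ[ℂ] C) : A →L[ℂ] C :=
  LinearMap.mkContinuous
    { toFun := π, map_add' := map_add π, map_smul' := fun c a => map_smul π c a } 1
    (fun a => by rw [one_mul]; exact NonUnitalStarAlgHom.norm_apply_le π a)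

@[simp]
theorem NonUnitalStarAlgHom.toCLM_apply (π : A →⋆ₙₐ[ℂ] C) (a : A) : π.toCLM a = π a := rfl

theorem NonUnitalStarAlgHom.isClosed_range (π : A →⋆ₙₐ[ℂ] C) (hπ : Function.Injective π) :
    IsClosed (LinearMap.range π.toCLM.toLinearMap : Set C) :=
  (NonUnitalStarAlgHom.isometry π hπ).isClosedEmbedding.isClosed_range

/-- An injective $*$-homomorphism is isometric, so the set-theoretic lift is linear and bounded by
$\|\Psi\|$. It turns operator coefficients into elements of the algebra. -/
theorem NonUnitalStarAlgHom.exists_lift {V : Type*} [NormedAddCommGroup V] [NormedSpace ℂ V]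
    (π : A →⋆ₙₐ[ℂ] C) (hπ : Function.Injective π) (Ψ : V →L[ℂ] C) (h : ∀ x, Ψ x ∈ Set.range π) :
    ∃ L : V →L[ℂ] A, ∀ x, π (L x) = Ψ x := by
  choose L hL using h
  refine ⟨LinearMap.mkContinuous
    { toFun := L
      map_add' := fun x y => hπ (by rw [map_add, hL, hL, hL, map_add])
      map_smul' := fun c x => hπ (by rw [RingHom.id_apply, map_smul, hL, hL, map_smul]) } ‖Ψ‖
    (fun x => ?_), hL⟩
  rw [← NonUnitalStarAlgHom.norm_map π hπ]
  change ‖π (L x)‖ ≤ _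
  rw [hL]
  exact Ψ.le_opNorm x

end Lifting

/-! ### The algebra $\mathcal A\otimes c_0(\mathbb Z)$ and its shift automorphism. -/

section BundleAlgebra

variable {A : Type u} [NonUnitalCStarAlgebra A]

theorem C0_norm_le {b : C₀(ℤ, A)} {C : ℝ} (hC : 0 ≤ C) (h : ∀ n, ‖b n‖ ≤ C) : ‖b‖ ≤ C := by
  rw [← ZeroAtInftyContinuousMap.norm_toBCF_eq_norm]
  exact (BoundedContinuousFunction.norm_le hC).2 h

theorem C0_norm_apply_le (b : C₀(ℤ, A)) (n : ℤ) : ‖b n‖ ≤ ‖b‖ := by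
  rw [← ZeroAtInftyContinuousMap.norm_toBCF_eq_norm]
  exact b.toBCF.norm_coe_le_norm n

theorem C0_finite (b : C₀(ℤ, A)) {ε : ℝ} (hε : 0 < ε) : {n | ¬ ‖b n‖ < ε}.Finite := by
  have h := zero_at_infty b
  rw [Filter.cocompact_eq_cofinite] at h
  have h2 := h.norm.eventually (gt_mem_nhds (by simpa using hε))
  exact h2

/-- A sequence tending to zero, as an element of `C₀(ℤ, A)`. -/
def C0_mk (b : ℤ → A) (hb : Filter.Tendsto b Filter.cofinite (𝓝 0)) : C₀(ℤ, A) where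
  toFun := b
  continuous_toFun := continuous_of_discreteTopology
  zero_at_infty' := by rwa [Filter.cocompact_eq_cofinite]

@[simp]
theorem C0_mk_apply (b : ℤ → A) (hb) (n : ℤ) : C0_mk b hb n = b n := rfl

/-- The element of `C₀(ℤ, A)` with value `a` at `n` and `0` elsewhere. -/
def C0_single (n : ℤ) : A →L[ℂ] C₀(ℤ, A) :=
  LinearMap.mkContinuous
    { toFun := fun a => C0_mk (Pi.single n a) (by
        refine tendsto_const_nhds.congr' ?_
        refine (Set.finite_singleton n).subset fun m hm => ?_
        by_contra hne
        exact hm (Pi.single_eq_of_ne (M := fun _ => A) hne a).symm)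
      map_add' := fun a b => by
        ext m; exact congrFun (Pi.single_add (f := fun _ : ℤ => A) n a b) m
      map_smul' := fun c a => by
        ext m; exact congrFun (Pi.single_smul (f := fun _ : ℤ => A) n c a) m } 1
    (fun a => by
      rw [one_mul]
      refine C0_norm_le (norm_nonneg a) fun m => ?_
      change ‖(Pi.single n a : ℤ → A) m‖ ≤ _
      rw [Pi.single_apply]
      split_ifs <;> simp)

theorem C0_single_apply (n : ℤ) (a : A) (m : ℤ) :
    C0_single n a m = if m = n then a else 0 := Pi.single_apply n a m

theorem norm_C0_single_le (n : ℤ) (a : A) : ‖C0_single n a‖ ≤ ‖a‖ := by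
  refine C0_norm_le (norm_nonneg a) fun m => ?_
  rw [C0_single_apply]; split_ifs <;> simp

theorem C0_hasSum_single (b : C₀(ℤ, A)) : HasSum (fun n => C0_single n (b n)) b := by
  classical
  rw [HasSum, SummationFilter.unconditional_filter, Metric.tendsto_atTop]
  intro ε hε
  refine ⟨(C0_finite b (half_pos hε)).toFinset, fun s hs => ?_⟩
  rw [dist_eq_norm]
  refine lt_of_le_of_lt (C0_norm_le (half_pos hε).le fun m => ?_) (half_lt_self hε)
  have h1 : (∑ n ∈ s, C0_single n (b n)) m = if m ∈ s then b m else 0 := by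
    have : ∀ t : Finset ℤ, (∑ n ∈ t, C0_single n (b n)) m = ∑ n ∈ t, C0_single n (b n) m := by
      intro t
      induction t using Finset.induction_on with
      | empty => simp
      | insert a t ha ih => rw [Finset.sum_insert ha, Finset.sum_insert ha, ← ih]; rfl
    rw [this]
    simp [C0_single_apply]
  rw [ZeroAtInftyContinuousMap.sub_apply, h1]
  split_ifs with hm
  · simp [(half_pos hε).le]
  · rw [zero_sub, norm_neg]
    by_contra hc
    exact hm (hs ((C0_finite b (half_pos hε)).mem_toFinset.2 fun h => hc h.le))

theorem C0_single_mul (n : ℤ) (a : A) (b : C₀(ℤ, A)) :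
    C0_single n a * b = C0_single n (a * b n) := by
  ext m
  rw [ZeroAtInftyContinuousMap.mul_apply, C0_single_apply, C0_single_apply]
  split_ifs with h <;> simp [h]

theorem C0_mul_single (n : ℤ) (a : A) (b : C₀(ℤ, A)) :
    b * C0_single n a = C0_single n (b n * a) := by
  ext m
  rw [ZeroAtInftyContinuousMap.mul_apply, C0_single_apply, C0_single_apply]
  split_ifs with h <;> simp [h]

/-- A closed subspace of `C₀(ℤ, A)` that contains the elements supported at one point is
everything. -/
theorem C0_mem_of_isClosed {S : Submodule ℂ C₀(ℤ, A)} (hS : IsClosed (S : Set C₀(ℤ, A)))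
    (h : ∀ n a, C0_single n a ∈ S) (b : C₀(ℤ, A)) : b ∈ S :=
  hS.mem_of_tendsto (C0_hasSum_single b)
    (Filter.Eventually.of_forall fun _ => S.sum_mem fun n _ => h n (b n))

variable (α : A ≃⋆ₐ[ℂ] A)

theorem bundleAut_apply (b : C₀(ℤ, A)) (n : ℤ) : bundleAut α b n = α (b (n - 1)) := rfl

theorem bundleAut_zpow_apply (k : ℤ) (b : C₀(ℤ, A)) (n : ℤ) :
    (bundleAut α ^ k) b n = (α ^ k) (b (n - k)) := by
  induction k generalizing b n with
  | zero => simp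
  | succ k ih =>
    rw [zpow_add_one, StarAlgEquiv.mul_apply, ih, bundleAut_apply, zpow_add_one,
      StarAlgEquiv.mul_apply, sub_sub]
  | pred k ih =>
    have h : ((bundleAut α)⁻¹) b (n - -k) = α⁻¹ (b (n - -k - (-1))) := rfl
    rw [zpow_sub_one, StarAlgEquiv.mul_apply, ih, zpow_sub_one, StarAlgEquiv.mul_apply, h]
    congr 3
    ring

theorem bundleAut_zpow_single (k n : ℤ) (a : A) :
    (bundleAut α ^ k) (C0_single n a) = C0_single (n + k) ((α ^ k) a) := by
  ext m
  rw [bundleAut_zpow_apply, C0_single_apply, C0_single_apply]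
  by_cases h : m = n + k
  · simp [h]
  · rw [if_neg h, if_neg (by rwa [sub_eq_iff_eq_add]), map_zero]

end BundleAlgebra

/-! ### Covariant representations by shifts, and matrix entries of operators on $\ell^2$. -/

section ShiftRep

variable {B : Type u} [NonUnitalCStarAlgebra B] {β : B ≃⋆ₐ[ℂ] B} {J : Type} {H : Type u}
  [NormedAddCommGroup H] [InnerProductSpace ℂ H] [CompleteSpace H]

/-- The permutation `(n, j) ↦ (n + 1, j)`. -/
def shiftPerm (J : Type) : Equiv.Perm (ℤ × J) := (Equiv.addRight (1 : ℤ)).prodCongr (Equiv.refl J)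

theorem shiftPerm_zpow_apply (l : ℤ) (k : ℤ × J) : (shiftPerm J ^ l) k = (k.1 + l, k.2) := by
  induction l generalizing k with
  | zero => simp
  | succ l ih =>
    rw [zpow_add_one, Equiv.Perm.mul_apply, ih]
    simp [shiftPerm, add_assoc, add_comm (1 : ℤ)]
  | pred l ih =>
    have h : (shiftPerm J)⁻¹ k = (k.1 + -1, k.2) := rfl
    rw [zpow_sub_one, Equiv.Perm.mul_apply, ih, h]
    simp [sub_eq_add_neg, add_assoc, add_comm (-1 : ℤ)]

theorem lpPerm_shiftPerm_zpow_apply (l : ℤ) (f : lp (fun _ : ℤ × J => H) 2) (k : ℤ × J) :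
    ((lpPerm (shiftPerm J) ^ l :
      unitary (lp (fun _ : ℤ × J => H) 2 →L[ℂ] lp (fun _ : ℤ × J => H) 2)) :
      lp (fun _ : ℤ × J => H) 2 →L[ℂ] lp (fun _ : ℤ × J => H) 2) f k = f (k.1 - l, k.2) := by
  rw [← map_zpow, lpPerm_apply, ← zpow_neg, shiftPerm_zpow_apply, sub_eq_add_neg]

/-- The covariant representation on `ℓ²(ℤ × J, H)` given by a compatible family of representations
on `H` and the shift. -/
def shiftCovariantRep (π : ℤ × J → B →⋆ₙₐ[ℂ] (H →L[ℂ] H))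
    (h : ∀ k b, π (k.1 + 1, k.2) (β b) = π k b) : CovariantRep β where
  space := lp (fun _ : ℤ × J => H) 2
  π := lpDiagRep π
  U := lpPerm (shiftPerm J)
  covariant b := by
    rw [← map_inv]
    ext f k
    have h1 : (shiftPerm J)⁻¹ k = (k.1 - 1, k.2) := rfl
    have h2 := h (k.1 - 1, k.2) b
    rw [sub_add_cancel] at h2
    rw [mul_apply_eq_comp, mul_apply_eq_comp, lpPerm_apply, lpDiagRep_apply,
      lpDiagRep_apply, lpPerm_apply, inv_inv, ← Equiv.Perm.mul_apply, mul_inv_cancel, Equiv.Perm.one_apply, h1, ← h2]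

theorem eval_shiftCovariantRep_monomial (π : ℤ × J → B →⋆ₙₐ[ℂ] (H →L[ℂ] H))
    (h : ∀ k b, π (k.1 + 1, k.2) (β b) = π k b) (b : B) (l : ℤ) (f : lp (fun _ : ℤ × J => H) 2)
    (k : ℤ × J) :
    (show lp (fun _ : ℤ × J => H) 2 →L[ℂ] lp (fun _ : ℤ × J => H) 2 from
      CrossedProduct.eval (shiftCovariantRep π h) (CrossedProduct.monomial β b l)) f k =
      π k b (f (k.1 - l, k.2)) := by
  rw [← lpPerm_shiftPerm_zpow_apply l f k]
  rfl

end ShiftRep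

theorem CrossedProduct.clm_ext {B : Type u} [NonUnitalCStarAlgebra B] {β : B ≃⋆ₐ[ℂ] B} {V : Type*}
    [NormedAddCommGroup V] [NormedSpace ℂ V] {F G : CrossedProduct β →L[ℂ] V}
    (h : ∀ b n, F (monomial β b n) = G (monomial β b n)) : F = G := by
  ext x
  have := mem_of_isClosed (S := LinearMap.ker (F - G).toLinearMap) (F - G).isClosed_ker
    (fun b n => by simp [h]) x
  simpa [sub_eq_zero] using this

theorem lp_single_apply_eq_ite {I : Type*} [DecidableEq I] {H : Type v} [NormedAddCommGroup H]
    (k j : I) (v : H) :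
    (lp.single 2 k v : lp (fun _ : I => H) 2) j = if j = k then v else 0 := by
  rw [lp.single_apply, Pi.single_apply]

section LpCoeff

variable {I : Type*} [DecidableEq I] {H : Type v} [NormedAddCommGroup H] [InnerProductSpace ℂ H]

theorem norm_apply_single_apply_le (k k' : I)
    (T : lp (fun _ : I => H) 2 →L[ℂ] lp (fun _ : I => H) 2) (v : H) :
    ‖T (lp.single 2 k' v) k‖ ≤ ‖T‖ * ‖v‖ := by
  refine (lp.norm_apply_le_norm (by norm_num) _ _).trans ?_
  refine (T.le_opNorm _).trans ?_
  rw [lp.norm_single (by norm_num)]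

/-- The matrix coefficient `T ↦ (v ↦ (T (single k' v))_k)`. -/
def lpCoeff (k k' : I) :
    (lp (fun _ : I => H) 2 →L[ℂ] lp (fun _ : I => H) 2) →L[ℂ] (H →L[ℂ] H) :=
  LinearMap.mkContinuous
    { toFun := fun T => lp.evalCLM ℂ (fun _ : I => H) 2 k ∘L T ∘L
        lp.singleContinuousLinearMap ℂ (fun _ : I => H) 2 k'
      map_add' := fun S T => by ext v; rfl
      map_smul' := fun c T => by ext v; rfl } 1 (fun T => by
        rw [one_mul]
        exact ContinuousLinearMap.opNorm_le_bound _ (norm_nonneg T)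
          (norm_apply_single_apply_le k k' T))

theorem lpCoeff_apply (k k' : I) (T : lp (fun _ : I => H) 2 →L[ℂ] lp (fun _ : I => H) 2) (v : H) :
    lpCoeff k k' T v = T (lp.single 2 k' v) k := rfl

theorem norm_lpCoeff_le (k k' : I) (T : lp (fun _ : I => H) 2 →L[ℂ] lp (fun _ : I => H) 2) :
    ‖lpCoeff k k' T‖ ≤ ‖T‖ :=
  ContinuousLinearMap.opNorm_le_bound _ (norm_nonneg T) (norm_apply_single_apply_le k k' T)

end LpCoeff

/-! ### The crossed product as matrices over $\mathcal A$: matrix units and coefficients. -/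

section BundleRep

variable {A H : Type u} [NonUnitalCStarAlgebra A] [NormedAddCommGroup H] [InnerProductSpace ℂ H]
  [CompleteSpace H] (π₀ : A →⋆ₙₐ[ℂ] (H →L[ℂ] H)) (α : A ≃⋆ₐ[ℂ] A)

/-- The representation `a ↦ π₀(α⁻ⁿ(a))`. -/
def twistedRep (n : ℤ) : A →⋆ₙₐ[ℂ] (H →L[ℂ] H) where
  toFun a := π₀ ((α ^ (-n)) a)
  map_smul' c a := by simp
  map_zero' := by simp
  map_add' a b := by simp
  map_mul' a b := by simp
  map_star' a := by simp [map_star]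

theorem twistedRep_apply (n : ℤ) (a : A) : twistedRep π₀ α n a = π₀ ((α ^ (-n)) a) := rfl

/-- The evaluation `b ↦ b n` on `C₀(ℤ, A)`. -/
def C0_eval (n : ℤ) : C₀(ℤ, A) →⋆ₙₐ[ℂ] A where
  toFun b := b n
  map_smul' _ _ := rfl
  map_zero' := rfl
  map_add' _ _ := rfl
  map_mul' _ _ := rfl
  map_star' _ := rfl

theorem C0_eval_apply (n : ℤ) (b : C₀(ℤ, A)) : C0_eval n b = b n := rfl

/-- The covariant representation of `(C₀(ℤ, A), α_*)` on the Hilbert space of the metric bundle. -/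
def bundleCovariantRep : CovariantRep (bundleAut α) :=
  shiftCovariantRep (J := ℕ+ × Fin 4) (fun k => (twistedRep π₀ α k.1).comp (C0_eval k.1)) (by
    rintro ⟨n, j⟩ b
    simp only [NonUnitalStarAlgHom.comp_apply, twistedRep_apply, C0_eval_apply, bundleAut_apply,
      add_sub_cancel_right]
    rw [neg_add, StarAlgEquiv.zpow_add_apply, zpow_neg_one, ← StarAlgEquiv.mul_apply α⁻¹,
      inv_mul_cancel, StarAlgEquiv.one_apply])

/-- The covariant representation of `(A, α)` on the Hilbert space of the metric bundle. -/
def regularCovariantRep : CovariantRep α :=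
  shiftCovariantRep (J := ℕ+ × Fin 4) (fun k => twistedRep π₀ α k.1) (by
    rintro ⟨n, j⟩ b
    simp only [twistedRep_apply]
    rw [neg_add, StarAlgEquiv.zpow_add_apply, zpow_neg_one, ← StarAlgEquiv.mul_apply α⁻¹,
      inv_mul_cancel, StarAlgEquiv.one_apply])

/-- The representation of `C₀(ℤ, A) ⋊ ℤ` on the Hilbert space of the metric bundle. -/
def bundleCrossedRep :
    CrossedProduct (bundleAut α) →⋆ₙₐ[ℂ] (BundleSpace H →L[ℂ] BundleSpace H) :=
  CrossedProduct.eval (bundleCovariantRep π₀ α)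

/-- The representation of `A ⋊ ℤ` on the Hilbert space of the metric bundle. -/
def regularCrossedRep : CrossedProduct α →⋆ₙₐ[ℂ] (BundleSpace H →L[ℂ] BundleSpace H) :=
  CrossedProduct.eval (regularCovariantRep π₀ α)

theorem bundleCrossedRep_monomial (b : C₀(ℤ, A)) (l : ℤ) (f : BundleSpace H)
    (k : ℤ × ℕ+ × Fin 4) :
    bundleCrossedRep π₀ α (CrossedProduct.monomial (bundleAut α) b l) f k =
      π₀ ((α ^ (-k.1)) (b k.1)) (f (k.1 - l, k.2)) :=
  eval_shiftCovariantRep_monomial _ _ _ _ _ _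

theorem regularCrossedRep_monomial (a : A) (l : ℤ) (f : BundleSpace H)
    (k : ℤ × ℕ+ × Fin 4) :
    regularCrossedRep π₀ α (CrossedProduct.monomial α a l) f k =
      π₀ ((α ^ (-k.1)) a) (f (k.1 - l, k.2)) :=
  eval_shiftCovariantRep_monomial _ _ _ _ _ _

/-- The element `δₙ ⊗ αⁿ(c) u^{n-m}` of the crossed product; it acts as a matrix unit with
coefficient `c`. -/
def matUnit (n m : ℤ) : A →L[ℂ] CrossedProduct (bundleAut α) :=
  CrossedProduct.monomialCLM (bundleAut α) (n - m) ∘L C0_single n ∘L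
    NonUnitalStarAlgHom.toCLM ((α ^ n : A ≃⋆ₐ[ℂ] A) : A →⋆ₙₐ[ℂ] A)

theorem matUnit_apply (n m : ℤ) (c : A) : matUnit α n m c =
    CrossedProduct.monomial (bundleAut α) (C0_single n ((α ^ n) c)) (n - m) := rfl

theorem norm_matUnit_le (n m : ℤ) (c : A) : ‖matUnit α n m c‖ ≤ ‖c‖ := by
  rw [matUnit_apply]
  refine (CrossedProduct.norm_monomial_le _ _).trans ((norm_C0_single_le _ _).trans_eq ?_)
  exact StarAlgEquiv.norm_apply _ _

theorem bundleCrossedRep_matUnit (n m : ℤ) (c : A) (f : BundleSpace H) (k : ℤ × ℕ+ × Fin 4) :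
    bundleCrossedRep π₀ α (matUnit α n m c) f k = if k.1 = n then π₀ c (f (m, k.2)) else 0 := by
  rw [matUnit_apply, bundleCrossedRep_monomial, C0_single_apply]
  split_ifs with h
  · rw [h, StarAlgEquiv.zpow_neg_apply_zpow_apply, sub_sub_cancel]
  · simp

/-- The monomial $bu^l$ occupies the $l$-th diagonal, and the sum converges in norm because $b$
vanishes at infinity. Hence matrix units span a dense subspace. -/
theorem hasSum_matUnit (b : C₀(ℤ, A)) (l : ℤ) :
    HasSum (fun n => matUnit α n (n - l) ((α ^ (-n)) (b n)))
      (CrossedProduct.monomial (bundleAut α) b l) := by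
  convert (CrossedProduct.monomialCLM (bundleAut α) l).hasSum (C0_hasSum_single b) using 2 with n
  swap
  · rfl
  rw [matUnit_apply, StarAlgEquiv.zpow_apply_zpow_neg_apply, sub_sub_cancel]
  rfl

variable {α}

theorem CrossedProduct.mem_of_isClosed_of_matUnit {S : Submodule ℂ (CrossedProduct (bundleAut α))}
    (hS : IsClosed (S : Set (CrossedProduct (bundleAut α)))) (h : ∀ n m c, matUnit α n m c ∈ S)
    (x : CrossedProduct (bundleAut α)) : x ∈ S :=
  mem_of_isClosed hS (fun b l => hS.mem_of_tendsto (hasSum_matUnit α b l)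
    (Filter.Eventually.of_forall fun _ => S.sum_mem fun _ _ => h _ _ _)) x

theorem CrossedProduct.clm_ext_of_matUnit {V : Type*} [NormedAddCommGroup V] [NormedSpace ℂ V]
    {F G : CrossedProduct (bundleAut α) →L[ℂ] V}
    (h : ∀ n m c, F (matUnit α n m c) = G (matUnit α n m c)) : F = G := by
  ext x
  have := mem_of_isClosed_of_matUnit (S := LinearMap.ker (F - G).toLinearMap) (F - G).isClosed_ker
    (fun n m c => by simp [h]) x
  simpa [sub_eq_zero] using this

variable {π₀}

/-- On matrix units the entry lies in $\pi_0(\mathcal A)$, which is closed since $\pi_0$ is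
isometric; density does the rest. The fibre $(r,i)=(1,0)$ is an arbitrary choice. -/
theorem exists_matCoeff (hπ : Function.Injective π₀) (n m : ℤ) :
    ∃ L : CrossedProduct (bundleAut α) →L[ℂ] A, ∀ x,
      π₀ (L x) = lpCoeff ((n, 1, 0) : ℤ × ℕ+ × Fin 4) (m, 1, 0) (bundleCrossedRep π₀ α x) := by
  let Ψ : CrossedProduct (bundleAut α) →L[ℂ] (H →L[ℂ] H) :=
    lpCoeff ((n, 1, 0) : ℤ × ℕ+ × Fin 4) (m, 1, 0) ∘L (bundleCrossedRep π₀ α).toCLM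
  refine π₀.exists_lift hπ Ψ fun x => ?_
  refine CrossedProduct.mem_of_isClosed_of_matUnit
    (S := (LinearMap.range π₀.toCLM.toLinearMap).comap Ψ.toLinearMap)
    ((π₀.isClosed_range hπ).preimage Ψ.continuous) (fun n' m' c => ?_) x
  refine ⟨if n' = n ∧ m' = m then c else 0, ?_⟩
  ext v
  change π₀ _ v = bundleCrossedRep π₀ α (matUnit α n' m' c) (lp.single 2 (m, 1, 0) v) (n, 1, 0)
  rw [bundleCrossedRep_matUnit, lp_single_apply_eq_ite]
  by_cases h1 : n' = n <;> by_cases h2 : m' = m <;>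
    simp [h1, h2, eq_comm (a := n)]

/-- The `(n, m)` matrix coefficient, in `A`, of an element of `C₀(ℤ, A) ⋊ ℤ`. -/
def matCoeff (hπ : Function.Injective π₀) (n m : ℤ) : CrossedProduct (bundleAut α) →L[ℂ] A :=
  (exists_matCoeff hπ n m).choose

theorem matCoeff_spec (hπ : Function.Injective π₀) (n m : ℤ) (x : CrossedProduct (bundleAut α)) :
    π₀ (matCoeff hπ n m x) =
      lpCoeff ((n, 1, 0) : ℤ × ℕ+ × Fin 4) (m, 1, 0) (bundleCrossedRep π₀ α x) :=
  (exists_matCoeff hπ n m).choose_spec x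

theorem norm_matCoeff_le (hπ : Function.Injective π₀) (n m : ℤ)
    (x : CrossedProduct (bundleAut α)) : ‖matCoeff hπ n m x‖ ≤ ‖x‖ := by
  rw [← NonUnitalStarAlgHom.norm_map π₀ hπ, matCoeff_spec]
  exact (norm_lpCoeff_le _ _ _).trans (NonUnitalStarAlgHom.norm_apply_le _ x)

theorem matCoeff_matUnit (hπ : Function.Injective π₀) (n m n' m' : ℤ) (c : A) :
    matCoeff hπ n m (matUnit α n' m' c) = if n = n' ∧ m = m' then c else 0 := by
  apply hπ
  rw [matCoeff_spec]
  ext v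
  rw [lpCoeff_apply, bundleCrossedRep_matUnit, lp_single_apply_eq_ite]
  by_cases h1 : n = n' <;> by_cases h2 : m' = m <;> simp [h1, h2, eq_comm (a := m)]

/-- The crossed product does not see the fibre index, so the coefficients read off in the fibre
$(1,0)$ describe the action in all fibres. -/
theorem bundleCrossedRep_single (hπ : Function.Injective π₀) (x : CrossedProduct (bundleAut α))
    (k k' : ℤ × ℕ+ × Fin 4) (v : H) :
    bundleCrossedRep π₀ α x (lp.single 2 k' v) k =
      if k.2 = k'.2 then π₀ (matCoeff hπ k.1 k'.1 x) v else 0 := by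
  let F : CrossedProduct (bundleAut α) →L[ℂ] (H →L[ℂ] H) :=
    lpCoeff k k' ∘L (bundleCrossedRep π₀ α).toCLM
  let G : CrossedProduct (bundleAut α) →L[ℂ] (H →L[ℂ] H) :=
    if k.2 = k'.2 then π₀.toCLM ∘L matCoeff hπ k.1 k'.1 else 0
  have hFG : F = G := by
    refine CrossedProduct.clm_ext_of_matUnit fun n m c => ?_
    ext v
    change bundleCrossedRep π₀ α (matUnit α n m c) (lp.single 2 k' v) k = _
    rw [bundleCrossedRep_matUnit, lp_single_apply_eq_ite]
    by_cases h : k.2 = k'.2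
    · simp only [G, if_pos h, ContinuousLinearMap.comp_apply, NonUnitalStarAlgHom.toCLM_apply,
        matCoeff_matUnit]
      by_cases h1 : k.1 = n <;> by_cases h2 : k'.1 = m <;>
        simp [h1, h2, h, Prod.ext_iff, eq_comm (a := m)]
    · have h' : ¬ ((m, k.2) = k') := fun e => h (by rw [← e])
      simp [G, h, h']
  have h : bundleCrossedRep π₀ α x (lp.single 2 k' v) k = G x v := congrArg (fun T => T x v) hFG
  rw [h]
  split_ifs with h <;> simp [G, h]

theorem matUnit_mul_mul_matUnit (hπ : Function.Injective π₀) (n m : ℤ) (k k' : A)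
    (x : CrossedProduct (bundleAut α)) :
    matUnit α n n k * x * matUnit α m m k' = matUnit α n m (k * matCoeff hπ n m x * k') := by
  let mulL := ContinuousLinearMap.mul ℂ (CrossedProduct (bundleAut α))
  let mulA := ContinuousLinearMap.mul ℂ A
  let F : CrossedProduct (bundleAut α) →L[ℂ] CrossedProduct (bundleAut α) :=
    mulL.flip (matUnit α m m k') ∘L mulL (matUnit α n n k)
  let G : CrossedProduct (bundleAut α) →L[ℂ] CrossedProduct (bundleAut α) :=
    matUnit α n m ∘L mulA.flip k' ∘L mulA k ∘L matCoeff hπ n m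
  have hFG : F = G := by
    refine CrossedProduct.clm_ext_of_matUnit fun n' m' c => ?_
    change matUnit α n n k * matUnit α n' m' c * matUnit α m m k' =
      matUnit α n m (k * matCoeff hπ n m (matUnit α n' m' c) * k')
    rw [matCoeff_matUnit]
    simp only [matUnit_apply, CrossedProduct.monomial_mul_monomial, sub_self, zpow_zero,
      StarAlgEquiv.one_apply, zero_add, add_zero, bundleAut_zpow_single]
    rw [C0_single_mul, C0_single_mul, C0_single_apply, C0_single_apply]
    by_cases h1 : n = n'
    · subst h1
      by_cases h2 : m = m'
      · subst h2
        simp [← StarAlgEquiv.zpow_add_apply]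
      · have h3 : ¬ (n = m + (n - m')) := fun h => h2 (by linarith)
        simp only [h2, h3, and_false, if_false]
        simp [← CrossedProduct.monomialCLM_apply]
    · simp only [h1, false_and, if_false]
      simp [← CrossedProduct.monomialCLM_apply]
  exact congrArg (fun T => T x) hFG

/-- A matrix unit has at most one nonzero entry on a diagonal, and coefficients are contractive, so
the decay passes to norm limits. This reflects the factor $c_0(\mathbb Z)$ and replaces compactness
of the base. -/
theorem tendsto_matCoeff (hπ : Function.Injective π₀) (n m : ℤ) (x : CrossedProduct (bundleAut α)) :
    Filter.Tendsto (fun r : ℕ => matCoeff hπ (n - r) (m - r) x) Filter.atTop (𝓝 0) := by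
  let S : Submodule ℂ (CrossedProduct (bundleAut α)) :=
    { carrier := {x | Filter.Tendsto (fun r : ℕ => matCoeff hπ (n - r) (m - r) x)
        Filter.atTop (𝓝 0)}
      zero_mem' := by simp
      add_mem' := fun {x y} hx hy => by
        have := Filter.Tendsto.add hx hy
        simpa using this
      smul_mem' := fun c x hx => by
        have := Filter.Tendsto.const_smul hx c
        simpa using this }
  refine CrossedProduct.mem_of_isClosed_of_matUnit (S := S) ?_ (fun n' m' c => ?_) x
  · refine isClosed_of_closure_subset fun y hy => ?_
    change Filter.Tendsto _ _ _
    rw [Metric.tendsto_atTop]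
    intro ε hε
    obtain ⟨z, hz, hd⟩ := Metric.mem_closure_iff.1 hy (ε / 2) (half_pos hε)
    obtain ⟨N, hN⟩ := Metric.tendsto_atTop.1 hz (ε / 2) (half_pos hε)
    refine ⟨N, fun r hr => ?_⟩
    have h1 := hN r hr
    have h2 := norm_matCoeff_le hπ (n - r) (m - r) (y - z)
    rw [dist_zero_right] at h1 ⊢
    rw [dist_eq_norm] at hd
    rw [map_sub] at h2
    have h3 := norm_sub_norm_le (matCoeff hπ (n - r) (m - r) y) (matCoeff hπ (n - r) (m - r) z)
    linarith
  · refine tendsto_const_nhds.congr' ?_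
    filter_upwards [Filter.eventually_gt_atTop (n - n').toNat] with r hr
    rw [matCoeff_matUnit, if_neg]
    rintro ⟨h1, -⟩
    omega

end BundleRep

/-! ### Strictly positive elements, faithfulness and precompactness. -/

section StrictlyPositive

/-- From $(hbh)x(hb'h)=hb(hxh)b'h=0$ and density, $wxw'=0$ for all $w,w'$; the choice $w=w'=x^*$ and
the C*-identity give $x=0$. -/
theorem eq_zero_of_dense_of_mul_mul_eq_zero {B : Type*} [NonUnitalCStarAlgebra B] {h x : B}
    (hd : Dense (Set.range fun b : B => h * b * h)) (hx : h * x * h = 0) : x = 0 := by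
  have h1 : ∀ w w' : B, w * x * w' = 0 := by
    intro w w'
    refine DenseRange.induction_on hd (p := fun w => w * x * w' = 0) w
      (isClosed_eq (by fun_prop) continuous_const) ?_
    rintro b
    refine DenseRange.induction_on hd (p := fun w' => h * b * h * x * w' = 0) w'
      (isClosed_eq (by fun_prop) continuous_const) ?_
    rintro b'
    calc h * b * h * x * (h * b' * h) = h * b * (h * x * h) * b' * h := by simp only [mul_assoc]
      _ = 0 := by rw [hx]; simp
  have h2 : star (star x * x) * (star x * x) = 0 := by
    have := congrArg (fun y => y * x) (h1 (star x) (star x))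
    simpa [mul_assoc] using this
  rw [CStarRing.star_mul_self_eq_zero_iff, CStarRing.star_mul_self_eq_zero_iff] at h2
  exact h2

theorem mul_mul_eq_tsum {B ι : Type*} [NonUnitalCStarAlgebra B] {f : ι → B} {a : B}
    (hf : HasSum f a) (hs : Summable fun i => ‖f i‖) (x : B) :
    a * x * a = ∑' p : ι × ι, f p.1 * x * f p.2 := by
  have hs' : Summable fun i => ‖f i * x‖ :=
    Summable.of_nonneg_of_le (fun _ => norm_nonneg _) (fun _ => norm_mul_le _ _) (hs.mul_right ‖x‖)
  have h : Summable fun p : ι × ι => ‖f p.1 * x * f p.2‖ :=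
    Summable.of_nonneg_of_le (fun _ => norm_nonneg _) (fun _ => norm_mul_le _ _)
      (hs'.mul_of_nonneg hs (fun _ => norm_nonneg _) fun _ => norm_nonneg _)
  exact ((hf.mul_right x).mul hf h.of_norm).tsum_eq.symm

variable {A : Type u} [NonUnitalCStarAlgebra A]

/-- The weights `2^{-|n|}`. -/
def bundleWeight (n : ℤ) : ℝ := (1 / 2 : ℝ) ^ n.natAbs

theorem bundleWeight_pos (n : ℤ) : 0 < bundleWeight n := by unfold bundleWeight; positivity

theorem bundleWeight_ne_zero (n : ℤ) : (bundleWeight n : ℂ) ≠ 0 :=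
  Complex.ofReal_ne_zero.2 (bundleWeight_pos n).ne'

theorem summable_bundleWeight : Summable bundleWeight := by
  refine Summable.of_nat_of_neg ?_ ?_ <;>
  · simp only [bundleWeight, Int.natAbs_neg, Int.natAbs_natCast]
    exact summable_geometric_of_lt_one (by norm_num) (by norm_num)

theorem bundleWeight_le_one (n : ℤ) : bundleWeight n ≤ 1 :=
  pow_le_one₀ (by norm_num) (by norm_num)

theorem summable_bundleWeight_sq : Summable fun n => bundleWeight n ^ 2 :=
  summable_bundleWeight.of_nonneg_of_le (fun n => by positivity) fun n => by
    nlinarith [bundleWeight_pos n, bundleWeight_le_one n]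

variable (α : A ≃⋆ₐ[ℂ] A)

/-- The element `(sₙ αⁿ(a))ₙ` of `C₀(ℤ, A)`, for a summable sequence of real numbers `s`. -/
def weightedOrbit (s : ℤ → ℝ) (hs : Summable s) (a : A) : C₀(ℤ, A) :=
  C0_mk (fun n => (s n : ℂ) • (α ^ n) a) (by
    rw [tendsto_zero_iff_norm_tendsto_zero]
    have h := (hs.tendsto_cofinite_zero.norm).mul_const ‖a‖
    rw [norm_zero, zero_mul] at h
    refine h.congr fun n => ?_
    rw [norm_smul, StarAlgEquiv.norm_apply, Complex.norm_real])

theorem weightedOrbit_apply (s : ℤ → ℝ) (hs : Summable s) (a : A) (n : ℤ) :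
    weightedOrbit α s hs a n = (s n : ℂ) • (α ^ n) a := rfl

/-- The element `(4^{-|n|} αⁿ(h₀))ₙ` of `C₀(ℤ, A)`. -/
def bundlePositive (h₀ : A) : C₀(ℤ, A) :=
  weightedOrbit α (fun n => bundleWeight n ^ 2) summable_bundleWeight_sq h₀

theorem bundlePositive_apply (h₀ : A) (n : ℤ) :
    bundlePositive α h₀ n = ((bundleWeight n : ℂ) ^ 2) • (α ^ n) h₀ := by
  rw [bundlePositive, weightedOrbit_apply]; simp

theorem exists_bundlePositive_eq {h₀ : A} (h : ∃ k, h₀ = star k * k) :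
    ∃ k, bundlePositive α h₀ = star k * k := by
  obtain ⟨k, rfl⟩ := h
  -- The weights $4^{-|n|}$ are squares so that the element with weights $2^{-|n|}$ is a root.
  refine ⟨weightedOrbit α bundleWeight summable_bundleWeight k, ?_⟩
  ext n
  rw [bundlePositive_apply, ZeroAtInftyContinuousMap.mul_apply, ZeroAtInftyContinuousMap.star_apply,
    weightedOrbit_apply, star_smul, smul_mul_smul_comm, map_mul, map_star, sq]
  congr 2
  simp

theorem dense_range_bundlePositive {h₀ : A} (h : Dense (Set.range fun a : A => h₀ * a * h₀)) :
    Dense (Set.range fun b : C₀(ℤ, A) => bundlePositive α h₀ * b * bundlePositive α h₀) := by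
  let mulB := ContinuousLinearMap.mul ℂ C₀(ℤ, A)
  let F : C₀(ℤ, A) →L[ℂ] C₀(ℤ, A) := mulB.flip (bundlePositive α h₀) ∘L mulB (bundlePositive α h₀)
  suffices hS : ∀ b, b ∈ (LinearMap.range F.toLinearMap).topologicalClosure from fun b => hS b
  refine C0_mem_of_isClosed (Submodule.isClosed_topologicalClosure _) fun n a => ?_
  set S := (LinearMap.range F.toLinearMap).topologicalClosure
  have key : ∀ b : A, C0_single n ((α ^ n) (h₀ * b * h₀)) ∈ S := by
    intro b
    have h1 : F (C0_single n ((α ^ n) b)) = ((bundleWeight n : ℂ) ^ 4) •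
        C0_single n ((α ^ n) (h₀ * b * h₀)) := by
      change bundlePositive α h₀ * _ * bundlePositive α h₀ = _
      rw [C0_mul_single, C0_single_mul, bundlePositive_apply]
      simp only [smul_mul_assoc, mul_smul_comm, smul_smul, map_smul, ← map_mul (α ^ n)]
      congr 1
      ring
    have h2 : F (C0_single n ((α ^ n) b)) ∈ S := Submodule.le_topologicalClosure _ ⟨_, rfl⟩
    rw [h1] at h2
    exact (S.smul_mem_iff (pow_ne_zero 4 (bundleWeight_ne_zero n))).1 h2
  have h3 : ∀ b : A, C0_single n ((α ^ n) b) ∈ S := fun b =>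
    DenseRange.induction_on h (p := fun b => C0_single n ((α ^ n) b) ∈ S) b
      ((Submodule.isClosed_topologicalClosure _).preimage
        ((C0_single n).continuous.comp (StarAlgEquiv.isometry (α ^ n)).continuous)) key
  have := h3 ((α ^ (-n)) a)
  rwa [StarAlgEquiv.zpow_apply_zpow_neg_apply] at this

/-- The strictly positive element of the crossed product given by `bundlePositive`. -/
def crossedPositive (h₀ : A) : CrossedProduct (bundleAut α) :=
  CrossedProduct.monomial (bundleAut α) (bundlePositive α h₀) 0

theorem exists_crossedPositive_eq {h₀ : A} (h : ∃ k, h₀ = star k * k) :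
    ∃ k, crossedPositive α h₀ = star k * k := by
  obtain ⟨k, hk⟩ := exists_bundlePositive_eq α h
  refine ⟨CrossedProduct.monomial (bundleAut α) k 0, ?_⟩
  rw [CrossedProduct.star_monomial, CrossedProduct.monomial_mul_monomial, crossedPositive, hk]
  simp

theorem hasSum_crossedPositive (h₀ : A) :
    HasSum (fun n => ((bundleWeight n : ℂ) ^ 2) • matUnit α n n h₀) (crossedPositive α h₀) := by
  convert hasSum_matUnit α (bundlePositive α h₀) 0 using 2 with n
  swap
  · rfl
  rw [bundlePositive_apply, map_smul, StarAlgEquiv.zpow_neg_apply_zpow_apply, sub_zero, map_smul]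

theorem summable_norm_crossedPositive (h₀ : A) :
    Summable (fun n => ‖((bundleWeight n : ℂ) ^ 2) • matUnit α n n h₀‖) := by
  refine (summable_bundleWeight_sq.mul_right ‖h₀‖).of_nonneg_of_le (fun _ => norm_nonneg _) fun n => ?_
  rw [norm_smul, norm_pow, Complex.norm_real, Real.norm_eq_abs, sq_abs]
  exact mul_le_mul_of_nonneg_left (norm_matUnit_le α n n h₀) (by positivity)

variable {α}
variable {H : Type u} [NormedAddCommGroup H] [InnerProductSpace ℂ H]
  [CompleteSpace H] {π₀ : A →⋆ₙₐ[ℂ] (H →L[ℂ] H)}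

/-- The twist by $\alpha^n$ cancels in the representation, so the positive element is the absolutely
convergent diagonal matrix with entries $4^{-|n|}h_0$; the compression therefore depends on $x$ only
through its coefficients. -/
theorem crossedPositive_mul_mul (hπ : Function.Injective π₀) (h₀ : A)
    (x : CrossedProduct (bundleAut α)) :
    crossedPositive α h₀ * x * crossedPositive α h₀ =
      ∑' p : ℤ × ℤ, (((bundleWeight p.1 : ℂ) ^ 2) * ((bundleWeight p.2 : ℂ) ^ 2)) •
        matUnit α p.1 p.2 (h₀ * matCoeff hπ p.1 p.2 x * h₀) := by
  rw [mul_mul_eq_tsum (hasSum_crossedPositive α h₀) (summable_norm_crossedPositive α h₀)]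
  refine tsum_congr fun p => ?_
  rw [smul_mul_assoc, smul_mul_smul_comm, matUnit_mul_mul_matUnit hπ]

theorem crossedPositive_mul_matUnit_mul (hπ : Function.Injective π₀) (h₀ c : A) (n m : ℤ) :
    crossedPositive α h₀ * matUnit α n m c * crossedPositive α h₀ =
      (((bundleWeight n : ℂ) ^ 2) * ((bundleWeight m : ℂ) ^ 2)) •
        matUnit α n m (h₀ * c * h₀) := by
  rw [crossedPositive_mul_mul hπ, tsum_eq_single (n, m)]
  · simp [matCoeff_matUnit]
  · rintro ⟨n', m'⟩ hne
    have h : ¬ (n' = n ∧ m' = m) := fun h => hne (by rw [h.1, h.2])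
    simp [matCoeff_matUnit, h]

theorem dense_range_crossedPositive (hπ : Function.Injective π₀) {h₀ : A}
    (h : Dense (Set.range fun a : A => h₀ * a * h₀)) :
    Dense (Set.range fun x : CrossedProduct (bundleAut α) =>
      crossedPositive α h₀ * x * crossedPositive α h₀) := by
  let mulB := ContinuousLinearMap.mul ℂ (CrossedProduct (bundleAut α))
  let F : CrossedProduct (bundleAut α) →L[ℂ] CrossedProduct (bundleAut α) :=
    mulB.flip (crossedPositive α h₀) ∘L mulB (crossedPositive α h₀)
  suffices hS : ∀ b, b ∈ (LinearMap.range F.toLinearMap).topologicalClosure from fun b => hS b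
  refine CrossedProduct.mem_of_isClosed_of_matUnit (Submodule.isClosed_topologicalClosure _)
    fun n m a => ?_
  set S := (LinearMap.range F.toLinearMap).topologicalClosure
  refine DenseRange.induction_on h (p := fun b => matUnit α n m b ∈ S) a
      ((Submodule.isClosed_topologicalClosure _).preimage (matUnit α n m).continuous) fun b => ?_
  have h2 : F (matUnit α n m b) ∈ S := Submodule.le_topologicalClosure _ ⟨_, rfl⟩
  change crossedPositive α h₀ * _ * crossedPositive α h₀ ∈ S at h2
  rw [crossedPositive_mul_matUnit_mul hπ] at h2
  exact (S.smul_mem_iff (mul_ne_zero (pow_ne_zero 2 (bundleWeight_ne_zero n))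
    (pow_ne_zero 2 (bundleWeight_ne_zero m)))).1 h2

/-- Vanishing coefficients make the compression by a strictly positive element vanish, which
suffices. This yields faithfulness on the universal crossed product without an amenability argument.
-/
theorem CrossedProduct.eq_zero_of_matCoeff (hπ : Function.Injective π₀) {h₀ : A}
    (h : Dense (Set.range fun a : A => h₀ * a * h₀)) {x : CrossedProduct (bundleAut α)}
    (hx : ∀ n m, matCoeff hπ n m x = 0) : x = 0 := by
  refine eq_zero_of_dense_of_mul_mul_eq_zero (dense_range_crossedPositive hπ h) ?_
  rw [crossedPositive_mul_mul hπ]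
  simp [hx]

theorem bundleCrossedRep_injective (hπ : Function.Injective π₀) {h₀ : A}
    (h : Dense (Set.range fun a : A => h₀ * a * h₀)) :
    Function.Injective (bundleCrossedRep π₀ α) := by
  rw [injective_iff_map_eq_zero]
  intro x hx
  refine CrossedProduct.eq_zero_of_matCoeff hπ h fun n m => hπ ?_
  rw [matCoeff_spec, hx, map_zero, map_zero]

/-- By Tychonoff the families with values in $\overline Q$ form a compact set, and the weighted sum
over matrix units is continuous on it. -/
theorem totallyBounded_crossedPositive (hπ : Function.Injective π₀) {h₀ : A} {Q : Set A}
    (hQ : TotallyBounded Q) {T : Set (CrossedProduct (bundleAut α))}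
    (hT : ∀ x ∈ T, ∀ n m, h₀ * matCoeff hπ n m x * h₀ ∈ Q) :
    TotallyBounded ((fun x => crossedPositive α h₀ * x * crossedPositive α h₀) '' T) := by
  have hK : IsCompact (closure Q) := hQ.closure.isCompact_of_isClosed isClosed_closure
  obtain ⟨M, hM⟩ := hK.isBounded.exists_norm_le
  let F : (ℤ × ℤ → A) → CrossedProduct (bundleAut α) := fun q =>
    ∑' p : ℤ × ℤ, (((bundleWeight p.1 : ℂ) ^ 2) * ((bundleWeight p.2 : ℂ) ^ 2)) •
      matUnit α p.1 p.2 (q p)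
  have hsum : Summable fun p : ℤ × ℤ => bundleWeight p.1 ^ 2 * bundleWeight p.2 ^ 2 * M :=
    (summable_bundleWeight_sq.mul_of_nonneg summable_bundleWeight_sq (fun _ => by positivity)
      fun _ => by positivity).mul_right M
  -- Weierstrass test: the terms are dominated by $4^{-|n|}4^{-|m|}M$, with $M$ a norm bound on
  -- $\overline Q$.
  have hF : ContinuousOn F (Set.univ.pi fun _ => closure Q) := by
    refine continuousOn_tsum (fun p => ?_) hsum fun p q hq => ?_
    · exact ((((bundleWeight p.1 : ℂ) ^ 2 * (bundleWeight p.2 : ℂ) ^ 2) •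
        matUnit α p.1 p.2).continuous.comp (continuous_apply p)).continuousOn
    · rw [norm_smul, norm_mul, norm_pow, norm_pow, Complex.norm_real, Complex.norm_real,
        Real.norm_eq_abs, Real.norm_eq_abs, sq_abs, sq_abs]
      gcongr
      exact (norm_matUnit_le α _ _ _).trans (hM _ (hq p trivial))
  refine ((isCompact_univ_pi fun _ => hK).image_of_continuousOn hF).totallyBounded.subset ?_
  rintro _ ⟨x, hx, rfl⟩
  exact ⟨fun p => h₀ * matCoeff hπ p.1 p.2 x * h₀, fun p _ => subset_closure (hT x hx p.1 p.2),
    (crossedPositive_mul_mul hπ h₀ x).symm⟩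

end StrictlyPositive

/-! ### Bounded commutators and their matrix entries. -/

section CommutatorGraph

variable {H : Type v} [NormedAddCommGroup H] [InnerProductSpace ℂ H]

theorem isCommutator_iff_graph {D : H →ₗ.[ℂ] H} {T S : H →L[ℂ] H} :
    IsCommutator D T S ↔ ∀ x y, (x, y) ∈ D.graph → (T x, S x + T y) ∈ D.graph := by
  constructor
  · intro h x y hxy
    obtain ⟨hx, rfl⟩ := LinearPMap.exists_eq_of_mem_graph hxy
    obtain ⟨h1, h2⟩ := h ⟨x, hx⟩
    rw [← h2, sub_add_cancel]
    exact D.mem_graph ⟨T x, h1⟩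
  · intro h x
    obtain ⟨h1, h2⟩ := LinearPMap.exists_eq_of_mem_graph (h _ _ (D.mem_graph x))
    exact ⟨h1, by rw [h2, add_sub_cancel_right]⟩

theorem IsCommutator.add {D : H →ₗ.[ℂ] H} {T S T' S' : H →L[ℂ] H} (h : IsCommutator D T S)
    (h' : IsCommutator D T' S') : IsCommutator D (T + T') (S + S') := by
  rw [isCommutator_iff_graph] at *
  intro x y hxy
  convert D.graph.add_mem (h x y hxy) (h' x y hxy) using 1
  refine Prod.ext rfl ?_
  simp only [add_apply, Prod.snd_add]
  abel

theorem IsCommutator.smul {D : H →ₗ.[ℂ] H} {T S : H →L[ℂ] H} (c : ℂ) (h : IsCommutator D T S) :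
    IsCommutator D (c • T) (c • S) := by
  rw [isCommutator_iff_graph] at *
  intro x y hxy
  convert D.graph.smul_mem c (h x y hxy) using 1
  refine Prod.ext rfl ?_
  simp

theorem isCommutator_zero (D : H →ₗ.[ℂ] H) : IsCommutator D 0 0 := by
  rw [isCommutator_iff_graph]
  intro x y _
  simp

/-- The subspace of elements having a bounded commutator with `D`. -/
def boundedCommutator {A : Type*} [NonUnitalCStarAlgebra A] (D : H →ₗ.[ℂ] H) [CompleteSpace H]
    (π : A →⋆ₙₐ[ℂ] (H →L[ℂ] H)) : Submodule ℂ A where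
  carrier := {a | ∃ S, IsCommutator D (π a) S}
  zero_mem' := ⟨0, by rw [map_zero]; exact isCommutator_zero D⟩
  add_mem' := by
    rintro a b ⟨S, hS⟩ ⟨T, hT⟩
    exact ⟨S + T, by rw [map_add]; exact hS.add hT⟩
  smul_mem' := by
    rintro c a ⟨S, hS⟩
    exact ⟨c • S, by rw [map_smul]; exact hS.smul c⟩

end CommutatorGraph

section BundleSingle

variable {H : Type v} [NormedAddCommGroup H] [InnerProductSpace ℂ H] {D : H →ₗ.[ℂ] H}

theorem single_mem_bundleDirac_graph {v w : H} (h : (v, w) ∈ D.graph) (k : ℤ × ℕ+ × Fin 4) :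
    ((lp.single 2 k v : BundleSpace H),
      (lp.single 2 k ((bundleDiracTypeData.ε k : ℂ) • w) +
      lp.single 2 (bundleDiracTypeData.τ k)
        (bundleDiracTypeData.c (bundleDiracTypeData.τ k) • v) +
      (lp.single 2 (fiberSwap k) v - lp.single 2 (fiberShiftSwap k) v) : BundleSpace H)) ∈
      (bundleDirac D).graph := by
  rw [mem_bundleDirac_graph]
  intro j
  have h1 : ∀ {e : ℤ × ℕ+ × Fin 4 ≃ ℤ × ℕ+ × Fin 4}, (∀ i, e (e i) = i) → (e j = k ↔ j = e k) :=
    fun {e} he => ⟨fun h => by rw [← h, he], fun h => by rw [h, he]⟩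
  have hτ := h1 bundleDiracTypeData.τ_τ
  have hμ := h1 (e := fiberSwap) fiberSwap.left_inv
  have hν := h1 (e := fiberShiftSwap) fiberShiftSwap.left_inv
  refine ⟨if j = k then w else 0, ?_, ?_⟩
  · rw [lp_single_apply_eq_ite]
    split_ifs
    · exact h
    · exact D.graph.zero_mem
  · simp only [lp.coeFn_add, lp.coeFn_sub, Pi.add_apply, Pi.sub_apply, lp_single_apply_eq_ite,
      hτ, hμ, hν, smul_ite, smul_zero]
    congr 2
    · split_ifs with h2
      · rw [h2]
      · rfl
    · split_ifs with h2
      · rw [h2]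
      · rfl

end BundleSingle

section BundleTriple

variable {A H : Type u} [NonUnitalCStarAlgebra A] [NormedAddCommGroup H] [InnerProductSpace ℂ H]
  [CompleteSpace H] {π₀ : A →⋆ₙₐ[ℂ] (H →L[ℂ] H)} {α : A ≃⋆ₐ[ℂ] A} {D : H →ₗ.[ℂ] H}

/-- None of $\tau$ and the two swaps sends the spinor index $0$ to itself, so between two positions
with index $0$ only the summand $\gamma_5D$ contributes, with sign $+1$. -/
theorem isCommutator_matCoeff (hπ : Function.Injective π₀) {x : CrossedProduct (bundleAut α)}
    {S : BundleSpace H →L[ℂ] BundleSpace H}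
    (hS : IsCommutator (bundleDirac D) (bundleCrossedRep π₀ α x) S) (n m : ℤ) :
    IsCommutator D (π₀ (matCoeff hπ n m x))
      (lpCoeff ((n, 1, 0) : ℤ × ℕ+ × Fin 4) (m, 1, 0) S) := by
  rw [isCommutator_iff_graph] at hS ⊢
  intro v w hvw
  have h1 := hS _ _ (single_mem_bundleDirac_graph hvw (m, 1, 0))
  rw [mem_bundleDirac_graph] at h1
  obtain ⟨y, hy, h2⟩ := h1 (n, 1, 0)
  simp only [map_add, map_sub, lp.coeFn_add, lp.coeFn_sub, Pi.add_apply, Pi.sub_apply,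
    bundleCrossedRep_single hπ, fiberSwap_apply, fiberShiftSwap_apply, bundleDiracTypeData,
    if_true] at hy h2
  simp at h2
  rw [lpCoeff_apply, h2]
  exact hy

/-- Between the spinor indices $1$ and $3$ only $\nabla$ contributes: $\tau$ does not link them, and
$D$ is diagonal. The unshifted terms $x_{nm}$ cancel, leaving the shifted ones. -/
theorem map_matCoeff_sub_eq_lpCoeff (hπ : Function.Injective π₀) (hD : Dense (D.domain : Set H))
    {x : CrossedProduct (bundleAut α)} {S : BundleSpace H →L[ℂ] BundleSpace H}
    (hS : IsCommutator (bundleDirac D) (bundleCrossedRep π₀ α x) S) (n m : ℤ) (r : ℕ+) :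
    π₀ (matCoeff hπ n (m + r) x - matCoeff hπ (n - r) m x) =
      lpCoeff ((n, r, 1) : ℤ × ℕ+ × Fin 4) (m, r, 3) S := by
  refine ContinuousLinearMap.coeFn_injective (Continuous.ext_on hD
    (ContinuousLinearMap.continuous _) (ContinuousLinearMap.continuous _) fun v hv => ?_)
  rw [isCommutator_iff_graph] at hS
  have h1 := hS _ _ (single_mem_bundleDirac_graph (D.mem_graph ⟨v, hv⟩) (m, r, 3))
  rw [mem_bundleDirac_graph] at h1
  obtain ⟨y, hy, h2⟩ := h1 (n, r, 1)
  simp only [map_add, map_sub, lp.coeFn_add, lp.coeFn_sub, Pi.add_apply, Pi.sub_apply,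
    bundleCrossedRep_single hπ, fiberSwap_apply, fiberShiftSwap_apply, bundleDiracTypeData] at hy h2
  rw [if_neg (by simp)] at hy
  obtain rfl : y = 0 := D.graph_fst_eq_zero_snd hy rfl
  simp [Fin.rev] at h2
  rw [lpCoeff_apply, map_sub, sub_apply]
  rw [eq_sub_of_add_eq h2, sub_eq_add_neg n]
  abel

/-- The difference $x_{nm}-x_{n-r,m-r}$ is an entry of $S$ for every $r>0$, and the second term
tends to $0$. -/
theorem norm_matCoeff_le_of_isCommutator (hπ : Function.Injective π₀)
    (hD : Dense (D.domain : Set H))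
    {x : CrossedProduct (bundleAut α)} {S : BundleSpace H →L[ℂ] BundleSpace H}
    (hS : IsCommutator (bundleDirac D) (bundleCrossedRep π₀ α x) S) (n m : ℤ) :
    ‖matCoeff hπ n m x‖ ≤ ‖S‖ := by
  have h1 : Filter.Tendsto (fun r : ℕ => ‖matCoeff hπ n m x - matCoeff hπ (n - r) (m - r) x‖)
      Filter.atTop (𝓝 ‖matCoeff hπ n m x - 0‖) :=
    (tendsto_const_nhds.sub (tendsto_matCoeff hπ n m x)).norm
  rw [sub_zero] at h1
  refine le_of_tendsto h1 ?_
  filter_upwards [Filter.eventually_gt_atTop 0] with r hr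
  have h2 := map_matCoeff_sub_eq_lpCoeff hπ hD hS n (m - r) ⟨r, hr⟩
  rw [← NonUnitalStarAlgHom.norm_map π₀ hπ]
  simp only [PNat.mk_coe, sub_add_cancel] at h2
  rw [h2]
  exact norm_lpCoeff_le _ _ _

theorem norm_bundleDiracTypeData_ε (k : ℤ × ℕ+ × Fin 4) :
    ‖(bundleDiracTypeData.ε k : ℂ)‖ = 1 := by
  obtain ⟨n, r, i⟩ := k
  fin_cases i <;> simp [bundleDiracTypeData]

/-- The part of $c$ in $r$ cancels, so shifting $n$ changes $c$ by a bounded amount, uniformly over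
the fibres. -/
theorem bundleDiracTypeData_c_sub (n m : ℤ) (j : ℕ+ × Fin 4) :
    bundleDiracTypeData.c (n, j) - bundleDiracTypeData.c (m, j) =
      (bundleDiracTypeData.ε (n, j) : ℂ) * (Complex.I * (n - m)) := by
  obtain ⟨r, i⟩ := j
  fin_cases i <;> simp [bundleDiracTypeData] <;> ring

/-- The commutator has three bounded parts: that with the bounded part of $D_Y$, the block `V` from
$[D,\pi_0(c)]$, and the block `W` from the difference of the coefficients in rows $n$ and $m$. -/
theorem exists_isCommutator_matUnit (n m : ℤ) {c : A} {S₀ : H →L[ℂ] H}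
    (hS₀ : IsCommutator D (π₀ c) S₀) :
    ∃ S, IsCommutator (bundleDirac D) (bundleCrossedRep π₀ α (matUnit α n m c)) S := by
  let e : ℤ × ℕ+ × Fin 4 ≃ ℤ × ℕ+ × Fin 4 :=
    (Equiv.addRight (m - n)).prodCongr (Equiv.refl _)
  let V : ℤ × ℕ+ × Fin 4 → H →L[ℂ] H := fun k => if k.1 = n then (bundleDiracTypeData.ε k : ℂ) • S₀ else 0
  let W : ℤ × ℕ+ × Fin 4 → H →L[ℂ] H := fun k =>
    if k.1 = n then ((bundleDiracTypeData.ε k : ℂ) * (Complex.I * (n - m))) • π₀ c else 0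
  have hV : ∃ C, ∀ k, ‖V k‖ ≤ C := by
    refine ⟨‖S₀‖, fun k => ?_⟩
    dsimp only [V]
    split_ifs
    · rw [norm_smul, norm_bundleDiracTypeData_ε, one_mul]
    · simp
  have hW : ∃ C, ∀ k, ‖W k‖ ≤ C := by
    refine ⟨‖Complex.I * (n - m)‖ * ‖π₀ c‖, fun k => ?_⟩
    dsimp only [W]
    split_ifs
    · rw [norm_smul, norm_mul, norm_bundleDiracTypeData_ε, one_mul]
    · rw [norm_zero]
      positivity
  let T := bundleCrossedRep π₀ α (matUnit α n m c)
  let S : BundleSpace H →L[ℂ] BundleSpace H := bundleDiff H * T - T * bundleDiff H +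
    lpDiag V hV ∘L (lpReindex e).toContinuousLinearMap +
    lpDiag W hW ∘L (lpReindex (bundleDiracTypeData.τ.trans e)).toContinuousLinearMap
  have hS : ∀ f k, S f k = bundleDiff H (T f) k - T (bundleDiff H f) k + V k (f (e k)) +
    W k (f (e (bundleDiracTypeData.τ k))) := fun f k => rfl
  refine ⟨S, ?_⟩
  rw [isCommutator_iff_graph] at hS₀ ⊢
  intro f g hfg
  rw [mem_bundleDirac_graph] at hfg ⊢
  have hT : ∀ f k, T f k = if k.1 = n then π₀ c (f (m, k.2)) else 0 :=
    bundleCrossedRep_matUnit π₀ α n m c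
  rintro ⟨n', j⟩
  change ∃ y, (T f (n', j), y) ∈ D.graph ∧ S f (n', j) + T g (n', j) = _ • y +
    _ • T f _ + bundleDiff H (T f) (n', j)
  have hτ : ∀ n' : ℤ, bundleDiracTypeData.τ (n', j) = (n', (bundleDiracTypeData.τ (n, j)).2) := fun _ => rfl
  by_cases h : n' = n
  · subst h
    obtain ⟨y, hy, hg⟩ := hfg (m, j)
    refine ⟨S₀ (f (m, j)) + π₀ c y, ?_, ?_⟩
    · rw [hT, if_pos rfl]
      exact hS₀ _ _ hy
    · have he : ∀ j, e (n', j) = (m, j) := fun j => Prod.ext (add_sub_cancel n' m) rfl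
      rw [hS, hT, hT, hT, if_pos rfl, if_pos rfl, if_pos (by rw [hτ]), hg, hτ, he, he]
      simp only [V, W, if_true]
      change _ + _ + π₀ c (_ + _ + bundleDiff H f (m, j)) = _
      rw [← bundleDiracTypeData_c_sub]
      have hε : bundleDiracTypeData.ε (m, j) = bundleDiracTypeData.ε (n', j) := rfl
      simp only [map_add, map_smul, smul_add, smul_apply, sub_smul]
      change _ + _ + (_ + _ • π₀ c (f (bundleDiracTypeData.τ (m, j))) + _) = _
      rw [hτ m, hε, sub_apply, smul_apply, smul_apply]
      dsimp only
      module
  · refine ⟨0, ?_, ?_⟩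
    · rw [hT, if_neg h]
      exact D.graph.zero_mem
    · rw [hS, hT, hT, hT, if_neg h, if_neg h, if_neg (by rw [hτ]; exact h)]
      simp [V, W, h]

end BundleTriple

/-! ### The spectral triples $Y$ and $Z$ are spectral metric spaces. -/

/-- With a bounded projection $p$ onto $F$, write $x=(x-px)+px$: the first summand factors through
the quotient, and the second stays in a ball of a finite-dimensional space. -/
theorem totallyBounded_of_mkQ_image {E : Type*} [NormedAddCommGroup E] [NormedSpace ℂ E]
    [CompleteSpace E] {F : Submodule ℂ E} [FiniteDimensional ℂ F] {B : Set E} {C : ℝ}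
    (hC : ∀ x ∈ B, ‖x‖ ≤ C) (hB : TotallyBounded (F.mkQ '' B)) : TotallyBounded B := by
  obtain ⟨p, hp⟩ := Submodule.ClosedComplemented.of_finiteDimensional (𝕜 := ℂ) F
  let q : E →L[ℂ] E := ContinuousLinearMap.id ℂ E - F.subtypeL ∘L p
  have hq : F ≤ LinearMap.ker q.toLinearMap := fun x hx => by
    simp [q, hp ⟨x, hx⟩]
  let q' : E ⧸ F →L[ℂ] E := ⟨F.liftQ q.toLinearMap hq,
    F.isQuotientMap_mkQ.continuous_iff.2 (by exact q.continuous)⟩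
  have h1 : IsCompact (closure (q' '' (F.mkQ '' B))) :=
    (hB.image q'.uniformContinuous).closure.isCompact_of_isClosed isClosed_closure
  have h2 : IsCompact (F.subtypeL '' Metric.closedBall 0 (‖p‖ * C)) :=
    (ProperSpace.isCompact_closedBall 0 _).image F.subtypeL.continuous
  refine (h1.add h2).totallyBounded.subset fun x hx => ?_
  refine ⟨q x, subset_closure ⟨_, ⟨x, hx, rfl⟩, rfl⟩, p x, ⟨p x, ?_, rfl⟩, by simp [q]⟩
  rw [mem_closedBall_zero_iff]
  exact (p.le_opNorm x).trans (mul_le_mul_of_nonneg_left (hC x hx) (norm_nonneg p))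

theorem eq_of_isUnit_left_right {A : Type*} [Mul A] {e e' : A} (he : ∀ x, e * x = x ∧ x * e = x)
    (he' : ∀ x, e' * x = x ∧ x * e' = x) : e = e' := by
  rw [← (he' e).1, (he e').2]

namespace SpectralTriple

variable {A H : Type u} [NonUnitalCStarAlgebra A]
  [NormedAddCommGroup H] [InnerProductSpace ℂ H] [CompleteSpace H] {X : SpectralTriple A H}

theorem finiteDimensional_of_isMultipleOfUnit {K : Submodule ℂ A}
    (h : ∀ a ∈ K, IsMultipleOfUnit a) : FiniteDimensional ℂ K := by
  by_cases hu : ∃ e : A, ∀ x : A, e * x = x ∧ x * e = x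
  · obtain ⟨e, he⟩ := hu
    refine Submodule.finiteDimensional_of_le (S₂ := Submodule.span ℂ {e}) fun a ha => ?_
    obtain rfl | ⟨e', c, he', rfl⟩ := h a ha
    · exact zero_mem _
    · rw [eq_of_isUnit_left_right he' he]
      exact Submodule.smul_mem _ _ (Submodule.mem_span_singleton_self e)
  · have hK : K = ⊥ := by
      rw [Submodule.eq_bot_iff]
      intro a ha
      obtain h0 | ⟨e, c, he, -⟩ := h a ha
      · exact h0
      · exact absurd ⟨e, he⟩ hu
    rw [hK]
    infer_instance

theorem C1b_subset_C1 (X : SpectralTriple A H) (G : Subgroup (A ≃⋆ₐ[ℂ] A)) : X.C1b G ⊆ X.C1 := by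
  rintro a ⟨S, hS, -⟩
  exact ⟨S 1, hS 1⟩

theorem isEquicontinuous_one (X : SpectralTriple A H) : X.IsEquicontinuous 1 := by
  refine Set.Subset.antisymm ?_ (X.C1b_subset_C1 _)
  rintro a ⟨S, hS⟩
  let _ := pointNormTopology (Subgroup.zpowers (1 : A ≃⋆ₐ[ℂ] A))
  refine ⟨fun _ => S, ?_, continuous_const, ‖S‖, fun _ => le_rfl⟩
  rintro ⟨g, hg⟩
  obtain ⟨k, rfl⟩ := Subgroup.mem_zpowers_iff.1 hg
  simpa using hS

theorem nontrivial_of_not_isEquicontinuous {α : A ≃⋆ₐ[ℂ] A} (hne : ¬ X.IsEquicontinuous α) :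
    Nontrivial A := by
  by_contra h
  rw [not_nontrivial_iff_subsingleton] at h
  refine hne ?_
  rw [show α = 1 from StarAlgEquiv.ext fun a => Subsingleton.elim _ _]
  exact X.isEquicontinuous_one

/-- The kernel lies in the metric commutant. A nonzero element of it would be a multiple of the
unit, so the representation would be zero and every element a multiple of the unit; then $\alpha=1$,
which is equicontinuous. -/
theorem IsSpectralMetricSpace.rep_injective (hX : X.IsSpectralMetricSpace) {α : A ≃⋆ₐ[ℂ] A}
    (hne : ¬ X.IsEquicontinuous α) : Function.Injective X.rep := by
  rw [injective_iff_map_eq_zero]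
  intro a ha
  have hmem : ∀ b, X.rep b = 0 → b ∈ X.metricCommutant := fun b hb => by
    change IsCommutator X.D (X.rep b) 0
    rw [hb]
    exact isCommutator_zero X.D
  obtain h | ⟨e, c, he, rfl⟩ := hX.commutant_trivial a (hmem a ha)
  · exact h
  by_cases hc : c = 0
  · rw [hc, zero_smul]
  rw [map_smul, smul_eq_zero, or_iff_right hc] at ha
  refine absurd ?_ hne
  have hα : α = 1 := by
    refine StarAlgEquiv.ext fun b => ?_
    have hb : X.rep b = 0 := by rw [← (he b).1, map_mul, ha, zero_mul]
    obtain rfl | ⟨e', c', he', rfl⟩ := hX.commutant_trivial b (hmem b hb)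
    · simp
    · have h1 : ∀ x, α e' * x = x ∧ x * α e' = x := fun x => by
        obtain ⟨y, hy⟩ := α.surjective x
        replace hy : α y = x := hy
        rw [← hy, ← map_mul, ← map_mul, (he' y).1, (he' y).2]
        exact ⟨rfl, rfl⟩
      rw [map_smul, eq_of_isUnit_left_right h1 he']
      rfl
  rw [hα]
  exact X.isEquicontinuous_one

/-- A trivial metric commutant has dimension at most one, so with the bound $\|a\|\le1$
precompactness modulo the commutant becomes precompactness in $\mathcal A$. -/
theorem IsSpectralMetricSpace.exists_totallyBounded (hX : X.IsSpectralMetricSpace) :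
    ∃ h : A, IsStrictlyPositiveElement h ∧
      TotallyBounded ((fun a : A => h * a * h) '' {a | a ∈ X.lipschitzBall ∧ ‖a‖ ≤ 1}) := by
  obtain ⟨h, hh, hB⟩ := hX.precompact
  have := finiteDimensional_of_isMultipleOfUnit hX.commutant_trivial
  refine ⟨h, hh, totallyBounded_of_mkQ_image (F := X.metricCommutant) (C := ‖h‖ * 1 * ‖h‖) ?_
    (hB.subset (Set.image_mono (Set.image_mono fun a ha => ha.1)))⟩
  rintro _ ⟨a, ⟨-, ha⟩, rfl⟩
  exact (norm_mul_le _ _).trans (mul_le_mul_of_nonneg_right ((norm_mul_le _ _).trans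
    (mul_le_mul_of_nonneg_left ha (norm_nonneg h))) (norm_nonneg h))

theorem bundleDirac_isSelfAdjoint (X : SpectralTriple A H) : IsSelfAdjoint (bundleDirac X.D) :=
  bundleDiracTypeData.isSelfAdjoint_op _ X.isSelfAdjoint X.hasCompactResolvent bundleDiff_symmetric

theorem bundleDirac_hasCompactResolvent (X : SpectralTriple A H) :
    HasCompactResolvent (bundleDirac X.D) :=
  bundleDiracTypeData.hasCompactResolvent_op _ X.isSelfAdjoint X.hasCompactResolvent
    bundleDiff_symmetric

theorem matUnit_mem_closure (X : SpectralTriple A H) (α : A ≃⋆ₐ[ℂ] A) (n m : ℤ) (c : A) :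
    c ∈ closure {c | matUnit α n m c ∈
      boundedCommutator (bundleDirac X.D) (bundleCrossedRep X.rep α)} :=
  closure_mono (fun _ hc => exists_isCommutator_matUnit n m hc.choose_spec) (X.dense_C1 c)

/-- The spectral triple on the crossed product of the metric bundle for the discrete metric. -/
def crossedBundle (X : SpectralTriple A H) (α : A ≃⋆ₐ[ℂ] A) :
    SpectralTriple (CrossedProduct (bundleAut α)) (BundleSpace H) where
  rep := bundleCrossedRep X.rep α
  D := bundleDirac X.D
  isSelfAdjoint := X.bundleDirac_isSelfAdjoint
  hasCompactResolvent := X.bundleDirac_hasCompactResolvent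
  dense_C1 x := by
    refine CrossedProduct.mem_of_isClosed_of_matUnit (S := (boundedCommutator (bundleDirac X.D)
      (bundleCrossedRep X.rep α)).topologicalClosure) (Submodule.isClosed_topologicalClosure _)
      (fun n m c => ?_) x
    exact map_mem_closure (matUnit α n m).continuous (X.matUnit_mem_closure α n m c) fun c hc => hc

/-- The inclusion of `C₀(ℤ, A)` into its crossed product. -/
def _root_.bundleInclusion (α : A ≃⋆ₐ[ℂ] A) : C₀(ℤ, A) →⋆ₙₐ[ℂ] CrossedProduct (bundleAut α) where
  toFun b := CrossedProduct.monomial (bundleAut α) b 0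
  map_smul' c b := CrossedProduct.monomial_smul c b 0
  map_zero' := (CrossedProduct.monomialCLM (bundleAut α) 0).map_zero
  map_add' b c := CrossedProduct.monomial_add b c 0
  map_mul' b c := by rw [CrossedProduct.monomial_mul_monomial]; simp
  map_star' b := by rw [CrossedProduct.star_monomial]; simp

theorem _root_.bundleInclusion_apply (α : A ≃⋆ₐ[ℂ] A) (b : C₀(ℤ, A)) :
    bundleInclusion α b = CrossedProduct.monomial (bundleAut α) b 0 := rfl

theorem _root_.bundleInclusion_single (α : A ≃⋆ₐ[ℂ] A) (n : ℤ) (a : A) :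
    bundleInclusion α (C0_single n a) = matUnit α n n ((α ^ (-n)) a) := by
  rw [matUnit_apply, StarAlgEquiv.zpow_apply_zpow_neg_apply, sub_self, bundleInclusion_apply]

/-- The metric bundle for the discrete metric. -/
def metricBundle (X : SpectralTriple A H) (α : A ≃⋆ₐ[ℂ] A) :
    SpectralTriple C₀(ℤ, A) (BundleSpace H) where
  rep := (bundleCrossedRep X.rep α).comp (bundleInclusion α)
  D := bundleDirac X.D
  isSelfAdjoint := X.bundleDirac_isSelfAdjoint
  hasCompactResolvent := X.bundleDirac_hasCompactResolvent
  dense_C1 b := by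
    refine C0_mem_of_isClosed (S := (boundedCommutator (bundleDirac X.D)
      ((bundleCrossedRep X.rep α).comp (bundleInclusion α))).topologicalClosure)
      (Submodule.isClosed_topologicalClosure _) (fun n a => ?_) b
    have h : Continuous fun c => C0_single n ((α ^ n) c) :=
      (C0_single n).continuous.comp (StarAlgEquiv.isometry (α ^ n)).continuous
    rw [← StarAlgEquiv.zpow_apply_zpow_neg_apply α n a]
    refine map_mem_closure (f := fun c => C0_single n ((α ^ n) c)) h (X.matUnit_mem_closure α n n ((α ^ (-n)) a)) fun c hc => ?_
    obtain ⟨S, hS⟩ := hc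
    refine ⟨S, ?_⟩
    rwa [NonUnitalStarAlgHom.comp_apply, bundleInclusion_single,
      StarAlgEquiv.zpow_neg_apply_zpow_apply]

theorem metricBundle_rep_apply (X : SpectralTriple A H) (α : A ≃⋆ₐ[ℂ] A) (b : C₀(ℤ, A)) :
    (X.metricBundle α).rep b = (X.crossedBundle α).rep (bundleInclusion α b) := rfl

theorem isMetricBundle_metricBundle (X : SpectralTriple A H) (α : A ≃⋆ₐ[ℂ] A) :
    (X.metricBundle α).IsMetricBundle X α discreteBundleData where
  rep_apply b f n r i := by
    have h := bundleCrossedRep_monomial X.rep α b 0 f (n, r, i)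
    rwa [sub_zero] at h
  mem_graph_iff f g := mem_bundleDirac_graph_iff

end SpectralTriple

theorem lp_mem_of_isClosed {I : Type*} [DecidableEq I] {H : Type v} [NormedAddCommGroup H]
    [InnerProductSpace ℂ H] {S : Submodule ℂ (lp (fun _ : I => H) 2)}
    (hS : IsClosed (S : Set (lp (fun _ : I => H) 2))) (h : ∀ k v, lp.single 2 k v ∈ S)
    (f : lp (fun _ : I => H) 2) : f ∈ S :=
  hS.mem_of_tendsto (lp.hasSum_single (by norm_num) f)
    (Filter.Eventually.of_forall fun _ => S.sum_mem fun k _ => h k (f k))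

namespace SpectralTriple

variable {A H : Type u} [NonUnitalCStarAlgebra A]
  [NormedAddCommGroup H] [InnerProductSpace ℂ H] [CompleteSpace H] {X : SpectralTriple A H}

theorem bundleCrossedRep_matUnit_single (π₀ : A →⋆ₙₐ[ℂ] (H →L[ℂ] H)) (α : A ≃⋆ₐ[ℂ] A) (n m : ℤ)
    (j : ℕ+ × Fin 4) (a : A) (v : H) :
    bundleCrossedRep π₀ α (matUnit α n m a) (lp.single 2 (m, j) v) = lp.single 2 (n, j) (π₀ a v) := by
  ext k
  rw [bundleCrossedRep_matUnit, lp_single_apply_eq_ite, lp_single_apply_eq_ite]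
  obtain ⟨n', j'⟩ := k
  by_cases h1 : n' = n <;> by_cases h2 : j' = j <;> simp [h1, h2]

theorem IsSpectralMetricSpace.metricBundle_nondegenerate (hX : X.IsSpectralMetricSpace)
    (α : A ≃⋆ₐ[ℂ] A) :
    Dense (Submodule.span ℂ {y : BundleSpace H | ∃ (b : C₀(ℤ, A)) (x : BundleSpace H),
      y = (X.metricBundle α).rep b x} : Set (BundleSpace H)) := by
  set S := Submodule.span ℂ {y : BundleSpace H | ∃ (b : C₀(ℤ, A)) (x : BundleSpace H),
      y = (X.metricBundle α).rep b x}
  intro f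
  refine lp_mem_of_isClosed S.isClosed_topologicalClosure ?_ f
  rintro ⟨n, j⟩ v
  refine map_mem_closure (lp.singleContinuousLinearMap ℂ (fun _ : ℤ × ℕ+ × Fin 4 => H) 2
    (n, j)).continuous (hX.nondegenerate v) fun w hw => ?_
  have h : Submodule.span ℂ {y : H | ∃ (a : A) (x : H), y = X.rep a x} ≤
      S.comap (lp.singleContinuousLinearMap ℂ (fun _ : ℤ × ℕ+ × Fin 4 => H) 2 (n, j)).toLinearMap := by
    rw [Submodule.span_le]
    rintro _ ⟨a, x, rfl⟩
    refine Submodule.subset_span ⟨C0_single n ((α ^ n) a), lp.single 2 (n, j) x, ?_⟩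
    rw [metricBundle_rep_apply, bundleInclusion_single, StarAlgEquiv.zpow_neg_apply_zpow_apply]
    exact (bundleCrossedRep_matUnit_single X.rep α n n j a x).symm
  exact h hw

theorem totallyBounded_mkQ_image {E : Type*} [NormedAddCommGroup E] [NormedSpace ℂ E]
    (F : Submodule ℂ E) {B : Set E} (hB : TotallyBounded B) : TotallyBounded (F.mkQ '' B) :=
  hB.image F.mkQL.uniformContinuous

theorem matCoeff_mem_lipschitzBall (hπ : Function.Injective X.rep) {α : A ≃⋆ₐ[ℂ] A}
    {x : CrossedProduct (bundleAut α)} (hx : x ∈ (X.crossedBundle α).lipschitzBall) (n m : ℤ) :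
    matCoeff hπ n m x ∈ X.lipschitzBall ∧ ‖matCoeff hπ n m x‖ ≤ 1 := by
  obtain ⟨S, hS, hS1⟩ := hx
  exact ⟨⟨_, isCommutator_matCoeff hπ hS n m, (norm_lpCoeff_le _ _ S).trans hS1⟩,
    (norm_matCoeff_le_of_isCommutator hπ X.isSelfAdjoint.dense_domain hS n m).trans hS1⟩

theorem IsSpectralMetricSpace.eq_zero_of_mem_metricCommutant (hX : X.IsSpectralMetricSpace)
    (hπ : Function.Injective X.rep) {α : A ≃⋆ₐ[ℂ] A} {x : CrossedProduct (bundleAut α)}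
    (hx : x ∈ (X.crossedBundle α).metricCommutant) : x = 0 := by
  obtain ⟨h, hh, -⟩ := hX.precompact
  refine CrossedProduct.eq_zero_of_matCoeff hπ hh.2 fun n m => ?_
  have h1 := norm_matCoeff_le_of_isCommutator hπ X.isSelfAdjoint.dense_domain (α := α) (S := 0)
    hx n m
  rwa [norm_zero, norm_le_zero_iff] at h1

theorem IsSpectralMetricSpace.crossedBundle (hX : X.IsSpectralMetricSpace)
    (hπ : Function.Injective X.rep) (α : A ≃⋆ₐ[ℂ] A) :
    (X.crossedBundle α).IsSpectralMetricSpace where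
  nondegenerate := by
    refine (hX.metricBundle_nondegenerate α).mono (Submodule.span_mono ?_)
    rintro _ ⟨b, x, rfl⟩
    exact ⟨bundleInclusion α b, x, rfl⟩
  commutant_trivial x hx := Or.inl (hX.eq_zero_of_mem_metricCommutant hπ hx)
  precompact := by
    obtain ⟨h, hh, hB⟩ := hX.exists_totallyBounded
    refine ⟨crossedPositive α h, ⟨exists_crossedPositive_eq α hh.1,
      dense_range_crossedPositive hπ hh.2⟩, totallyBounded_mkQ_image _ ?_⟩
    exact totallyBounded_crossedPositive hπ hB fun x hx n m =>
      ⟨_, matCoeff_mem_lipschitzBall hπ hx n m, rfl⟩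

theorem matCoeff_bundleInclusion {π₀ : A →⋆ₙₐ[ℂ] (H →L[ℂ] H)} (hπ : Function.Injective π₀)
    (α : A ≃⋆ₐ[ℂ] A) (b : C₀(ℤ, A)) (n : ℤ) :
    matCoeff hπ n n (bundleInclusion α b) = (α ^ (-n)) (b n) := by
  apply hπ
  ext v
  rw [matCoeff_spec, lpCoeff_apply, bundleInclusion_apply, bundleCrossedRep_monomial,
    lp_single_apply_eq_ite, sub_zero, if_pos rfl]

theorem bundleInclusion_injective {π₀ : A →⋆ₙₐ[ℂ] (H →L[ℂ] H)} (hπ : Function.Injective π₀)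
    (α : A ≃⋆ₐ[ℂ] A) : Function.Injective (bundleInclusion α) := by
  rw [injective_iff_map_eq_zero]
  intro b hb
  ext n
  have h := matCoeff_bundleInclusion hπ α b n
  rw [hb, map_zero] at h
  exact (map_eq_zero_iff (α ^ (-n)) (α ^ (-n)).injective).1 h.symm

theorem IsSpectralMetricSpace.metricBundle (hX : X.IsSpectralMetricSpace)
    (hπ : Function.Injective X.rep) (α : A ≃⋆ₐ[ℂ] A) :
    (X.metricBundle α).IsSpectralMetricSpace where
  nondegenerate := hX.metricBundle_nondegenerate α
  commutant_trivial b hb := Or.inl (bundleInclusion_injective hπ α (by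
    rw [map_zero]
    exact hX.eq_zero_of_mem_metricCommutant hπ hb))
  precompact := by
    obtain ⟨h, hh, hB⟩ := hX.exists_totallyBounded
    refine ⟨bundlePositive α h, ⟨exists_bundlePositive_eq α hh.1,
      dense_range_bundlePositive α hh.2⟩, totallyBounded_mkQ_image _ ?_⟩
    -- Total boundedness can be tested after the isometric inclusion into the crossed product, which
    -- preserves Lipschitz balls and sends `bundlePositive` to `crossedPositive`.
    have hι := NonUnitalStarAlgHom.isometry _ (bundleInclusion_injective hπ α)
    rw [← totallyBounded_image_iff hι.isUniformInducing]
    refine (totallyBounded_crossedPositive hπ hB (T := (X.crossedBundle α).lipschitzBall)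
      fun x hx n m => ⟨_, matCoeff_mem_lipschitzBall hπ hx n m, rfl⟩).subset ?_
    rintro _ ⟨_, ⟨b, hb, rfl⟩, rfl⟩
    refine ⟨bundleInclusion α b, hb, ?_⟩
    rw [map_mul, map_mul]
    rfl

end SpectralTriple

/-! ### Translations of the bundle and equicontinuity of $\alpha_*$. -/

section Translation

variable {H : Type v} [NormedAddCommGroup H] [InnerProductSpace ℂ H]

variable (H) in
/-- The translation `f ↦ (f (n + k, r, i))` of the Hilbert space of the metric bundle. -/
def bundleTranslation (k : ℤ) : BundleSpace H →L[ℂ] BundleSpace H :=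
  (lpReindex ((Equiv.addRight k).prodCongr (Equiv.refl (ℕ+ × Fin 4)))).toContinuousLinearMap

theorem bundleTranslation_apply (k : ℤ) (f : BundleSpace H) (j : ℤ × ℕ+ × Fin 4) :
    bundleTranslation H k f j = f (j.1 + k, j.2) := rfl

theorem norm_bundleTranslation_le (k : ℤ) : ‖bundleTranslation H k‖ ≤ 1 :=
  LinearIsometry.norm_toContinuousLinearMap_le _

variable (H) in
/-- The commutator of the Dirac operator of the metric bundle with the translation by `1`. -/
def bundleGrading : BundleSpace H →L[ℂ] BundleSpace H :=
  lpDiag (fun j => ((bundleDiracTypeData.ε j : ℂ) * Complex.I) • ContinuousLinearMap.id ℂ H)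
    ⟨1, fun j => by
      rw [norm_smul, norm_mul, norm_bundleDiracTypeData_ε, Complex.norm_I, one_mul, one_mul]
      exact ContinuousLinearMap.norm_id_le⟩ ∘L
    (lpReindex bundleDiracTypeData.τ).toContinuousLinearMap

theorem bundleGrading_apply (f : BundleSpace H) (j : ℤ × ℕ+ × Fin 4) : bundleGrading H f j =
    ((bundleDiracTypeData.ε j : ℂ) * Complex.I) • f (bundleDiracTypeData.τ j) := rfl

/-- Only the coefficient $n\gamma_3$ depends on $n$, and affinely, so translation by $k$ commutes
with $D_Y$ up to $k$ times the bounded operator `bundleGrading`. -/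
theorem bundleTranslation_mem_graph {D : H →ₗ.[ℂ] H} {f g : BundleSpace H}
    (h : (f, g) ∈ (bundleDirac D).graph) (k : ℤ) :
    (bundleTranslation H k f,
      bundleTranslation H k g - (k : ℂ) • bundleGrading H (bundleTranslation H k f)) ∈
      (bundleDirac D).graph := by
  rw [mem_bundleDirac_graph] at h ⊢
  rintro ⟨n, j⟩
  obtain ⟨y, hy, hg⟩ := h (n + k, j)
  refine ⟨y, hy, ?_⟩
  simp only [lp.coeFn_sub, lp.coeFn_smul, Pi.sub_apply, Pi.smul_apply, bundleGrading_apply,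
    bundleTranslation_apply]
  rw [hg]
  have hc := bundleDiracTypeData_c_sub (n + k) n j
  push_cast at hc
  rw [add_sub_cancel_left, sub_eq_iff_eq_add] at hc
  have hε : bundleDiracTypeData.ε (n + k, j) = bundleDiracTypeData.ε (n, j) := rfl
  have hτ : bundleDiracTypeData.τ (n + k, j) =
    ((bundleDiracTypeData.τ (n, j)).1 + k, (bundleDiracTypeData.τ (n, j)).2) := rfl
  have hμ : fiberSwap (n + k, j) = ((fiberSwap (n, j)).1 + k, (fiberSwap (n, j)).2) := rfl
  have hν : fiberShiftSwap (n + k, j) =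
      ((fiberShiftSwap (n, j)).1 + k, (fiberShiftSwap (n, j)).2) := by
    simp only [fiberShiftSwap_apply, Prod.mk.injEq, and_true]
    ring
  rw [hc, hε, hτ, hμ, hν]
  module

end Translation

namespace SpectralTriple

variable {A H : Type u} [NonUnitalCStarAlgebra A]
  [NormedAddCommGroup H] [InnerProductSpace ℂ H] [CompleteSpace H] {X : SpectralTriple A H}

theorem metricBundle_rep_apply_apply (α : A ≃⋆ₐ[ℂ] A) (b : C₀(ℤ, A)) (f : BundleSpace H)
    (j : ℤ × ℕ+ × Fin 4) :
    (X.metricBundle α).rep b f j = X.rep ((α ^ (-j.1)) (b j.1)) (f j) :=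
  (X.isMetricBundle_metricBundle α).rep_apply b f j.1 j.2.1 j.2.2

theorem metricBundle_rep_bundleAut_zpow (α : A ≃⋆ₐ[ℂ] A) (k : ℤ) (b : C₀(ℤ, A))
    (f : BundleSpace H) : (X.metricBundle α).rep ((bundleAut α ^ k) b) f =
      bundleTranslation H (-k) ((X.metricBundle α).rep b (bundleTranslation H k f)) := by
  ext j
  rw [bundleTranslation_apply, metricBundle_rep_apply_apply, metricBundle_rep_apply_apply,
    bundleTranslation_apply, bundleAut_zpow_apply, ← StarAlgEquiv.zpow_add_apply]
  simp only [neg_add, neg_neg, neg_add_cancel_right, sub_eq_add_neg]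

theorem bundleGrading_bundleTranslation_rep (α : A ≃⋆ₐ[ℂ] A) (k : ℤ) (b : C₀(ℤ, A))
    (f : BundleSpace H) :
    bundleGrading H (bundleTranslation H (-k) ((X.metricBundle α).rep b f)) =
      bundleTranslation H (-k) ((X.metricBundle α).rep b (bundleGrading H f)) := by
  ext j
  rw [bundleTranslation_apply, metricBundle_rep_apply_apply, bundleGrading_apply,
    bundleGrading_apply, bundleTranslation_apply, metricBundle_rep_apply_apply, map_smul]
  rfl

/-- The corrections from the translations by $k$ and $-k$ cancel, because `bundleGrading` commutes
with the representation and the translations. The norm is therefore bounded uniformly in $k$. -/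
theorem isCommutator_metricBundle_bundleAut_zpow {α : A ≃⋆ₐ[ℂ] A} {b : C₀(ℤ, A)}
    {S : BundleSpace H →L[ℂ] BundleSpace H}
    (hS : IsCommutator (bundleDirac X.D) ((X.metricBundle α).rep b) S) (k : ℤ) :
    IsCommutator (bundleDirac X.D) ((X.metricBundle α).rep ((bundleAut α ^ k) b))
      (bundleTranslation H (-k) ∘L S ∘L bundleTranslation H k) := by
  rw [isCommutator_iff_graph] at hS ⊢
  intro f g hfg
  have h := bundleTranslation_mem_graph (hS _ _ (bundleTranslation_mem_graph hfg k)) (-k)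
  rw [metricBundle_rep_bundleAut_zpow, metricBundle_rep_bundleAut_zpow]
  convert h using 2
  rw [bundleGrading_bundleTranslation_rep]
  simp only [map_add, map_sub, map_smul, ContinuousLinearMap.comp_apply, Int.cast_neg, neg_smul]
  abel

/-- Different powers move $\delta_0\otimes a$ to different points of $\mathbb Z$, hence to distance
at least $\|a\|$. Norm continuity of $g\mapsto[D_Y,g(b)]$ is then automatic. -/
theorem discreteTopology_zpowers_bundleAut [Nontrivial A] (α : A ≃⋆ₐ[ℂ] A) :
    pointNormTopology (Subgroup.zpowers (bundleAut α)) = ⊥ := by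
  obtain ⟨a, ha⟩ := exists_ne (0 : A)
  let _ := pointNormTopology (Subgroup.zpowers (bundleAut α))
  have hcont : Continuous fun (g : Subgroup.zpowers (bundleAut α)) (b : C₀(ℤ, A)) =>
      (g : C₀(ℤ, A) ≃⋆ₐ[ℂ] C₀(ℤ, A)) b := continuous_induced_dom
  refine (discreteTopology_iff_isOpen_singleton.2 fun g => ?_).eq_bot
  have hopen : IsOpen {g' : Subgroup.zpowers (bundleAut α) |
      ‖(g' : C₀(ℤ, A) ≃⋆ₐ[ℂ] C₀(ℤ, A)) (C0_single 0 a) -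
        (g : C₀(ℤ, A) ≃⋆ₐ[ℂ] C₀(ℤ, A)) (C0_single 0 a)‖ < ‖a‖} :=
    isOpen_lt (((continuous_apply (C0_single 0 a)).comp hcont).sub continuous_const).norm
      continuous_const
  convert hopen
  ext g'
  rw [Set.mem_singleton_iff, Set.mem_ofPred_eq]
  refine ⟨fun h => by rw [h, sub_self, norm_zero]; exact norm_pos_iff.2 ha, fun h => ?_⟩
  obtain ⟨k, hk⟩ := Subgroup.mem_zpowers_iff.1 g.2
  obtain ⟨k', hk'⟩ := Subgroup.mem_zpowers_iff.1 g'.2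
  refine Subtype.ext ?_
  rw [← hk, ← hk'] at h ⊢
  by_cases hkk : k = k'
  · rw [hkk]
  · refine absurd h (not_lt.2 ?_)
    have h1 := C0_norm_apply_le ((bundleAut α ^ k') (C0_single 0 a) -
      (bundleAut α ^ k) (C0_single 0 a)) k
    rw [ZeroAtInftyContinuousMap.sub_apply, bundleAut_zpow_single, bundleAut_zpow_single,
      C0_single_apply, C0_single_apply, zero_add, zero_add, if_neg hkk, if_pos rfl, zero_sub,
      norm_neg, StarAlgEquiv.norm_apply] at h1
    rwa [bundleAut_zpow_single, bundleAut_zpow_single, zero_add, zero_add]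

theorem isEquicontinuous_metricBundle [Nontrivial A] (X : SpectralTriple A H) (α : A ≃⋆ₐ[ℂ] A) :
    (X.metricBundle α).IsEquicontinuous (bundleAut α) := by
  refine Set.Subset.antisymm ?_ (C1b_subset_C1 _ _)
  rintro b ⟨S, hS⟩
  have hk : ∀ g : Subgroup.zpowers (bundleAut α), ∃ k : ℤ, bundleAut α ^ k = g :=
    fun g => Subgroup.mem_zpowers_iff.1 g.2
  choose k hk using hk
  refine ⟨fun g => bundleTranslation H (-k g) ∘L S ∘L bundleTranslation H (k g), fun g => ?_, ?_,
    ‖S‖, fun g => ?_⟩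
  · rw [← hk g]
    exact isCommutator_metricBundle_bundleAut_zpow hS (k g)
  · rw [discreteTopology_zpowers_bundleAut]
    exact continuous_bot
  · refine (ContinuousLinearMap.opNorm_comp_le _ _).trans ((mul_le_mul (norm_bundleTranslation_le _)
      ((ContinuousLinearMap.opNorm_comp_le _ _).trans (mul_le_mul_of_nonneg_left
      (norm_bundleTranslation_le _) (norm_nonneg S))) (norm_nonneg _) zero_le_one).trans_eq ?_)
    rw [one_mul, mul_one]

end SpectralTriple

/-! ### The dual circle action and Fourier coefficients in the crossed product. -/

section UnitaryScalar

variable {B : Type*} [CStarAlgebra B]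

variable (B) in
/-- The scalar unitaries. -/
def unitaryScalar : Circle →* unitary B where
  toFun z := ⟨(z : ℂ) • (1 : B), by
    rw [Unitary.mem_iff, star_smul, star_one, smul_mul_smul_comm, smul_mul_smul_comm, mul_one,
      mul_comm (z : ℂ), RCLike.star_def, ← Complex.normSq_eq_conj_mul_self, Circle.normSq_coe]
    simp⟩
  map_one' := Subtype.ext (by simp)
  map_mul' z w := Subtype.ext (by
    simp only [Circle.coe_mul, Submonoid.coe_mul, smul_mul_smul_comm, mul_one])

theorem coe_unitaryScalar (z : Circle) : (unitaryScalar B z : B) = (z : ℂ) • 1 := rfl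

theorem unitaryScalar_commute (z : Circle) (u : unitary B) : Commute (unitaryScalar B z) u :=
  Subtype.ext (by simp [coe_unitaryScalar])

end UnitaryScalar

section DualAction

variable {A : Type u} [NonUnitalCStarAlgebra A] {α : A ≃⋆ₐ[ℂ] A}

/-- The covariant representation `(π, z U)`, for a complex number `z` of modulus one. -/
def CovariantRep.twist (ρ : CovariantRep α) (z : Circle) : CovariantRep α where
  space := ρ.space
  π := ρ.π
  U := unitaryScalar _ z * ρ.U
  covariant a := by
    have h : (((unitaryScalar (ρ.space →L[ℂ] ρ.space) z)⁻¹ : unitary (ρ.space →L[ℂ] ρ.space)) :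
        ρ.space →L[ℂ] ρ.space) = ((z⁻¹ : Circle) : ℂ) • 1 := by
      rw [← map_inv, coe_unitaryScalar]
    have hz : ((z⁻¹ : Circle) : ℂ) * z = 1 := by
      rw [← Circle.coe_mul, inv_mul_cancel, Circle.coe_one]
    rw [mul_inv_rev, Submonoid.coe_mul, Submonoid.coe_mul, h, coe_unitaryScalar, smul_one_mul,
      smul_mul_assoc, ← mul_assoc, smul_mul_assoc, ρ.covariant, mul_smul_comm, mul_one, smul_smul,
      hz, one_smul]

namespace CrossedProduct

/-- The matrix coefficient `⟨η, x ξ⟩` of an element of the crossed product in the covariant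
representation `(π, z U)`. -/
def dualCoeff (ρ : CovariantRep α) (ξ η : ρ.space) (z : Circle) : CrossedProduct α →L[ℂ] ℂ :=
  innerSL ℂ η ∘L (ContinuousLinearMap.apply ℂ ρ.space ξ) ∘L (eval (ρ.twist z)).toCLM

theorem dualCoeff_monomial (ρ : CovariantRep α) (ξ η : ρ.space) (z : Circle) (a : A) (n : ℤ) :
    dualCoeff ρ ξ η z (monomial α a n) =
      (z ^ n : Circle) * ⟪η, (ρ.π a * (ρ.U ^ n : unitary (ρ.space →L[ℂ] ρ.space)) :
        ρ.space →L[ℂ] ρ.space) ξ⟫_ℂ := by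
  let V : unitary (ρ.space →L[ℂ] ρ.space) := (unitaryScalar _ z * ρ.U) ^ n
  have hV : (V : ρ.space →L[ℂ] ρ.space) =
      ((z ^ n : Circle) : ℂ) • ((ρ.U ^ n : unitary (ρ.space →L[ℂ] ρ.space)) :
        ρ.space →L[ℂ] ρ.space) := by
    rw [show V = (unitaryScalar _ z * ρ.U) ^ n from rfl, (unitaryScalar_commute z ρ.U).mul_zpow,
      ← map_zpow, Submonoid.coe_mul, coe_unitaryScalar, smul_one_mul]
  have h : dualCoeff ρ ξ η z (monomial α a n) = ⟪η, (ρ.π a * (V : ρ.space →L[ℂ] ρ.space)) ξ⟫_ℂ := rfl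
  rw [h, hV, mul_smul_comm, smul_apply, inner_smul_right]

theorem norm_dualCoeff_le (ρ : CovariantRep α) (ξ η : ρ.space) (z : Circle) (x : CrossedProduct α) :
    ‖dualCoeff ρ ξ η z x‖ ≤ ‖η‖ * ‖ξ‖ * ‖x‖ := by
  refine (norm_inner_le_norm η _).trans ?_
  rw [mul_assoc, mul_comm ‖ξ‖]
  refine mul_le_mul_of_nonneg_left ?_ (norm_nonneg η)
  refine (ContinuousLinearMap.le_opNorm
    (show ρ.space →L[ℂ] ρ.space from eval (ρ.twist z) x) ξ).trans (mul_le_mul_of_nonneg_right ?_ (norm_nonneg ξ))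
  exact NonUnitalStarAlgHom.norm_apply_le (eval (ρ.twist z)) x

/-- For monomials the dependence is $z^n$; the bound `norm_dualCoeff_le`, uniform in $z$, preserves
continuity under norm limits. -/
theorem continuous_dualCoeff (ρ : CovariantRep α) (ξ η : ρ.space) (x : CrossedProduct α) :
    Continuous fun z => dualCoeff ρ ξ η z x := by
  let S : Submodule ℂ (CrossedProduct α) :=
    { carrier := {x | Continuous fun z => dualCoeff ρ ξ η z x}
      zero_mem' := by simp [continuous_const]
      add_mem' := fun {x y} hx hy => by
        change Continuous _
        simp only [map_add]
        exact Continuous.add hx hy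
      smul_mem' := fun c x hx => by
        change Continuous _
        simp only [map_smul]
        exact Continuous.const_smul hx c }
  refine mem_of_isClosed (S := S) (isClosed_of_closure_subset fun y hy => ?_) (fun a n => ?_) x
  · refine continuous_of_uniform_approx_of_continuous fun u hu => ?_
    obtain ⟨ε, hε, hu⟩ := Metric.mem_uniformity_dist.1 hu
    have hC : 0 < ‖η‖ * ‖ξ‖ + 1 := by positivity
    obtain ⟨w, hw, hd⟩ := Metric.mem_closure_iff.1 hy (ε / (‖η‖ * ‖ξ‖ + 1)) (by positivity)
    refine ⟨fun z => dualCoeff ρ ξ η z w, hw, fun z => hu ?_⟩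
    rw [dist_eq_norm] at hd ⊢
    rw [← map_sub]
    refine (norm_dualCoeff_le ρ ξ η z _).trans_lt ?_
    rw [lt_div_iff₀ hC] at hd
    nlinarith [norm_nonneg (y - w)]
  · change Continuous _
    simp only [dualCoeff_monomial, Circle.coe_zpow]
    exact (Continuous.zpow₀ continuous_induced_dom n fun z => Or.inl z.coe_ne_zero).mul
      continuous_const

/-- The matrix coefficients in the covariant representations `(π, z U)` as a continuous function on
the circle. -/
def dualCoeffMap (ρ : CovariantRep α) (ξ η : ρ.space) :
    CrossedProduct α →L[ℂ] C(UnitAddCircle, ℂ) :=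
  LinearMap.mkContinuous
    { toFun := fun x => ⟨fun t => dualCoeff ρ ξ η (AddCircle.toCircle t) x,
        (continuous_dualCoeff ρ ξ η x).comp AddCircle.continuous_toCircle⟩
      map_add' := fun x y => by ext t; simp
      map_smul' := fun c x => by ext t; simp } (‖η‖ * ‖ξ‖) (fun x =>
        (ContinuousMap.norm_le _ (by positivity)).2 fun t => norm_dualCoeff_le ρ ξ η _ x)

theorem dualCoeffMap_apply (ρ : CovariantRep α) (ξ η : ρ.space) (x : CrossedProduct α)
    (t : UnitAddCircle) :
    dualCoeffMap ρ ξ η x t = dualCoeff ρ ξ η (AddCircle.toCircle t) x := rfl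

/-- The Fourier coefficient of a continuous function as a continuous linear functional. -/
def fourierCoeffCLM (n : ℤ) : C(UnitAddCircle, ℂ) →L[ℂ] ℂ :=
  lp.evalCLM ℂ (fun _ : ℤ => ℂ) 2 n ∘L fourierBasis.repr.toLinearIsometry.toContinuousLinearMap ∘L
    ContinuousMap.toLp (E := ℂ) 2 AddCircle.haarAddCircle ℂ

theorem fourierCoeffCLM_apply (n : ℤ) (f : C(UnitAddCircle, ℂ)) :
    fourierCoeffCLM n f = fourierCoeff f n :=
  (fourierBasis_repr _ n).trans (fourierCoeff_toLp f n)

/-- An element of the crossed product all of whose Fourier coefficients vanish is zero. -/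
theorem eq_zero_of_forall_coeff (E : ℤ → CrossedProduct α →L[ℂ] A)
    (hE : ∀ k a n, E k (monomial α a n) = if n = k then a else 0) {x : CrossedProduct α}
    (hx : ∀ k, E k x = 0) : x = 0 := by
  refine ext_eval fun ρ => ?_
  rw [map_zero]
  ext ξ
  rw [zero_apply]
  refine ext_inner_left ℂ fun η => ?_
  rw [inner_zero_right]
  -- The $n$-th Fourier coefficient is $\langle\eta,\pi(E_nx)U^n\xi\rangle$, by comparison on
  -- monomials.
  have h1 : ∀ n, fourierCoeff (dualCoeffMap ρ ξ η x) n = 0 := by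
    intro n
    let G : CrossedProduct α →L[ℂ] ℂ := innerSL ℂ η ∘L (ContinuousLinearMap.apply ℂ ρ.space ξ) ∘L
      (ContinuousLinearMap.mul ℂ (ρ.space →L[ℂ] ρ.space)).flip
        (ρ.U ^ n : unitary (ρ.space →L[ℂ] ρ.space)) ∘L ρ.π.toCLM ∘L E n
    have hG : fourierCoeffCLM n ∘L dualCoeffMap ρ ξ η = G := by
      refine clm_ext fun a m => ?_
      have h2 : dualCoeffMap ρ ξ η (monomial α a m) =
          ⟪η, (ρ.π a * (ρ.U ^ m : unitary (ρ.space →L[ℂ] ρ.space)) :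
            ρ.space →L[ℂ] ρ.space) ξ⟫_ℂ • fourier m := by
        ext t
        rw [dualCoeffMap_apply, dualCoeff_monomial, ContinuousMap.smul_apply, fourier_apply,
          AddCircle.toCircle_zsmul, smul_eq_mul, mul_comm]
      rw [ContinuousLinearMap.comp_apply, h2, map_smul, fourierCoeffCLM_apply, fourierCoeff_fourier]
      simp only [G, ContinuousLinearMap.comp_apply, hE]
      by_cases h : m = n
      · subst h
        simp
      · simp [h, eq_comm (a := n)]
    rw [← fourierCoeffCLM_apply, ← ContinuousLinearMap.comp_apply, hG]
    simp [G, hx]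
  -- A continuous function with vanishing Fourier coefficients vanishes. It is evaluated at $t=0$,
  -- that is $z=1$, where the twisted representation is the original one.
  have h2 := has_pointwise_sum_fourier_series_of_summable (f := dualCoeffMap ρ ξ η x)
    (by rw [show fourierCoeff (dualCoeffMap ρ ξ η x) = 0 from funext h1]; exact summable_zero) 0
  simp only [h1, zero_smul] at h2
  have h3 := h2.unique hasSum_zero
  rw [dualCoeffMap_apply, AddCircle.toCircle_zero] at h3
  rw [← h3]
  let G : CrossedProduct α →L[ℂ] ℂ :=
    innerSL ℂ η ∘L (ContinuousLinearMap.apply ℂ ρ.space ξ) ∘L (eval ρ).toCLM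
  have hG : G = dualCoeff ρ ξ η 1 := clm_ext fun a m => by
    rw [dualCoeff_monomial]
    simp [G, eval_monomial]
  exact congrArg (fun T => T x) hG

end CrossedProduct

end DualAction

/-! ### Multiplier actions of $\mathcal A$ and $\mathcal A\rtimes_\alpha\mathbb Z$. -/

/-- A representation whose image idealizes the image of a faithful representation of `C` induces a
homomorphism into the multiplier algebra of `C`. -/
theorem DoubleCentralizer.exists_hom_of_idealizer {B C L : Type*} [NonUnitalCStarAlgebra B]
    [NonUnitalCStarAlgebra C] [CStarAlgebra L] {θ : C →⋆ₙₐ[ℂ] L} (hθ : Function.Injective θ)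
    (Φ : B →⋆ₙₐ[ℂ] L) (h₁ : ∀ x y, Φ x * θ y ∈ Set.range θ) (h₂ : ∀ x y, θ y * Φ x ∈ Set.range θ) :
    ∃ M : B →⋆ₙₐ[ℂ] 𝓜(ℂ, C),
      ∀ x y, θ ((M x).fst y) = Φ x * θ y ∧ θ ((M x).snd y) = θ y * Φ x := by
  have hl : ∀ x, ∃ T : C →L[ℂ] C, ∀ y, θ (T y) = Φ x * θ y := fun x =>
    θ.exists_lift hθ (ContinuousLinearMap.mul ℂ L (Φ x) ∘L θ.toCLM) (h₁ x)
  have hr : ∀ x, ∃ T : C →L[ℂ] C, ∀ y, θ (T y) = θ y * Φ x := fun x =>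
    θ.exists_lift hθ ((ContinuousLinearMap.mul ℂ L).flip (Φ x) ∘L θ.toCLM) (h₂ x)
  choose l hl using hl
  choose r hr using hr
  refine ⟨{
    toFun := fun x => ⟨(l x, r x), fun y z => hθ (by
      change θ (r x y * z) = θ (y * l x z)
      rw [map_mul, map_mul, hl, hr, mul_assoc])⟩
    map_smul' := fun c x => ?_
    map_zero' := ?_
    map_add' := fun x y => ?_
    map_mul' := fun x y => ?_
    map_star' := fun x => ?_ }, fun x y => ⟨hl x y, hr x y⟩⟩ <;>
  refine DoubleCentralizer.ext _ _ _ _ (Prod.ext (ContinuousLinearMap.ext fun z => hθ ?_)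
    (ContinuousLinearMap.ext fun z => hθ ?_))
  · change θ (l (c • x) z) = θ (c • l x z)
    rw [map_smul, hl, hl, map_smul, smul_mul_assoc]
  · change θ (r (c • x) z) = θ (c • r x z)
    rw [map_smul, hr, hr, map_smul, mul_smul_comm]
  · change θ (l 0 z) = θ 0
    rw [hl, map_zero, map_zero, zero_mul]
  · change θ (r 0 z) = θ 0
    rw [hr, map_zero, map_zero, mul_zero]
  · change θ (l (x + y) z) = θ (l x z + l y z)
    rw [map_add, hl, hl, hl, map_add, add_mul]
  · change θ (r (x + y) z) = θ (r x z + r y z)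
    rw [map_add, hr, hr, hr, map_add, mul_add]
  · change θ (l (x * y) z) = θ (l x (l y z))
    rw [hl, hl, hl, map_mul, mul_assoc]
  · change θ (r (x * y) z) = θ (r y (r x z))
    rw [hr, hr, hr, map_mul, mul_assoc]
  · change θ (l (star x) z) = θ (star (r x (star z)))
    rw [map_star, hl, hr, star_mul, map_star, map_star, star_star]
  · change θ (r (star x) z) = θ (star (l x (star z)))
    rw [map_star, hl, hr, star_mul, map_star, map_star, star_star]

section Multipliers

variable {A : Type u} [NonUnitalCStarAlgebra A]

/-- The map `(bₙ)ₙ ↦ (a bₙ)ₙ`. -/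
def C0_constMul (a : A) : C₀(ℤ, A) →L[ℂ] C₀(ℤ, A) :=
  LinearMap.mkContinuous
    { toFun := fun b => C0_mk (fun n => a * b n) (by
        have h := zero_at_infty b
        rw [Filter.cocompact_eq_cofinite] at h
        simpa using h.const_mul a)
      map_add' := fun b c => by ext n; simp [mul_add]
      map_smul' := fun c b => by ext n; simp [mul_smul_comm] } ‖a‖
    (fun b => C0_norm_le (by positivity) fun n =>
      (norm_mul_le _ _).trans (mul_le_mul_of_nonneg_left (C0_norm_apply_le b n) (norm_nonneg a)))

/-- The map `(bₙ)ₙ ↦ (bₙ a)ₙ`. -/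
def C0_mulConst (a : A) : C₀(ℤ, A) →L[ℂ] C₀(ℤ, A) :=
  LinearMap.mkContinuous
    { toFun := fun b => C0_mk (fun n => b n * a) (by
        have h := zero_at_infty b
        rw [Filter.cocompact_eq_cofinite] at h
        simpa using h.mul_const a)
      map_add' := fun b c => by ext n; simp [add_mul]
      map_smul' := fun c b => by ext n; simp [smul_mul_assoc] } ‖a‖
    (fun b => C0_norm_le (by positivity) fun n =>
      (norm_mul_le _ _).trans ((mul_le_mul_of_nonneg_right (C0_norm_apply_le b n)
        (norm_nonneg a)).trans_eq (mul_comm _ _)))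

variable (A) in
/-- The action of `A` on `C₀(ℤ, A)` as an algebra of multipliers. -/
def C0_multiplier : A →⋆ₙₐ[ℂ] 𝓜(ℂ, C₀(ℤ, A)) where
  toFun a := ⟨(C0_constMul a, C0_mulConst a), fun b c => by
    ext n
    exact mul_assoc (b n) a (c n)⟩
  map_smul' c a := DoubleCentralizer.ext _ _ _ _ (Prod.ext
    (ContinuousLinearMap.ext fun b => ZeroAtInftyContinuousMap.ext fun n => smul_mul_assoc c a (b n))
    (ContinuousLinearMap.ext fun b => ZeroAtInftyContinuousMap.ext fun n => mul_smul_comm c (b n) a))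
  map_zero' := DoubleCentralizer.ext _ _ _ _ (Prod.ext
    (ContinuousLinearMap.ext fun b => ZeroAtInftyContinuousMap.ext fun n => zero_mul (b n))
    (ContinuousLinearMap.ext fun b => ZeroAtInftyContinuousMap.ext fun n => mul_zero (b n)))
  map_add' a a' := DoubleCentralizer.ext _ _ _ _ (Prod.ext
    (ContinuousLinearMap.ext fun b => ZeroAtInftyContinuousMap.ext fun n => add_mul a a' (b n))
    (ContinuousLinearMap.ext fun b => ZeroAtInftyContinuousMap.ext fun n => mul_add (b n) a a'))
  map_mul' a a' := DoubleCentralizer.ext _ _ _ _ (Prod.ext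
    (ContinuousLinearMap.ext fun b => ZeroAtInftyContinuousMap.ext fun n => mul_assoc a a' (b n))
    (ContinuousLinearMap.ext fun b => ZeroAtInftyContinuousMap.ext fun n =>
      (mul_assoc (b n) a a').symm))
  map_star' a := DoubleCentralizer.ext _ _ _ _ (Prod.ext
    (ContinuousLinearMap.ext fun b => ZeroAtInftyContinuousMap.ext fun n => by
      change star a * b n = star (star (b n) * a)
      rw [star_mul, star_star])
    (ContinuousLinearMap.ext fun b => ZeroAtInftyContinuousMap.ext fun n => by
      change b n * star a = star (a * star (b n))
      rw [star_mul, star_star]))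

theorem C0_multiplier_fst_apply (a : A) (b : C₀(ℤ, A)) (n : ℤ) :
    (C0_multiplier A a).fst b n = a * b n := rfl

theorem C0_multiplier_snd_apply (a : A) (b : C₀(ℤ, A)) (n : ℤ) :
    (C0_multiplier A a).snd b n = b n * a := rfl

theorem C0_multiplier_injective : Function.Injective (C0_multiplier A) := by
  rw [injective_iff_map_eq_zero]
  intro a ha
  have h := C0_multiplier_fst_apply a (C0_single 0 (star a)) 0
  rw [ha, C0_single_apply, if_pos rfl] at h
  exact CStarRing.mul_star_self_eq_zero_iff a |>.1 h.symm

variable {H : Type u} [NormedAddCommGroup H] [InnerProductSpace ℂ H] [CompleteSpace H]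
  {π₀ : A →⋆ₙₐ[ℂ] (H →L[ℂ] H)} {α : A ≃⋆ₐ[ℂ] A}

theorem regularCrossedRep_mul_bundleCrossedRep (a : A) (k : ℤ) (b : C₀(ℤ, A)) (l : ℤ) :
    regularCrossedRep π₀ α (CrossedProduct.monomial α a k) *
        bundleCrossedRep π₀ α (CrossedProduct.monomial (bundleAut α) b l) =
      bundleCrossedRep π₀ α (CrossedProduct.monomial (bundleAut α)
        ((C0_multiplier A a).fst ((bundleAut α ^ k) b)) (k + l)) := by
  ext f j
  rw [mul_apply_eq_comp, regularCrossedRep_monomial, bundleCrossedRep_monomial,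
    bundleCrossedRep_monomial, C0_multiplier_fst_apply, bundleAut_zpow_apply, map_mul, map_mul,
    mul_apply_eq_comp, ← StarAlgEquiv.zpow_add_apply]
  simp only [sub_sub, neg_sub', sub_neg_eq_add, add_comm]

theorem bundleCrossedRep_mul_regularCrossedRep (a : A) (k : ℤ) (b : C₀(ℤ, A)) (l : ℤ) :
    bundleCrossedRep π₀ α (CrossedProduct.monomial (bundleAut α) b l) *
        regularCrossedRep π₀ α (CrossedProduct.monomial α a k) =
      bundleCrossedRep π₀ α (CrossedProduct.monomial (bundleAut α)
        ((C0_multiplier A ((α ^ l) a)).snd b) (l + k)) := by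
  ext f j
  rw [mul_apply_eq_comp, bundleCrossedRep_monomial, regularCrossedRep_monomial,
    bundleCrossedRep_monomial, C0_multiplier_snd_apply, map_mul, map_mul,
    mul_apply_eq_comp, ← StarAlgEquiv.zpow_add_apply]
  simp only [sub_sub, neg_sub', sub_neg_eq_add, add_comm]

/-- Products of monomials from the two representations are again in the image of the second, which
is closed; two successive density arguments extend this to all $x$ and $y$. -/
theorem exists_crossedProduct_multiplier (hθ : Function.Injective (bundleCrossedRep π₀ α)) :
    ∃ M : CrossedProduct α →⋆ₙₐ[ℂ] 𝓜(ℂ, CrossedProduct (bundleAut α)), ∀ x y,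
      bundleCrossedRep π₀ α ((M x).fst y) = regularCrossedRep π₀ α x * bundleCrossedRep π₀ α y ∧
      bundleCrossedRep π₀ α ((M x).snd y) = bundleCrossedRep π₀ α y * regularCrossedRep π₀ α x := by
  let L := BundleSpace H →L[ℂ] BundleSpace H
  let R : Submodule ℂ L := LinearMap.range (bundleCrossedRep π₀ α).toCLM.toLinearMap
  have hR : IsClosed (R : Set L) := (bundleCrossedRep π₀ α).isClosed_range hθ
  refine DoubleCentralizer.exists_hom_of_idealizer hθ _ (fun x y => ?_) (fun x y => ?_)
  · let F : CrossedProduct α → CrossedProduct (bundleAut α) →L[ℂ] L := fun x =>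
      ContinuousLinearMap.mul ℂ L (regularCrossedRep π₀ α x) ∘L (bundleCrossedRep π₀ α).toCLM
    let G : CrossedProduct (bundleAut α) → CrossedProduct α →L[ℂ] L := fun y =>
      (ContinuousLinearMap.mul ℂ L).flip (bundleCrossedRep π₀ α y) ∘L (regularCrossedRep π₀ α).toCLM
    refine CrossedProduct.mem_of_isClosed (S := R.comap (G y).toLinearMap)
      (hR.preimage (G y).continuous) (fun a k => ?_) x
    refine CrossedProduct.mem_of_isClosed (S := R.comap (F (CrossedProduct.monomial α a k)).toLinearMap)
      (hR.preimage (F _).continuous) (fun b l => ?_) y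
    exact ⟨CrossedProduct.monomial _ _ _, (regularCrossedRep_mul_bundleCrossedRep (π₀ := π₀) (α := α) a k b l).symm⟩
  · let F : CrossedProduct α → CrossedProduct (bundleAut α) →L[ℂ] L := fun x =>
      (ContinuousLinearMap.mul ℂ L).flip (regularCrossedRep π₀ α x) ∘L (bundleCrossedRep π₀ α).toCLM
    let G : CrossedProduct (bundleAut α) → CrossedProduct α →L[ℂ] L := fun y =>
      ContinuousLinearMap.mul ℂ L (bundleCrossedRep π₀ α y) ∘L (regularCrossedRep π₀ α).toCLM
    refine CrossedProduct.mem_of_isClosed (S := R.comap (G y).toLinearMap)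
      (hR.preimage (G y).continuous) (fun a k => ?_) x
    refine CrossedProduct.mem_of_isClosed (S := R.comap (F (CrossedProduct.monomial α a k)).toLinearMap)
      (hR.preimage (F _).continuous) (fun b l => ?_) y
    exact ⟨CrossedProduct.monomial _ _ _, (bundleCrossedRep_mul_regularCrossedRep (π₀ := π₀) (α := α) a k b l).symm⟩

/-- In row $0$ there is no twist by $\alpha$, and $au^k$ reads column $-k$; this entry is the $k$-th
Fourier coefficient. -/
theorem exists_crossedProduct_coeff (hπ : Function.Injective π₀) (k : ℤ) :
    ∃ E : CrossedProduct α →L[ℂ] A, ∀ x,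
      π₀ (E x) = lpCoeff ((0, 1, 0) : ℤ × ℕ+ × Fin 4) (-k, 1, 0) (regularCrossedRep π₀ α x) := by
  let Ψ : CrossedProduct α →L[ℂ] (H →L[ℂ] H) :=
    lpCoeff ((0, 1, 0) : ℤ × ℕ+ × Fin 4) (-k, 1, 0) ∘L (regularCrossedRep π₀ α).toCLM
  refine π₀.exists_lift hπ Ψ fun x => ?_
  refine CrossedProduct.mem_of_isClosed
    (S := (LinearMap.range π₀.toCLM.toLinearMap).comap Ψ.toLinearMap)
    ((π₀.isClosed_range hπ).preimage Ψ.continuous) (fun a n => ?_) x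
  refine ⟨if n = k then a else 0, ?_⟩
  ext v
  change π₀ _ v = regularCrossedRep π₀ α (CrossedProduct.monomial α a n)
    (lp.single 2 (-k, 1, 0) v) (0, 1, 0)
  rw [regularCrossedRep_monomial, lp_single_apply_eq_ite]
  by_cases h : n = k <;> simp [h]

theorem regularCrossedRep_injective (hπ : Function.Injective π₀) :
    Function.Injective (regularCrossedRep π₀ α) := by
  rw [injective_iff_map_eq_zero]
  intro x hx
  choose E hE using exists_crossedProduct_coeff (α := α) hπ
  refine CrossedProduct.eq_zero_of_forall_coeff E (fun k a n => hπ ?_) (fun k => hπ ?_)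
  · ext v
    rw [hE, lpCoeff_apply, regularCrossedRep_monomial, lp_single_apply_eq_ite]
    by_cases h : n = k <;> simp [h]
  · rw [hE, hx, map_zero, map_zero]

end Multipliers

/-! ### The main theorem. -/

theorem mainTheorem3 {A H : Type u} [NonUnitalCStarAlgebra A]
    [NormedAddCommGroup H] [InnerProductSpace ℂ H] [CompleteSpace H]
    (X : SpectralTriple A H) (hX : X.IsSpectralMetricSpace)
    (α : A ≃⋆ₐ[ℂ] A) (hα : X.IsQuasiIsometry α) (hne : ¬ X.IsEquicontinuous α) :
    -- a spectral metric space `Y` on `A ⊗ c₀(ℤ)`, the metric bundle over `(X, α)`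
    ∃ (𝔡 : BundleData) (Y : SpectralTriple C₀(ℤ, A) (BundleSpace H)),
      Y.IsMetricBundle X α 𝔡 ∧ Y.IsSpectralMetricSpace ∧
      -- (i) `A` acts on `Y` as a multiplier algebra
      ∃ m : A →⋆ₙₐ[ℂ] 𝓜(ℂ, C₀(ℤ, A)), Function.Injective m ∧
        (∀ (a : A) (b : C₀(ℤ, A)) (n : ℤ),
          (m a).fst b n = a * b n ∧ (m a).snd b n = b n * a) ∧
      -- (ii) `α` implements an equicontinuous action `α_*` on `Y`
      Y.IsEquicontinuous (bundleAut α) ∧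
      -- (iii) a spectral metric space `Z` on `(A ⊗ c₀(ℤ)) ⋊ ℤ` extending `Y`
      ∃ Z : SpectralTriple (CrossedProduct (bundleAut α)) (BundleSpace H),
        Z.D = Y.D ∧
        (∀ (b : C₀(ℤ, A)) (l : ℤ) (f : BundleSpace H) (n : ℤ) (r : ℕ+) (i : Fin 4),
          Z.rep (CrossedProduct.monomial (bundleAut α) b l) f (n, r, i)
            = X.rep ((α ^ (-n)) (b n)) (f (n - l, r, i))) ∧
        Z.IsSpectralMetricSpace ∧
        -- on which `A ⋊ ℤ` acts as a multiplier algebra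
        ∃ M : CrossedProduct α →⋆ₙₐ[ℂ] 𝓜(ℂ, CrossedProduct (bundleAut α)),
          Function.Injective M ∧
          ∀ (a : A) (k : ℤ) (b : C₀(ℤ, A)) (l : ℤ),
            (M (CrossedProduct.monomial α a k)).fst
                (CrossedProduct.monomial (bundleAut α) b l)
              = CrossedProduct.monomial (bundleAut α)
                  ((m a).fst ((bundleAut α ^ k) b)) (k + l) ∧
            (M (CrossedProduct.monomial α a k)).snd
                (CrossedProduct.monomial (bundleAut α) b l)
              = CrossedProduct.monomial (bundleAut α)
                  ((m ((α ^ l) a)).snd b) (l + k) := by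
  have hπ := hX.rep_injective hne
  have := SpectralTriple.nontrivial_of_not_isEquicontinuous hne
  obtain ⟨h₀, hh₀, -⟩ := hX.precompact
  have hθ : Function.Injective (bundleCrossedRep X.rep α) := bundleCrossedRep_injective hπ hh₀.2
  obtain ⟨M, hM⟩ := exists_crossedProduct_multiplier hθ
  refine ⟨discreteBundleData, X.metricBundle α, X.isMetricBundle_metricBundle α,
    hX.metricBundle hπ α, C0_multiplier A, C0_multiplier_injective, fun a b n => ⟨rfl, rfl⟩,
    X.isEquicontinuous_metricBundle α, X.crossedBundle α, rfl,
    fun b l f n r i => bundleCrossedRep_monomial X.rep α b l f (n, r, i),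
    hX.crossedBundle hπ α, M, ?_, fun a k b l => ⟨hθ ?_, hθ ?_⟩⟩
  -- If `M x = 0`, the regular representation of `x` annihilates the range of the nondegenerate
  -- representation of $Z$, hence is zero, and it is faithful.
  · rw [injective_iff_map_eq_zero]
    intro x hx
    have h0 : ∀ y, regularCrossedRep X.rep α x * bundleCrossedRep X.rep α y = 0 := fun y => by
      rw [← (hM x y).1, hx]
      exact map_zero _
    refine regularCrossedRep_injective hπ ?_
    rw [map_zero]
    refine ContinuousLinearMap.coeFn_injective (Continuous.ext_on
      (hX.crossedBundle hπ α).nondegenerate (ContinuousLinearMap.continuous _)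
      (ContinuousLinearMap.continuous _) ?_)
    refine LinearMap.eqOn_span (f := (regularCrossedRep X.rep α x).toLinearMap) (g := 0) ?_
    rintro _ ⟨y, f, rfl⟩
    exact congrArg (fun T : BundleSpace H →L[ℂ] BundleSpace H => T f) (h0 y)
  · rw [(hM _ _).1, regularCrossedRep_mul_bundleCrossedRep]
  · rw [(hM _ _).2, bundleCrossedRep_mul_regularCrossedRep]

end
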